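/- Let $\beta>0$. There is a constant $C>0$, depending only on $\beta$, such that the following holds for every integer $N\ge 2$ with $N<\beta$ and every integer $n\ge 1$. Let $I_\nu(x)=\sum_{k\ge 0}\frac{(x/2)^{2k+\nu}}{k!\,\Gamma(k+\nu+1)}$ be the modified Bessel function of the first kind, let $f(x)=I_{N/2}(x)/I_{N/2-1}(x)$ for $x>0$, and let $b$ be the unique strictly positive solution of $x-\beta f(x)=0$. Let $\mu$ be the uniform probability measure on the unit sphere $\mathbb S^{N-1}\subset\mathbb R^N$, and let $\sigma=(\sigma_1,\dots,\sigma_n)$ be a random element of $(\mathbb S^{N-1})^n$ distributed according to the Gibbs measure $$\frac1{Z_{n,\beta}}\exp(-\beta H_n(\sigma))\,d\mu^{\otimes n}(\sigma),\qquad H_n(\sigma)=-\frac1{2n}\sum_{i,j=1}^n\langle\sigma_i,\sigma_j\rangle,\qquad Z_{n,\beta}=\int \exp(-\beta H_n)\,d\mu^{\otimes n}.$$ Let $\sigma'=(\sigma'_1,\dots,\sigma'_n)$ be such that for each $i$, given $(\sigma_j)_{j\ne i}$, the spin $\sigma_i'$ has the same conditional distribution as $\sigma_i$ and is conditionally independent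 of $\sigma_i$. Let $I$ be uniformly distributed on $\{1,\dots,n\}$ and independent of $(\sigma,\sigma')$. Put $S_n=\sum_{j=1}^n\sigma_j$, $S_n'=S_n-\sigma_I+\sigma_I'$, $$W_n=\sqrt n\Big(\frac{\beta^2}{n^2b^2}|S_n|^2-1\Big),\qquad W_n'=\sqrt n\Big(\frac{\beta^2}{n^2b^2}|S_n'|^2-1\Big),$$ $$\lambda=\frac{1-\beta f'(b)}{n},\qquad B^2=\frac{4\beta^2}{(1-\beta f'(b))\,b^2}\Big[1-\frac{(N-1)f(b)}{b}-f(b)^2\Big].$$ Then: (i) $|W_n-W_n'|\le 4\beta^2b^{-2}n^{-1/2}$ and $E W_n^2\le C$; (ii) $E(W_n-W_n'\mid W_n)=\lambda(W_n+R)$ almost surely, for some random variable $R$ with $E|R|\le C n^{-1/2}$; (iii) $E\left|\frac{1}{2\lambda}E\big((W_n-W_n')^2\mid W_n\big)-B^2\right|\le C n^{-1/2}$. -/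

import Mathlib

open MeasureTheory ProbabilityTheory
open scoped ENNReal RealInnerProductSpace

noncomputable section

/-- The modified Bessel function of the first kind
`I_ν(x) = ∑_{k ≥ 0} (x/2)^(2k+ν) / (k! Γ(k+ν+1))`, for `ν ≥ 0` and `x > 0`. -/
def besselI (ν x : ℝ) : ℝ :=
  ∑' k : ℕ, (x / 2) ^ (2 * (k : ℝ) + ν) / ((Nat.factorial k : ℝ) * Real.Gamma ((k : ℝ) + ν + 1))

/-- The ratio `f(x) = I_{N/2}(x) / I_{N/2-1}(x)`. -/
def besselRatio (N : ℕ) (x : ℝ) : ℝ :=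
  besselI ((N : ℝ) / 2) x / besselI ((N : ℝ) / 2 - 1) x

/-- The unit sphere of `ℝ^N` (Euclidean norm). -/
abbrev Spin (N : ℕ) : Type := Metric.sphere (0 : EuclideanSpace ℝ (Fin N)) 1

/-- Spin configurations on `n` vertices. -/
abbrev SpinConfig (N n : ℕ) : Type := Fin n → Spin N

/-- The uniform probability measure on the unit sphere: normalized surface measure. -/
def sphereUniform (N : ℕ) : Measure (Spin N) :=
  ((volume : Measure (EuclideanSpace ℝ (Fin N))).toSphere Set.univ)⁻¹ •
    (volume : Measure (EuclideanSpace ℝ (Fin N))).toSphere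

/-- The mean-field Hamiltonian `H_n(σ) = -(1/(2n)) ∑_i ∑_j ⟨σ_i, σ_j⟩`. -/
def hamiltonian {N n : ℕ} (σ : SpinConfig N n) : ℝ :=
  -(1 / (2 * (n : ℝ))) *
    ∑ i, ∑ j, ⟪(σ i : EuclideanSpace ℝ (Fin N)), (σ j : EuclideanSpace ℝ (Fin N))⟫

/-- The Gibbs measure: density `exp(-β H_n) / Z_{n,β}` with respect to the product of uniform
measures, where `Z_{n,β} = ∫ exp(-β H_n)`. -/
def gibbsMeasure (N n : ℕ) (β : ℝ) : Measure (SpinConfig N n) :=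
  (Measure.pi fun _ : Fin n => sphereUniform N).tilted fun σ => -β * hamiltonian σ

/-- `X'` is a conditionally independent copy of `X` given the σ-algebra `m`: given `m`, the two
have the same conditional distribution and are conditionally independent. -/
structure IsCondIndepCopy {Ω E : Type*} [MeasurableSpace Ω] [MeasurableSpace E]
    (P : Measure Ω) (m : MeasurableSpace Ω) (X X' : Ω → E) : Prop where
  same_law : ∀ A : Set E, MeasurableSet A → P⟦X' ⁻¹' A|m⟧ =ᵐ[P] P⟦X ⁻¹' A|m⟧
  cond_indep : ∀ A A' : Set E, MeasurableSet A → MeasurableSet A' →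
    P⟦X ⁻¹' A ∩ X' ⁻¹' A'|m⟧ =ᵐ[P] P⟦X ⁻¹' A|m⟧ * P⟦X' ⁻¹' A'|m⟧

/-- The σ-algebra on `Ω` generated by the spins `σ_j`, `j ≠ i`. -/
abbrev otherSpins {Ω : Type*} {N n : ℕ} (σ : Ω → SpinConfig N n) (i : Fin n) : MeasurableSpace Ω :=
  MeasurableSpace.comap (fun ω (j : {j : Fin n // j ≠ i}) => σ ω j) inferInstance

/-- The random elements behind the exchangeable pair: `σ` is distributed according to the Gibbs
measure, each `σ'_i` is a conditionally independent copy of `σ_i` given `(σ_j)_{j ≠ i}`, and `I` is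
a uniformly distributed index that is independent of `(σ, σ')`. -/
structure IsResampling {Ω : Type*} [MeasurableSpace Ω] (P : Measure Ω) {N n : ℕ} (β : ℝ)
    (σ σ' : Ω → SpinConfig N n) (I : Ω → Fin n) : Prop where
  measurable_spin : Measurable σ
  measurable_copy : Measurable σ'
  measurable_index : Measurable I
  law_spin : P.map σ = gibbsMeasure N n β
  copy : ∀ i, IsCondIndepCopy P (otherSpins σ i) (fun ω => σ ω i) (fun ω => σ' ω i)
  uniform_index : ∀ i, P (I ⁻¹' {i}) = (n : ℝ≥0∞)⁻¹
  indep_index : IndepFun I (fun ω => (σ ω, σ' ω)) P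

/-- The total spin `S_n = ∑_i σ_i`. -/
def totalSpin {N n : ℕ} (σ : SpinConfig N n) : EuclideanSpace ℝ (Fin N) :=
  ∑ i, (σ i : EuclideanSpace ℝ (Fin N))

/-- The total spin `S_n' = S_n - σ_I + σ'_I` after the spin at `i = I` has been resampled. -/
def totalSpin' {N n : ℕ} (σ σ' : SpinConfig N n) (i : Fin n) : EuclideanSpace ℝ (Fin N) :=
  totalSpin σ - (σ i : EuclideanSpace ℝ (Fin N)) + (σ' i : EuclideanSpace ℝ (Fin N))

/-- `√n (β² |S|² / (n² b²) - 1)`, the normalized fluctuation of the squared length of `S`. -/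
def fluctuation {N : ℕ} (n : ℕ) (β b : ℝ) (S : EuclideanSpace ℝ (Fin N)) : ℝ :=
  √(n : ℝ) * (β ^ 2 / ((n : ℝ) ^ 2 * b ^ 2) * ‖S‖ ^ 2 - 1)

/-- The constant
`B² = 4β² / ((1 - β f'(b)) b²) * (1 - (N-1) f(b) / b - f(b)²)`. -/
def limitVariance (N : ℕ) (β b : ℝ) : ℝ :=
  4 * β ^ 2 / ((1 - β * deriv (besselRatio N) b) * b ^ 2) *
    (1 - ((N : ℝ) - 1) * besselRatio N b / b - besselRatio N b ^ 2)

end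

/-! Everything is expressed through θ = (β/n)S and τ = |θ|², since W = (√n/b²)(τ - b²). Given the
other spins, σ_i has density proportional to exp⟨θ_i, s⟩ with θ_i = (β/n)(S - σ_i), and resampling
at i lowers τ by (2β/n)(⟨θ_i, σ_i⟩ - ⟨θ_i, σ_i'⟩). The moment generating function of the sphere is a
Bessel function (`integral_exp_inner`). With p(t) = f(√t)/√t, the conditional mean of ⟨θ_i, σ_i'⟩ is
therefore |θ_i|² p(|θ_i|²), and the conditional second moment is explicit in p as well
(`sphere_moments`).

Averaging over i and replacing |θ_i|² by τ at a cost O(1/n), the drift of τ is proportional to τ(1 -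
βp(τ)), which vanishes at b². Turán's inequality makes p strictly decreasing. Hence b is unique, 1 -
βf'(b) = -2βb²p'(b²) is positive, and linearising at b² gives (ii) up to a remainder of order (τ -
b²)² + 1/n.

All of this rests on E(τ - b²)² = O(1/n) (`exists_second_moment_bound`). Resampling preserves the
Gibbs measure, so φ = τ - b² satisfies E(φ - φ')φ = ½E(φ - φ')² = O(1/n²), which bounds the
correlation of φ with the drift by O(1/n). On the other hand φτ(1 - βp(τ)) ≥ cφ² as long as τ stays
away from the other zero of the drift, τ = 0. Small τ is exponentially unlikely because the
partition function grows exponentially when β > N (`exists_partition_lower`).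

For (iii), the squared increment involves the average of ⟨θ_i, σ_i⟩², where each term is replaced by
its conditional mean. The errors are centred and nearly uncorrelated: leaving σ_i out of the field
at j changes the defect at j by O(1/n) only. Their average is thus O(n^(-1/2)) in L², and τ is then
replaced by b².

The constants so obtained depend on N and b, but only finitely many N lie below β and each has at
most one b, so their sum depends on β alone. -/

/-! ### Bessel series with the power of x factored out -/

/-- The entire function `∑ (t/4)^k / (k! Γ(k+ν+1))`, so that `I_ν(x) = (x/2)^ν besselEntire ν (x²)`. -/
noncomputable def besselEntire (ν t : ℝ) : ℝ :=
  ∑' k : ℕ, (t / 4) ^ k / ((Nat.factorial k : ℝ) * Real.Gamma ((k : ℝ) + ν + 1))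

/-- Each step of the recursion multiplies by k + ν + 1 ≥ 1. Only integer shifts are compared because
Γ is not monotone on all of [1, ∞). -/
theorem Gamma_le_Gamma_nat_add {ν : ℝ} (hν : 0 ≤ ν) (k : ℕ) :
    Real.Gamma (ν + 1) ≤ Real.Gamma ((k : ℝ) + ν + 1) := by
  induction k with
  | zero => simp
  | succ k ih =>
    have h1 : ((k + 1 : ℕ) : ℝ) + ν + 1 = ((k : ℝ) + ν + 1) + 1 := by push_cast; ring
    have hk : (0 : ℝ) ≤ k := Nat.cast_nonneg k
    have hpos : 0 < Real.Gamma ((k : ℝ) + ν + 1) := Real.Gamma_pos_of_pos (by positivity)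
    rw [h1, Real.Gamma_add_one (s := (k : ℝ) + ν + 1) (by positivity)]
    nlinarith

theorem norm_besselEntire_term_le {ν : ℝ} (hν : 0 ≤ ν) (t : ℝ) (k : ℕ) :
    ‖(t / 4) ^ k / ((Nat.factorial k : ℝ) * Real.Gamma ((k : ℝ) + ν + 1))‖ ≤
      (|t| / 4) ^ k / (Nat.factorial k : ℝ) * (Real.Gamma (ν + 1))⁻¹ := by
  have h0 : 0 < Real.Gamma (ν + 1) := Real.Gamma_pos_of_pos (by positivity)
  have h1 := Gamma_le_Gamma_nat_add hν k
  have h2 : 0 < Real.Gamma ((k : ℝ) + ν + 1) := h0.trans_le h1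
  rw [norm_div, norm_pow, norm_div, norm_mul, Real.norm_eq_abs, Real.norm_of_nonneg h2.le]
  simp only [Real.norm_eq_abs, Nat.abs_cast, Nat.abs_ofNat]
  rw [← div_eq_mul_inv, div_div]
  gcongr

theorem summable_besselEntire {ν : ℝ} (hν : 0 ≤ ν) (t : ℝ) :
    Summable fun k : ℕ => (t / 4) ^ k / ((Nat.factorial k : ℝ) * Real.Gamma ((k : ℝ) + ν + 1)) :=
  .of_norm_bounded ((Real.summable_pow_div_factorial _).mul_right _)
    (norm_besselEntire_term_le hν t)

/-- Termwise differentiation; cancelling k against k! and shifting the index raises ν by one. -/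
theorem hasDerivAt_besselEntire {ν : ℝ} (hν : 0 ≤ ν) (t : ℝ) :
    HasDerivAt (besselEntire ν) (besselEntire (ν + 1) t / 4) t := by
  have hν1 : 0 ≤ ν + 1 := by positivity
  set g' : ℕ → ℝ → ℝ := fun k y =>
    (k : ℝ) * (y / 4) ^ (k - 1) * (1 / 4) /
      ((Nat.factorial k : ℝ) * Real.Gamma ((k : ℝ) + ν + 1)) with hg'
  have hsucc : ∀ (k : ℕ) (y : ℝ), g' (k + 1) y =
      (y / 4) ^ k / ((Nat.factorial k : ℝ) * Real.Gamma ((k : ℝ) + (ν + 1) + 1)) / 4 := by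
    intro k y
    have h1 : ((k + 1 : ℕ) : ℝ) + ν + 1 = (k : ℝ) + (ν + 1) + 1 := by push_cast; ring
    have h2 : Real.Gamma ((k : ℝ) + (ν + 1) + 1) ≠ 0 :=
      (Real.Gamma_pos_of_pos (by positivity)).ne'
    simp only [hg', h1, Nat.factorial_succ, Nat.add_sub_cancel]
    push_cast
    field_simp
  have hzero : ∀ y, g' 0 y = 0 := fun y => by simp [hg']
  -- On the ball of radius |t| + 1 every differentiated term is dominated by its value at the
  -- endpoint, where all terms are nonnegative and the shifted series converges.
  have hbound : ∀ (k : ℕ) (y : ℝ), y ∈ Metric.ball (0 : ℝ) (|t| + 1) → ‖g' k y‖ ≤ ‖g' k (|t| + 1)‖ := by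
    intro k y hy
    have hy' : |y| ≤ |t| + 1 := by
      rw [Metric.mem_ball, dist_zero_right, Real.norm_eq_abs] at hy
      exact hy.le
    have : |(|t| + 1)| = |t| + 1 := abs_of_nonneg (by positivity)
    simp only [hg', norm_div, norm_mul, norm_pow, Real.norm_eq_abs, this]
    gcongr
  have hsum : Summable fun k => ‖g' k (|t| + 1)‖ := by
    rw [← summable_nat_add_iff 1]
    simp only [hsucc]
    exact ((summable_besselEntire hν1 (|t| + 1)).norm.div_const 4).congr fun k => by simp
  have key := hasDerivAt_tsum_of_isPreconnected (u := fun k => ‖g' k (|t| + 1)‖)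
    (g := fun k y => (y / 4) ^ k / ((Nat.factorial k : ℝ) * Real.Gamma ((k : ℝ) + ν + 1)))
    (g' := g') (y₀ := t) (y := t) hsum Metric.isOpen_ball
    (convex_ball (0 : ℝ) (|t| + 1)).isPreconnected ?_ hbound (by simp) (summable_besselEntire hν t)
    (by simp)
  · have hs : Summable fun k => g' k t := by
      refine .of_norm_bounded hsum fun k => hbound k t (by simp)
    rw [hs.tsum_eq_zero_add, hzero, zero_add] at key
    simp only [hsucc] at key
    rwa [tsum_div_const] at key
  · intro k y _
    exact (((hasDerivAt_id y).div_const 4).pow k).div_const _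

/-- From Γ(k + ν + 2) = (k + ν + 1)Γ(k + ν + 1): split the factor as (ν + 1) + k, and let the
summand k shift the index. -/
theorem besselEntire_recurrence {ν : ℝ} (hν : 0 ≤ ν) (t : ℝ) :
    besselEntire ν t = (ν + 1) * besselEntire (ν + 1) t + t / 4 * besselEntire (ν + 2) t := by
  have hν1 : 0 ≤ ν + 1 := by positivity
  have hν2 : 0 ≤ ν + 2 := by positivity
  have hshift : HasSum (fun k : ℕ => (k : ℝ) * (t / 4) ^ k /
      ((Nat.factorial k : ℝ) * Real.Gamma ((k : ℝ) + (ν + 1) + 1)))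
      (t / 4 * besselEntire (ν + 2) t) := by
    rw [← hasSum_nat_add_iff' 1]
    simp only [Finset.range_one, Finset.sum_singleton, Nat.cast_zero, zero_mul, zero_div, sub_zero]
    refine ((summable_besselEntire hν2 t).hasSum.mul_left (t / 4)).congr_fun ?_
    intro k
    have h1 : ((k + 1 : ℕ) : ℝ) + (ν + 1) + 1 = (k : ℝ) + (ν + 2) + 1 := by push_cast; ring
    have h2 : Real.Gamma ((k : ℝ) + (ν + 2) + 1) ≠ 0 :=
      (Real.Gamma_pos_of_pos (by positivity)).ne'
    rw [h1, Nat.factorial_succ, pow_succ]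
    push_cast
    field_simp
  refine HasSum.tsum_eq ?_
  refine (((summable_besselEntire hν1 t).hasSum.mul_left (ν + 1)).add hshift).congr_fun ?_
  intro k
  have h1 : (k : ℝ) + (ν + 1) + 1 = ((k : ℝ) + ν + 1) + 1 := by ring
  have h2 : Real.Gamma ((k : ℝ) + ν + 1) ≠ 0 := (Real.Gamma_pos_of_pos (by positivity)).ne'
  have h3 : (k : ℝ) + ν + 1 ≠ 0 := by positivity
  rw [h1, Real.Gamma_add_one h3]
  field_simp
  ring

/-- These are the first two terms of a series with nonnegative terms. Beyond positivity, the linear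
term is what produces the threshold β > N in `exists_partition_lower`. -/
theorem besselEntire_ge {ν t : ℝ} (hν : 0 ≤ ν) (ht : 0 ≤ t) :
    (1 + t / (4 * (ν + 1))) / Real.Gamma (ν + 1) ≤ besselEntire ν t := by
  have h0 : 0 < Real.Gamma (ν + 1) := Real.Gamma_pos_of_pos (by positivity)
  have := (summable_besselEntire hν t).sum_le_tsum (Finset.range 2) (fun k _ => by
    have : 0 < Real.Gamma ((k : ℝ) + ν + 1) := Real.Gamma_pos_of_pos (by positivity)
    positivity)
  refine le_trans (le_of_eq ?_) this
  rw [Finset.sum_range_succ, Finset.sum_range_one]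
  have h1 : ((1 : ℕ) : ℝ) + ν + 1 = (ν + 1) + 1 := by push_cast; ring
  rw [h1, Real.Gamma_add_one (s := ν + 1) (by positivity)]
  simp
  field_simp

theorem besselEntire_pos {ν t : ℝ} (hν : 0 ≤ ν) (ht : 0 ≤ t) : 0 < besselEntire ν t := by
  have h0 : 0 < Real.Gamma (ν + 1) := Real.Gamma_pos_of_pos (by positivity)
  exact lt_of_lt_of_le (by positivity) (besselEntire_ge hν ht)

theorem besselI_eq {ν x : ℝ} (hx : 0 < x) : besselI ν x = (x / 2) ^ ν * besselEntire ν (x ^ 2) := by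
  rw [besselI, besselEntire, ← tsum_mul_left]
  congr 1 with k
  rw [Real.rpow_add (by positivity), mul_comm (2 : ℝ), Real.rpow_mul (by positivity),
    Real.rpow_natCast, Real.rpow_two, ← pow_mul, mul_comm k 2, pow_mul]
  have : (x / 2) ^ 2 = x ^ 2 / 4 := by ring
  rw [this]
  ring

/-- `besselSlope N (x²) = f(x) / x`. -/
noncomputable def besselSlope (N : ℕ) (t : ℝ) : ℝ :=
  besselEntire ((N : ℝ) / 2) t / (2 * besselEntire ((N : ℝ) / 2 - 1) t)

theorem besselRatio_eq {N : ℕ} {x : ℝ} (hx : 0 < x) :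
    besselRatio N x = x * besselSlope N (x ^ 2) := by
  rw [besselRatio, besselI_eq hx, besselI_eq hx, besselSlope]
  have h : (x / 2) ^ ((N : ℝ) / 2) = (x / 2) ^ ((N : ℝ) / 2 - 1) * (x / 2) := by
    rw [← Real.rpow_add_one (by positivity)]; congr 1; ring
  have h' : (x / 2) ^ ((N : ℝ) / 2 - 1) ≠ 0 := by positivity
  rw [h, mul_assoc, mul_div_mul_left _ _ h']
  by_cases hz : besselEntire ((N : ℝ) / 2 - 1) (x ^ 2) = 0
  · simp [hz]
  field_simp

theorem continuous_besselEntire {ν : ℝ} (hν : 0 ≤ ν) : Continuous (besselEntire ν) :=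
  continuous_iff_continuousAt.2 fun t => (hasDerivAt_besselEntire hν t).continuousAt

/-! ### Turán's inequality and the monotonicity of f(x)/x -/

/-- Turán's inequality `I_{ν+1}² > I_ν I_{ν+2}`. -/
theorem besselEntire_turan {ν t : ℝ} (hν : 0 ≤ ν) (ht : 0 < t) :
    besselEntire (ν + 2) t * besselEntire ν t < besselEntire (ν + 1) t ^ 2 := by
  have hν1 : 0 ≤ ν + 1 := by positivity
  have hν2 : 0 ≤ ν + 2 := by positivity
  set A := besselEntire ν
  set B := besselEntire (ν + 1)
  set C := besselEntire (ν + 2)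
  have hA : ∀ s, HasDerivAt A (B s / 4) s := hasDerivAt_besselEntire hν
  have hB : ∀ s, HasDerivAt B (C s / 4) s := by
    intro s
    have := hasDerivAt_besselEntire hν1 s
    rwa [show ν + 1 + 1 = ν + 2 by ring] at this
  have hrec : ∀ s, A s = (ν + 1) * B s + s / 4 * C s := besselEntire_recurrence hν
  -- By the recurrence K = (s/4)(B² - AC). Eliminating C beforehand means that differentiation
  -- brings in no further Bessel index.
  set K : ℝ → ℝ := fun s => A s * ((ν + 1) * B s - A s) + s * B s ^ 2 / 4 with hK
  have hKd : ∀ s, HasDerivAt K (B s / 4 * ((ν + 1) * B s - A s) +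
      A s * ((ν + 1) * (C s / 4) - B s / 4) + (B s ^ 2 + s * (2 * B s * (C s / 4))) / 4) s := by
    intro s
    have h1 := (hA s).mul (((hB s).const_mul (ν + 1)).sub (hA s))
    have h2 := ((hasDerivAt_id s).mul ((hB s).pow 2)).div_const 4
    refine (h1.add h2).congr_deriv ?_
    simp
  -- The factor s^(ν+1) is an integrating factor: the derivative collapses to s^ν · sB²/4 > 0. Since
  -- the product vanishes at 0, K is positive on (0, ∞).
  have hmono : StrictMonoOn (fun s : ℝ => s ^ (ν + 1) * K s) (Set.Ici 0) := by
    refine strictMonoOn_of_deriv_pos (convex_Ici 0) ?_ ?_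
    · have hc : Continuous K := continuous_iff_continuousAt.2 fun s => (hKd s).continuousAt
      exact ((Real.continuous_rpow_const hν1).mul hc).continuousOn
    · intro s hs
      rw [interior_Ici, Set.mem_Ioi] at hs
      have hd := (Real.hasDerivAt_rpow_const (x := s) (p := ν + 1) (Or.inl hs.ne')).mul (hKd s)
      change 0 < deriv ((fun x : ℝ => x ^ (ν + 1)) * K) s
      rw [hd.deriv]
      have hBpos : 0 < B s := besselEntire_pos hν1 hs.le
      have hpow : s ^ (ν + 1) = s ^ (ν + 1 - 1) * s := by
        rw [← Real.rpow_add_one hs.ne']; congr 1; ring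
      have hpos : 0 < s ^ (ν + 1 - 1) := Real.rpow_pos_of_pos hs _
      have : (ν + 1) * s ^ (ν + 1 - 1) * K s + s ^ (ν + 1) * (B s / 4 * ((ν + 1) * B s - A s) +
          A s * ((ν + 1) * (C s / 4) - B s / 4) + (B s ^ 2 + s * (2 * B s * (C s / 4))) / 4) =
          s ^ (ν + 1 - 1) * (s * B s ^ 2 / 4) := by
        rw [hpow]
        simp only [hK, hrec s]
        ring
      rw [this]
      positivity
  have h0 := hmono (Set.mem_Ici.2 le_rfl) (Set.mem_Ici.2 ht.le) ht
  simp only [hK] at h0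
  rw [Real.zero_rpow (by positivity), zero_mul] at h0
  have h1 := pos_of_mul_pos_right h0 (Real.rpow_nonneg ht.le _)
  have h2 : A t * ((ν + 1) * B t - A t) + t * B t ^ 2 / 4 = t / 4 * (B t ^ 2 - C t * A t) := by
    linear_combination (-A t) * hrec t
  rw [h2] at h1
  have := pos_of_mul_pos_right h1 (by positivity)
  linarith

/-- The derivative of `besselSlope N` on `[0, ∞)`. -/
noncomputable def besselSlopeDeriv (N : ℕ) (t : ℝ) : ℝ :=
  (besselEntire ((N : ℝ) / 2 + 1) t * besselEntire ((N : ℝ) / 2 - 1) t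
    - besselEntire ((N : ℝ) / 2) t ^ 2) / (8 * besselEntire ((N : ℝ) / 2 - 1) t ^ 2)

theorem half_sub_one_nonneg {N : ℕ} (hN : 2 ≤ N) : (0 : ℝ) ≤ (N : ℝ) / 2 - 1 := by
  have : (2 : ℝ) ≤ N := by exact_mod_cast hN
  linarith

theorem hasDerivAt_besselSlope {N : ℕ} (hN : 2 ≤ N) {t : ℝ} (ht : 0 ≤ t) :
    HasDerivAt (besselSlope N) (besselSlopeDeriv N t) t := by
  have h0 := half_sub_one_nonneg hN
  have hA : HasDerivAt (besselEntire ((N : ℝ) / 2 - 1)) (besselEntire ((N : ℝ) / 2) t / 4) t := by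
    simpa using hasDerivAt_besselEntire h0 t
  have hB := hasDerivAt_besselEntire (show (0 : ℝ) ≤ (N : ℝ) / 2 by positivity) t
  have hpos := besselEntire_pos h0 ht
  refine (hB.div (hA.const_mul 2) (by positivity)).congr_deriv ?_
  rw [besselSlopeDeriv]
  field_simp
  ring

theorem besselSlopeDeriv_neg {N : ℕ} (hN : 2 ≤ N) {t : ℝ} (ht : 0 < t) :
    besselSlopeDeriv N t < 0 := by
  have h0 := half_sub_one_nonneg hN
  have hpos := besselEntire_pos h0 ht.le
  have := besselEntire_turan h0 ht
  rw [show (N : ℝ) / 2 - 1 + 2 = N / 2 + 1 by ring, sub_add_cancel] at this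
  exact div_neg_of_neg_of_pos (by linarith) (by positivity)

/-- Only existence and continuity of the second derivative matter, for the Taylor remainder of the
drift at b²; the quotient rule supplies the formula by unification. -/
theorem exists_hasDerivAt_besselSlopeDeriv {N : ℕ} (hN : 2 ≤ N) :
    ∃ g : ℝ → ℝ, ContinuousOn g (Set.Ici 0) ∧
      ∀ t, 0 ≤ t → HasDerivAt (besselSlopeDeriv N) (g t) t := by
  have h0 := half_sub_one_nonneg hN
  have h1 : (0 : ℝ) ≤ (N : ℝ) / 2 := by positivity
  have h2 : (0 : ℝ) ≤ (N : ℝ) / 2 + 1 := by positivity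
  have h3 : (0 : ℝ) ≤ (N : ℝ) / 2 + 1 + 1 := by positivity
  have cA := continuous_besselEntire h0
  have cB := continuous_besselEntire h1
  have cC := continuous_besselEntire h2
  have cD := continuous_besselEntire h3
  have hd : ∀ t, 0 ≤ t → HasDerivAt (besselSlopeDeriv N) _ t := fun t ht => by
    have hA : HasDerivAt (besselEntire ((N : ℝ) / 2 - 1)) (besselEntire ((N : ℝ) / 2) t / 4) t := by
      simpa using hasDerivAt_besselEntire h0 t
    have hpos := besselEntire_pos h0 ht
    exact (((hasDerivAt_besselEntire h2 t).mul hA).sub ((hasDerivAt_besselEntire h1 t).pow 2)).div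
      ((hA.pow 2).const_mul 8) (by positivity)
  refine ⟨_, ?_, hd⟩
  refine ContinuousOn.div (Continuous.continuousOn ?_) (Continuous.continuousOn ?_) ?_
  · fun_prop
  · fun_prop
  · intro t ht
    have hpos := besselEntire_pos h0 ht
    positivity

theorem continuousOn_besselSlope {N : ℕ} (hN : 2 ≤ N) : ContinuousOn (besselSlope N) (Set.Ici 0) :=
  fun _ ht => (hasDerivAt_besselSlope hN ht).continuousAt.continuousWithinAt

theorem continuousOn_besselSlopeDeriv {N : ℕ} (hN : 2 ≤ N) :
    ContinuousOn (besselSlopeDeriv N) (Set.Ici 0) := by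
  obtain ⟨g, -, hg⟩ := exists_hasDerivAt_besselSlopeDeriv hN
  exact fun t ht => (hg t ht).continuousAt.continuousWithinAt

theorem besselSlope_strictAntiOn {N : ℕ} (hN : 2 ≤ N) :
    StrictAntiOn (besselSlope N) (Set.Ici 0) := by
  refine strictAntiOn_of_deriv_neg (convex_Ici 0) (continuousOn_besselSlope hN) fun t ht => ?_
  rw [interior_Ici, Set.mem_Ioi] at ht
  rw [(hasDerivAt_besselSlope hN ht.le).deriv]
  exact besselSlopeDeriv_neg hN ht

theorem hasDerivAt_besselRatio {N : ℕ} (hN : 2 ≤ N) {x : ℝ} (hx : 0 < x) :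
    HasDerivAt (besselRatio N) (besselSlope N (x ^ 2) + 2 * x ^ 2 * besselSlopeDeriv N (x ^ 2)) x := by
  have h1 := (hasDerivAt_besselSlope hN (sq_nonneg x)).comp (h := fun y => y ^ 2) x
    (hasDerivAt_pow 2 x)
  have h2 := (hasDerivAt_id x).mul h1
  refine (h2.congr_of_eventuallyEq ?_).congr_deriv ?_
  · filter_upwards [lt_mem_nhds hx] with y hy
    simp [besselRatio_eq hy]
  · simp
    ring

theorem besselSlope_eq_of_root {N : ℕ} {β b : ℝ} (hb : 0 < b) (hroot : b - β * besselRatio N b = 0) :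
    β * besselSlope N (b ^ 2) = 1 := by
  rw [besselRatio_eq hb] at hroot
  have : b * (1 - β * besselSlope N (b ^ 2)) = 0 := by linarith
  rcases mul_eq_zero.1 this with h | h
  · exact absurd h hb.ne'
  · linarith

/-- A positive root is a solution of βp(b²) = 1, and p is injective. -/
theorem root_unique {N : ℕ} (hN : 2 ≤ N) {β b c : ℝ} (hb : 0 < b) (hc : 0 < c)
    (hrb : b - β * besselRatio N b = 0) (hrc : c - β * besselRatio N c = 0) : b = c := by
  have h1 := besselSlope_eq_of_root hb hrb
  have h2 := besselSlope_eq_of_root hc hrc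
  have hβ : β ≠ 0 := by rintro rfl; simp at h1
  have h3 := (besselSlope_strictAntiOn hN).injOn (Set.mem_Ici.2 (sq_nonneg b))
    (Set.mem_Ici.2 (sq_nonneg c)) (mul_left_cancel₀ hβ (h1.trans h2.symm))
  exact (pow_left_inj₀ hb.le hc.le two_ne_zero).1 h3

/-- The 1 cancels against βp(b²), so the rate λ has the sign of -p'(b²), which Turán's inequality
decides. -/
theorem one_sub_deriv_besselRatio {N : ℕ} (hN : 2 ≤ N) {β b : ℝ} (hb : 0 < b)
    (hroot : b - β * besselRatio N b = 0) :
    1 - β * deriv (besselRatio N) b = -(2 * β * b ^ 2 * besselSlopeDeriv N (b ^ 2)) := by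
  rw [(hasDerivAt_besselRatio hN hb).deriv]
  linear_combination -besselSlope_eq_of_root hb hroot

/-! ### Calculus bounds for the drift t(1 - βp(t)) -/

theorem exists_lipschitz_bound {f f' : ℝ → ℝ} {R : ℝ}
    (hf : ∀ t, 0 ≤ t → HasDerivAt f (f' t) t) (hf' : ContinuousOn f' (Set.Ici 0)) :
    ∃ L : ℝ, 0 ≤ L ∧ ∀ s ∈ Set.Icc 0 R, ∀ t ∈ Set.Icc 0 R, |f s - f t| ≤ L * |s - t| := by
  obtain ⟨L, hL⟩ := (isCompact_Icc (a := (0 : ℝ)) (b := R)).exists_bound_of_continuousOn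
    (hf'.mono Set.Icc_subset_Ici_self)
  refine ⟨max L 0, le_max_right _ _, fun s hs t ht => ?_⟩
  exact (convex_Icc (0 : ℝ) R).norm_image_sub_le_of_norm_hasDerivWithin_le (f := f) (f' := f')
    (fun x hx => (hf x hx.1).hasDerivWithinAt) (fun x hx => (hL x hx).trans (le_max_left _ _)) ht hs

/-- The mean value inequality for x ↦ f(x) - f'(s)x on the segment between s and t, whose derivative
is at most L|t - s| there. -/
theorem exists_taylor_bound {f f' f'' : ℝ → ℝ} {R : ℝ}
    (hf : ∀ t, 0 ≤ t → HasDerivAt f (f' t) t) (hf' : ∀ t, 0 ≤ t → HasDerivAt f' (f'' t) t)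
    (hf'' : ContinuousOn f'' (Set.Ici 0)) :
    ∃ L : ℝ, 0 ≤ L ∧ ∀ s ∈ Set.Icc 0 R, ∀ t ∈ Set.Icc 0 R,
      |f t - f s - f' s * (t - s)| ≤ L * (t - s) ^ 2 := by
  obtain ⟨L, hL0, hL⟩ := exists_lipschitz_bound (R := R) hf' hf''
  refine ⟨L, hL0, fun s hs t ht => ?_⟩
  have hsub : Set.uIcc s t ⊆ Set.Icc 0 R := (convex_Icc (0 : ℝ) R).ordConnected.uIcc_subset hs ht
  have := (convex_uIcc s t).norm_image_sub_le_of_norm_hasDerivWithin_le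
    (f := fun x => f x - f' s * x) (f' := fun x => f' x - f' s) (C := L * |t - s|)
    (fun x hx => by
      refine ((hf x (hsub hx).1).sub ((hasDerivAt_id x).const_mul (f' s))).hasDerivWithinAt.congr_deriv ?_
      simp)
    (fun x hx => (hL x (hsub hx) s hs).trans 
      (mul_le_mul_of_nonneg_left (Set.abs_sub_left_of_mem_uIcc hx) hL0)) Set.left_mem_uIcc Set.right_mem_uIcc
  rw [Real.norm_eq_abs, Real.norm_eq_abs, mul_assoc, abs_mul_abs_self] at this
  rw [sq]
  refine le_trans (le_of_eq ?_) this
  congr 1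
  ring

/-- The drift vanishes at b² and has derivative -βb²p'(b²) there, because 1 - βp(b²) = 0. -/
theorem exists_drift_taylor {N : ℕ} (hN : 2 ≤ N) {β b R : ℝ}
    (hroot : β * besselSlope N (b ^ 2) = 1) (hR : b ^ 2 ≤ R) :
    ∃ L : ℝ, 0 ≤ L ∧ ∀ t ∈ Set.Icc 0 R,
      |t * (1 - β * besselSlope N t) + β * b ^ 2 * besselSlopeDeriv N (b ^ 2) * (t - b ^ 2)| ≤
        L * (t - b ^ 2) ^ 2 := by
  obtain ⟨g, hgc, hg⟩ := exists_hasDerivAt_besselSlopeDeriv hN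
  have c1 := continuousOn_besselSlope hN
  have c2 := continuousOn_besselSlopeDeriv hN
  obtain ⟨L, hL0, hL⟩ := exists_taylor_bound (R := R)
    (f := fun t => t * (1 - β * besselSlope N t))
    (f' := fun t => 1 - β * besselSlope N t - t * (β * besselSlopeDeriv N t))
    (f'' := fun t => -(β * besselSlopeDeriv N t) - (β * besselSlopeDeriv N t + t * (β * g t)))
    (fun t ht => by
      refine ((hasDerivAt_id t).mul
        (((hasDerivAt_besselSlope hN ht).const_mul β).const_sub 1)).congr_deriv ?_
      simp
      ring)
    (fun t ht => by
      refine ((((hasDerivAt_besselSlope hN ht).const_mul β).const_sub 1).sub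
        ((hasDerivAt_id t).mul ((hg t ht).const_mul β))).congr_deriv ?_
      simp)
    (by fun_prop)
  refine ⟨L, hL0, fun t ht => le_trans (le_of_eq ?_) (hL (b ^ 2) ⟨sq_nonneg b, hR⟩ t ht)⟩
  rw [hroot]
  congr 1
  ring

/-- As p decreases, 1 - βp(t) has the sign of t - b². This covers small t, where the quantitative
bound below is not available. -/
theorem drift_nonneg {N : ℕ} (hN : 2 ≤ N) {β b t : ℝ} (hβ : 0 < β)
    (hroot : β * besselSlope N (b ^ 2) = 1) (ht : 0 ≤ t) :
    0 ≤ (t - b ^ 2) * (t * (1 - β * besselSlope N t)) := by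
  have hb : (0 : ℝ) ≤ b ^ 2 := sq_nonneg b
  have hanti := (besselSlope_strictAntiOn hN).antitoneOn
  rcases le_total t (b ^ 2) with h | h
  · have := hanti ht hb h
    have h2 : 1 - β * besselSlope N t ≤ 0 := by nlinarith
    exact mul_nonneg_of_nonpos_of_nonpos (by linarith) (mul_nonpos_of_nonneg_of_nonpos ht h2)
  · have := hanti hb ht h
    have h2 : 0 ≤ 1 - β * besselSlope N t := by nlinarith
    exact mul_nonneg (by linarith) (mul_nonneg ht h2)

/-- On a compact interval away from 0, p' ≤ -κ < 0, so |1 - βp(t)| ≥ βκ|t - b²|. The factor t forces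
the restriction t ≥ ε. -/
theorem exists_drift_lower {N : ℕ} (hN : 2 ≤ N) {β b ε R : ℝ} (hβ : 0 < β) (hb : 0 < b)
    (hroot : β * besselSlope N (b ^ 2) = 1) (hε : 0 < ε) (hR : b ^ 2 ≤ R) :
    ∃ c : ℝ, 0 < c ∧ ∀ t ∈ Set.Icc ε R,
      c * (t - b ^ 2) ^ 2 ≤ (t - b ^ 2) * (t * (1 - β * besselSlope N t)) := by
  have hb2 : 0 < b ^ 2 := by positivity
  -- The minimum keeps b² inside the interval on which p is compared, even if ε > b².
  set δ := min ε (b ^ 2) with hδ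
  have hδ0 : 0 < δ := lt_min hε hb2
  have hsub : Set.Icc δ R ⊆ Set.Ici 0 := fun x hx => hδ0.le.trans hx.1
  have hbmem : b ^ 2 ∈ Set.Icc δ R := ⟨min_le_right _ _, hR⟩
  obtain ⟨x₀, hx₀, hmax⟩ := (isCompact_Icc (a := δ) (b := R)).exists_isMaxOn ⟨_, hbmem⟩
    ((continuousOn_besselSlopeDeriv hN).mono hsub)
  set κ := -besselSlopeDeriv N x₀ with hκ
  have hκ0 : 0 < κ := by
    have := besselSlopeDeriv_neg hN (hδ0.trans_le hx₀.1)
    linarith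
  have hmono : AntitoneOn (fun s => besselSlope N s + κ * s) (Set.Icc δ R) := by
    have hd : ∀ s ∈ Set.Icc δ R, HasDerivAt (fun s => besselSlope N s + κ * s)
        (besselSlopeDeriv N s + κ) s := fun s hs => by
      have h := (hasDerivAt_besselSlope hN (hsub hs)).add ((hasDerivAt_id s).const_mul κ)
      rw [mul_one] at h
      exact h
    refine antitoneOn_of_deriv_nonpos (convex_Icc _ _)
      (fun s hs => (hd s hs).continuousAt.continuousWithinAt)
      (fun s hs => (hd s (interior_subset hs)).differentiableAt.differentiableWithinAt)
      fun s hs => ?_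
    rw [(hd s (interior_subset hs)).deriv]
    have : besselSlopeDeriv N s ≤ besselSlopeDeriv N x₀ := hmax (interior_subset hs)
    linarith
  refine ⟨ε * (β * κ), by positivity, fun t ht => ?_⟩
  have htmem : t ∈ Set.Icc δ R := ⟨(min_le_left _ _).trans ht.1, ht.2⟩
  have key : β * κ * (t - b ^ 2) ^ 2 ≤ (t - b ^ 2) * (1 - β * besselSlope N t) := by
    rw [← hroot]
    rcases le_total t (b ^ 2) with h | h
    · have h1 : besselSlope N (b ^ 2) + κ * b ^ 2 ≤ besselSlope N t + κ * t :=
        hmono htmem hbmem h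
      have h2 : 0 ≤ β * ((b ^ 2 - t) *
        (besselSlope N t + κ * t - (besselSlope N (b ^ 2) + κ * b ^ 2))) :=
        mul_nonneg hβ.le (mul_nonneg (by linarith) (by linarith))
      linarith
    · have h1 : besselSlope N t + κ * t ≤ besselSlope N (b ^ 2) + κ * b ^ 2 :=
        hmono hbmem htmem h
      have h2 : 0 ≤ β * ((t - b ^ 2) *
        (besselSlope N (b ^ 2) + κ * b ^ 2 - (besselSlope N t + κ * t))) :=
        mul_nonneg hβ.le (mul_nonneg (by linarith) (by linarith))
      linarith
  have h0 : 0 ≤ β * κ * (t - b ^ 2) ^ 2 := by positivity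
  calc ε * (β * κ) * (t - b ^ 2) ^ 2 = ε * (β * κ * (t - b ^ 2) ^ 2) := by ring
    _ ≤ t * ((t - b ^ 2) * (1 - β * besselSlope N t)) :=
        mul_le_mul ht.1 key h0 (hε.le.trans ht.1)
    _ = _ := by ring

/-! ### Moments of the uniform measure on the sphere -/

theorem integral_volumeIoiPow (n : ℕ) (g : ℝ → ℝ) :
    ∫ r : Set.Ioi (0 : ℝ), g r ∂(Measure.volumeIoiPow n) = ∫ r in Set.Ioi (0 : ℝ), r ^ n * g r := by
  simp only [Measure.volumeIoiPow, ENNReal.ofReal]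
  rw [integral_withDensity_eq_integral_smul,
    integral_subtype_comap measurableSet_Ioi fun a ↦ Real.toNNReal (a ^ n) • g a,
    setIntegral_congr_fun measurableSet_Ioi fun x hx ↦ ?_]
  · rw [NNReal.smul_def, Real.coe_toNNReal _ (pow_nonneg hx.out.le _), smul_eq_mul]
  · exact (measurable_subtype_coe.pow_const _).real_toNNReal

/-- Homogeneity of ⟨e, x⟩^j separates the radial and spherical variables. Computing the same
Gaussian integral in Cartesian coordinates then yields the spherical moment. -/
theorem integral_inner_pow_mul_gaussian_polar {N : ℕ} (hN : 2 ≤ N) (e : EuclideanSpace ℝ (Fin N)) (j : ℕ) :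
    ∫ x : EuclideanSpace ℝ (Fin N), ⟪e, x⟫ ^ j * Real.exp (-‖x‖ ^ 2) =
      (∫ s : Spin N, ⟪e, (s : EuclideanSpace ℝ (Fin N))⟫ ^ j
        ∂(volume : Measure (EuclideanSpace ℝ (Fin N))).toSphere) *
      ∫ r in Set.Ioi (0 : ℝ), r ^ (N - 1) * (r ^ j * Real.exp (-r ^ 2)) := by
  have : NeZero N := ⟨by omega⟩
  set μ := (volume : Measure (EuclideanSpace ℝ (Fin N)))
  have hdim : Module.finrank ℝ (EuclideanSpace ℝ (Fin N)) - 1 = N - 1 := by simp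
  calc
    _ = ∫ x : ({(0)}ᶜ : Set (EuclideanSpace ℝ (Fin N))), ⟪e, x.1⟫ ^ j * Real.exp (-‖x.1‖ ^ 2)
          ∂(μ.comap (↑)) := by
      rw [integral_subtype_comap (measurableSet_singleton _).compl
        fun x ↦ ⟪e, x⟫ ^ j * Real.exp (-‖x‖ ^ 2), restrict_compl_singleton]
    _ = ∫ z : Spin N × Set.Ioi (0 : ℝ), ⟪e, (z.1 : EuclideanSpace ℝ (Fin N))⟫ ^ j *
          ((z.2 : ℝ) ^ j * Real.exp (-(z.2 : ℝ) ^ 2))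
          ∂(μ.toSphere.prod (.volumeIoiPow (N - 1))) := by
      rw [← hdim, ← μ.measurePreserving_homeomorphUnitSphereProd.integral_comp
        (Homeomorph.measurableEmbedding _)]
      refine integral_congr_ae (.of_forall fun x => ?_)
      have hx : ‖x.1‖ ≠ 0 := norm_ne_zero_iff.2 x.2
      simp only [homeomorphUnitSphereProd_apply_fst_coe, homeomorphUnitSphereProd_apply_snd_coe]
      rw [real_inner_smul_right, mul_pow, ← mul_assoc, mul_right_comm (‖x.1‖⁻¹ ^ j), ← mul_pow,
        inv_mul_cancel₀ hx, one_pow, one_mul]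
    _ = _ := by
      rw [integral_prod_mul (fun s : Spin N => ⟪e, (s : EuclideanSpace ℝ (Fin N))⟫ ^ j)
        (fun r : Set.Ioi (0 : ℝ) => (r : ℝ) ^ j * Real.exp (-(r : ℝ) ^ 2)),
        integral_volumeIoiPow _ fun r => r ^ j * Real.exp (-r ^ 2)]

theorem exists_orthonormalBasis_zero {N : ℕ} [NeZero N] {e : EuclideanSpace ℝ (Fin N)} (he : ‖e‖ = 1) :
    ∃ v : OrthonormalBasis (Fin N) ℝ (EuclideanSpace ℝ (Fin N)), v 0 = e := by
  obtain ⟨v, hv⟩ := Orthonormal.exists_orthonormalBasis_extension_of_card_eq (𝕜 := ℝ)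
    (E := EuclideanSpace ℝ (Fin N)) (ι := Fin N) (by simp) (v := fun _ => e) (s := {0})
    (by
      rw [orthonormal_iff_ite]
      rintro ⟨i, hi⟩ ⟨j, hj⟩
      rw [Set.mem_singleton_iff] at hi hj
      subst hi hj
      simp [he])
  exact ⟨v, hv 0 rfl⟩

/-- Rotate e to the first basis vector; the Gaussian then factors over the coordinates. -/
theorem integral_inner_pow_mul_gaussian {N : ℕ} [NeZero N] {e : EuclideanSpace ℝ (Fin N)} (he : ‖e‖ = 1) (j : ℕ) :
    ∫ x : EuclideanSpace ℝ (Fin N), ⟪e, x⟫ ^ j * Real.exp (-‖x‖ ^ 2) =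
      (∫ x : ℝ, x ^ j * Real.exp (-x ^ 2)) * (∫ x : ℝ, Real.exp (-x ^ 2)) ^ (N - 1) := by
  obtain ⟨v, hv⟩ := exists_orthonormalBasis_zero he
  have h1 : ∫ x : EuclideanSpace ℝ (Fin N), ⟪e, x⟫ ^ j * Real.exp (-‖x‖ ^ 2) =
      ∫ x : EuclideanSpace ℝ (Fin N), x 0 ^ j * Real.exp (-‖x‖ ^ 2) := by
    rw [← v.measurePreserving_repr.integral_comp v.repr.toHomeomorph.measurableEmbedding
      fun x => x 0 ^ j * Real.exp (-‖x‖ ^ 2)]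
    refine integral_congr_ae (.of_forall fun x => ?_)
    simp only [LinearIsometryEquiv.norm_map]
    rw [← hv, OrthonormalBasis.repr_apply_apply]
  have h2 : ∫ x : EuclideanSpace ℝ (Fin N), x 0 ^ j * Real.exp (-‖x‖ ^ 2) =
      ∫ x : Fin N → ℝ, ∏ i, (if i = 0 then (x i) ^ j else 1) * Real.exp (-(x i) ^ 2) := by
    rw [← (EuclideanSpace.volume_preserving_symm_measurableEquiv_toLp (Fin N)).integral_comp
      (MeasurableEquiv.measurableEmbedding _)]
    refine integral_congr_ae (.of_forall fun x => ?_)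
    simp only [Finset.prod_mul_distrib, Finset.prod_ite_eq', Finset.mem_univ, if_true,
      ← Real.exp_sum, Finset.sum_neg_distrib, EuclideanSpace.norm_sq_eq, Real.norm_eq_abs, sq_abs]
    rfl
  rw [h1, h2, integral_fintype_prod_volume_eq_prod
    (fun i (y : ℝ) => (if i = 0 then y ^ j else 1) * Real.exp (-y ^ 2)),
    ← Finset.mul_prod_erase _ _ (Finset.mem_univ (0 : Fin N))]
  simp only [if_true]
  congr 1
  rw [Finset.prod_congr rfl (g := fun _ => ∫ x : ℝ, Real.exp (-x ^ 2)) fun i hi => by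
    simp [Finset.ne_of_mem_erase hi]]
  simp

theorem integral_odd_pow_mul_gaussian {j : ℕ} (hj : Odd j) : ∫ x : ℝ, x ^ j * Real.exp (-x ^ 2) = 0 := by
  have h := integral_neg_eq_self (fun x : ℝ => x ^ j * Real.exp (-x ^ 2)) volume
  simp only [hj.neg_pow, neg_mul, even_two.neg_pow, integral_neg] at h
  linarith

theorem integral_Ioi_pow_mul_gaussian (m : ℕ) :
    ∫ r in Set.Ioi (0 : ℝ), r ^ m * Real.exp (-r ^ 2) = Real.Gamma (((m : ℝ) + 1) / 2) / 2 := by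
  have h := integral_rpow_mul_exp_neg_rpow (p := 2) (q := m) two_pos
    (by linarith [(Nat.cast_nonneg m : (0 : ℝ) ≤ m)])
  simp only [Real.rpow_natCast, Real.rpow_two] at h
  rw [h]
  ring

theorem integral_even_pow_mul_gaussian (k : ℕ) :
    ∫ x : ℝ, x ^ (2 * k) * Real.exp (-x ^ 2) = Real.Gamma ((k : ℝ) + 1 / 2) := by
  have h := integral_comp_abs (f := fun x : ℝ => x ^ (2 * k) * Real.exp (-x ^ 2))
  simp only [(even_two_mul k).pow_abs, sq_abs] at h
  rw [h, integral_Ioi_pow_mul_gaussian]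
  push_cast
  rw [mul_div_cancel₀ _ (two_ne_zero' ℝ)]
  congr 1
  ring

/-- The half-integer form of the duplication formula. It matches the (2k)! of the exponential series
with the 4^k k! of the Bessel series. -/
theorem Gamma_nat_add_half_eq (k : ℕ) :
    Real.Gamma ((k : ℝ) + 1 / 2) * (4 ^ k * (Nat.factorial k : ℝ)) =
      Real.Gamma (1 / 2) * (Nat.factorial (2 * k) : ℝ) := by
  induction k with
  | zero => simp
  | succ k ih =>
    have h1 : ((k + 1 : ℕ) : ℝ) + 1 / 2 = ((k : ℝ) + 1 / 2) + 1 := by push_cast; ring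
    rw [h1, Real.Gamma_add_one (s := (k : ℝ) + 1 / 2) (by positivity), show 2 * (k + 1) = 2 * k + 1 + 1 by ring,
      Nat.factorial_succ, Nat.factorial_succ, Nat.factorial_succ, pow_succ]
    push_cast
    linear_combination (4 * ((k : ℝ) + 1 / 2) * (k + 1)) * ih

instance isProbabilityMeasure_sphereUniform {N : ℕ} [NeZero N] : IsProbabilityMeasure (sphereUniform N) := by
  constructor
  rw [sphereUniform, Measure.smul_apply, smul_eq_mul]
  refine ENNReal.inv_mul_cancel ?_ (measure_ne_top _ _)
  rw [Ne, Measure.measure_univ_eq_zero]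
  exact Measure.toSphere_ne_zero _

/-- The polar and Cartesian evaluations are equated and divided; the case j = 0 gives the total
surface mass, hence the normalisation. -/
theorem integral_inner_pow {N : ℕ} (hN : 2 ≤ N) {e : EuclideanSpace ℝ (Fin N)} (he : ‖e‖ = 1) (j : ℕ) :
    ∫ s : Spin N, ⟪e, (s : EuclideanSpace ℝ (Fin N))⟫ ^ j ∂(sphereUniform N) =
      (∫ x : ℝ, x ^ j * Real.exp (-x ^ 2)) / Real.Gamma (1 / 2) *
        (Real.Gamma ((N : ℝ) / 2) / Real.Gamma (((j : ℝ) + N) / 2)) := by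
  have : NeZero N := ⟨by omega⟩
  have key : ∀ j : ℕ, (∫ s : Spin N, ⟪e, (s : EuclideanSpace ℝ (Fin N))⟫ ^ j
        ∂(volume : Measure (EuclideanSpace ℝ (Fin N))).toSphere) * (Real.Gamma (((j : ℝ) + N) / 2) / 2) =
      (∫ x : ℝ, x ^ j * Real.exp (-x ^ 2)) * Real.Gamma (1 / 2) ^ (N - 1) := by
    intro j
    have h := (integral_inner_pow_mul_gaussian_polar hN e j).symm.trans
      (integral_inner_pow_mul_gaussian he j)
    have h0 := integral_even_pow_mul_gaussian 0
    simp only [mul_zero, pow_zero, one_mul, Nat.cast_zero, zero_add] at h0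
    rw [h0] at h
    rw [← h]
    congr 1
    simp_rw [← mul_assoc, ← pow_add]
    rw [integral_Ioi_pow_mul_gaussian]
    congr 3
    rw [Nat.cast_add, Nat.cast_sub (by omega)]
    push_cast
    ring
  have h0 := key 0
  have hj := key j
  have e0 := integral_even_pow_mul_gaussian 0
  simp only [mul_zero, pow_zero, one_mul, Nat.cast_zero, zero_add] at e0
  simp only [pow_zero, integral_const, smul_eq_mul, mul_one, one_mul, e0, Nat.cast_zero, zero_add] at h0
  have hNpos : (0 : ℝ) < N := by exact_mod_cast (by omega : 0 < N)
  have g1 : 0 < Real.Gamma ((N : ℝ) / 2) := Real.Gamma_pos_of_pos (by positivity)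
  have g2 : 0 < Real.Gamma (((j : ℝ) + N) / 2) := Real.Gamma_pos_of_pos (by positivity)
  have g3 : 0 < Real.Gamma (1 / 2) := Real.Gamma_pos_of_pos (by positivity)
  rw [sphereUniform, integral_smul_measure, ENNReal.toReal_inv, smul_eq_mul]
  change (Measure.real _ Set.univ)⁻¹ * _ = _
  set V := (volume : Measure (EuclideanSpace ℝ (Fin N))).toSphere.real Set.univ
  have hV : V = Real.Gamma (1 / 2) * Real.Gamma (1 / 2) ^ (N - 1) / (Real.Gamma ((N : ℝ) / 2) / 2) := by
    rw [eq_div_iff (by positivity), h0]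
  rw [← eq_div_iff (by positivity)] at hj
  rw [hj, hV]
  field_simp

theorem integral_inner_pow_odd {N : ℕ} (hN : 2 ≤ N) {e : EuclideanSpace ℝ (Fin N)} (he : ‖e‖ = 1) {j : ℕ} (hj : Odd j) :
    ∫ s : Spin N, ⟪e, (s : EuclideanSpace ℝ (Fin N))⟫ ^ j ∂(sphereUniform N) = 0 := by
  rw [integral_inner_pow hN he, integral_odd_pow_mul_gaussian hj]
  simp

theorem integral_inner_pow_even {N : ℕ} (hN : 2 ≤ N) {e : EuclideanSpace ℝ (Fin N)} (he : ‖e‖ = 1) (k : ℕ) :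
    ∫ s : Spin N, ⟪e, (s : EuclideanSpace ℝ (Fin N))⟫ ^ (2 * k) ∂(sphereUniform N) =
      Real.Gamma ((N : ℝ) / 2) * (Nat.factorial (2 * k) : ℝ) /
        (4 ^ k * (Nat.factorial k : ℝ) * Real.Gamma ((k : ℝ) + N / 2)) := by
  rw [integral_inner_pow hN he, integral_even_pow_mul_gaussian]
  have hNpos : (0 : ℝ) < N := by exact_mod_cast (by omega : 0 < N)
  have g2 : 0 < Real.Gamma ((k : ℝ) + N / 2) := Real.Gamma_pos_of_pos (by positivity)
  have g3 : 0 < Real.Gamma (1 / 2) := Real.Gamma_pos_of_pos (by positivity)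
  have h := Gamma_nat_add_half_eq k
  rw [show (((2 * k : ℕ) : ℝ) + N) / 2 = k + N / 2 by push_cast; ring]
  rw [div_mul_div_comm, div_eq_div_iff (by positivity) (by positivity)]
  linear_combination Real.Gamma ((N : ℝ) / 2) * Real.Gamma ((k : ℝ) + N / 2) * h

theorem abs_inner_spin_le {N : ℕ} (θ : EuclideanSpace ℝ (Fin N)) (s : Spin N) :
    |⟪θ, (s : EuclideanSpace ℝ (Fin N))⟫| ≤ ‖θ‖ := by
  simpa using abs_real_inner_le_norm θ (s : EuclideanSpace ℝ (Fin N))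

theorem continuous_inner_spin {N : ℕ} (θ : EuclideanSpace ℝ (Fin N)) :
    Continuous fun s : Spin N => ⟪θ, (s : EuclideanSpace ℝ (Fin N))⟫ := by fun_prop

theorem exists_unit_smul {N : ℕ} [NeZero N] (θ : EuclideanSpace ℝ (Fin N)) :
    ∃ e : EuclideanSpace ℝ (Fin N), ‖e‖ = 1 ∧ θ = ‖θ‖ • e := by
  by_cases h : θ = 0
  · exact ⟨EuclideanSpace.single 0 1, by simp, by simp [h]⟩
  · exact ⟨‖θ‖⁻¹ • θ, norm_smul_inv_norm h, by
      rw [smul_smul, mul_inv_cancel₀ (norm_ne_zero_iff.2 h), one_smul]⟩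

/-- Integrate the exponential series term by term. Odd moments vanish, and dividing the even moments
by (2k)! gives exactly the Bessel coefficients. -/
theorem integral_exp_inner {N : ℕ} (hN : 2 ≤ N) (θ : EuclideanSpace ℝ (Fin N)) :
    ∫ s : Spin N, Real.exp ⟪θ, (s : EuclideanSpace ℝ (Fin N))⟫ ∂(sphereUniform N) =
      Real.Gamma ((N : ℝ) / 2) * besselEntire ((N : ℝ) / 2 - 1) (‖θ‖ ^ 2) := by
  have : NeZero N := ⟨by omega⟩
  obtain ⟨e, he, hθ⟩ := exists_unit_smul θ
  have hint : ∀ j : ℕ, Integrable (fun s : Spin N => ⟪θ, (s : EuclideanSpace ℝ (Fin N))⟫ ^ j /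
      (Nat.factorial j : ℝ)) (sphereUniform N) := fun j =>
    (((continuous_inner_spin θ).pow j).div_const _).integrable_of_hasCompactSupport
      (HasCompactSupport.of_compactSpace _)
  have hs : HasSum (fun j : ℕ => ∫ s : Spin N, ⟪θ, (s : EuclideanSpace ℝ (Fin N))⟫ ^ j /
      (Nat.factorial j : ℝ) ∂(sphereUniform N))
      (∫ s : Spin N, Real.exp ⟪θ, (s : EuclideanSpace ℝ (Fin N))⟫ ∂(sphereUniform N)) := by
    have := hasSum_integral_of_summable_integral_norm hint ?_
    · simp_rw [Real.exp_eq_exp_ℝ, NormedSpace.exp_eq_tsum_div]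
      exact this
    · refine .of_nonneg_of_le (fun j => integral_nonneg fun s => norm_nonneg _) (fun j => ?_)
        (Real.summable_pow_div_factorial ‖θ‖)
      refine (integral_mono (hint j).norm (integrable_const (‖θ‖ ^ j / (Nat.factorial j : ℝ)))
        fun s => ?_).trans (by simp)
      simp only [norm_div, norm_pow, Real.norm_eq_abs, Nat.abs_cast]
      gcongr
      exact abs_inner_spin_le θ s
  have hinj : Function.Injective fun k : ℕ => 2 * k := fun a b h => by simpa using h
  rw [← hinj.hasSum_iff] at hs
  · refine hs.unique ?_
    refine ((summable_besselEntire (half_sub_one_nonneg hN) (‖θ‖ ^ 2)).hasSum.mul_left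
      (Real.Gamma ((N : ℝ) / 2))).congr_fun fun k => ?_
    simp only [Function.comp]
    rw [integral_div]
    have : ∀ s : Spin N, ⟪θ, (s : EuclideanSpace ℝ (Fin N))⟫ ^ (2 * k) =
        ‖θ‖ ^ (2 * k) * ⟪e, (s : EuclideanSpace ℝ (Fin N))⟫ ^ (2 * k) := fun s => by
      conv_lhs => rw [hθ, real_inner_smul_left, mul_pow]
    simp_rw [this]
    have hNpos : (0 : ℝ) < N := by exact_mod_cast (by omega : 0 < N)
    have g2 : 0 < Real.Gamma ((k : ℝ) + N / 2) := Real.Gamma_pos_of_pos (by positivity)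
    rw [integral_const_mul, integral_inner_pow_even hN he, pow_mul,
      show (k : ℝ) + ((N : ℝ) / 2 - 1) + 1 = k + N / 2 by ring, div_pow]
    field_simp
  · intro j hj
    have hodd : Odd j := by
      rw [← Nat.not_even_iff_odd]
      rintro ⟨k, rfl⟩
      exact hj ⟨k, by simp; ring⟩
    have : ∀ s : Spin N, ⟪θ, (s : EuclideanSpace ℝ (Fin N))⟫ ^ j =
        ‖θ‖ ^ j * ⟪e, (s : EuclideanSpace ℝ (Fin N))⟫ ^ j := fun s => by
      conv_lhs => rw [hθ, real_inner_smul_left, mul_pow]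
    simp_rw [this]
    rw [integral_div, integral_const_mul, integral_inner_pow_odd hN he hodd]
    simp

/-- The moment generating function `∫ exp ⟪θ, s⟫ dμ(s)` of the uniform measure on the sphere. -/
noncomputable def sphereMGF {N : ℕ} (θ : EuclideanSpace ℝ (Fin N)) : ℝ :=
  ∫ s : Spin N, Real.exp ⟪θ, (s : EuclideanSpace ℝ (Fin N))⟫ ∂(sphereUniform N)

/-- The second moment `∫ ⟪θ, s⟫² exp ⟪θ, s⟫ dμ(s) / ∫ exp ⟪θ, s⟫ dμ(s)` for `‖θ‖² = t`. -/
noncomputable def tiltedSecondMoment (N : ℕ) (t : ℝ) : ℝ := t * (1 - ((N : ℝ) - 1) * besselSlope N t)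

/-- Differentiate x ↦ ∫ exp(x⟨θ, s⟩) = Γ(N/2)A(x²t) once and twice at x = 1. In the second
derivative the recurrence eliminates the higher Bessel index, so both answers involve only p. -/
theorem sphere_moments {N : ℕ} (hN : 2 ≤ N) (θ : EuclideanSpace ℝ (Fin N)) :
    (∫ s : Spin N, ⟪θ, (s : EuclideanSpace ℝ (Fin N))⟫ * Real.exp ⟪θ, (s : EuclideanSpace ℝ (Fin N))⟫
        ∂(sphereUniform N) = ‖θ‖ ^ 2 * besselSlope N (‖θ‖ ^ 2) * sphereMGF θ) ∧
    (∫ s : Spin N, ⟪θ, (s : EuclideanSpace ℝ (Fin N))⟫ ^ 2 * Real.exp ⟪θ, (s : EuclideanSpace ℝ (Fin N))⟫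
        ∂(sphereUniform N) = tiltedSecondMoment N (‖θ‖ ^ 2) * sphereMGF θ) := by
  have : NeZero N := ⟨by omega⟩
  have h0 := half_sub_one_nonneg hN
  have hν : (0 : ℝ) ≤ (N : ℝ) / 2 := by positivity
  set X : Spin N → ℝ := fun s => ⟪θ, (s : EuclideanSpace ℝ (Fin N))⟫ with hX
  set t := ‖θ‖ ^ 2 with ht
  have hint : ∀ x, x ∈ interior (integrableExpSet X (sphereUniform N)) := by
    intro x
    have : integrableExpSet X (sphereUniform N) = Set.univ := by
      ext y
      simp only [integrableExpSet, Set.mem_ofPred_eq, Set.mem_univ, iff_true]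
      exact (((continuous_inner_spin θ).const_mul y).rexp).integrable_of_hasCompactSupport
        (HasCompactSupport.of_compactSpace _)
    simp [this]
  have hd := fun x n => hasDerivAt_integral_pow_mul_exp_real (hint x) n
  set Γ := Real.Gamma ((N : ℝ) / 2)
  set A := besselEntire ((N : ℝ) / 2 - 1)
  set B := besselEntire ((N : ℝ) / 2)
  set C := besselEntire ((N : ℝ) / 2 + 1)
  have hA : ∀ s, HasDerivAt A (B s / 4) s := fun s => by
    simpa using hasDerivAt_besselEntire h0 s
  have hB : ∀ s, HasDerivAt B (C s / 4) s := hasDerivAt_besselEntire hν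
  have hsq : ∀ x, HasDerivAt (fun x => x ^ 2 * t) (2 * x * t) x := fun x => by
    simpa using (hasDerivAt_pow 2 x).mul_const t
  have hM : ∀ x, ∫ s, Real.exp (x * X s) ∂(sphereUniform N) = Γ * A (x ^ 2 * t) := by
    intro x
    have := integral_exp_inner hN (x • θ)
    rw [norm_smul, mul_pow, Real.norm_eq_abs, sq_abs] at this
    rw [← this]
    refine integral_congr_ae (.of_forall fun s => ?_)
    simp [hX, real_inner_smul_left]
  have hMθ : sphereMGF θ = Γ * A t := integral_exp_inner hN θ
  have h1 : ∀ x, ∫ s, X s * Real.exp (x * X s) ∂(sphereUniform N) = Γ * (B (x ^ 2 * t) * (x * t / 2)) := by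
    intro x
    have e1 := hd x 0
    simp only [pow_zero, one_mul, zero_add, pow_one, hM] at e1
    have e2 := ((hA (x ^ 2 * t)).comp x (hsq x)).const_mul Γ
    rw [e1.unique e2]
    ring
  have h2 : ∫ s, X s ^ 2 * Real.exp (1 * X s) ∂(sphereUniform N) = Γ * t / 2 * (B t + t * C t / 2) := by
    have e1 := hd 1 1
    simp only [pow_one, h1, Nat.reduceAdd] at e1
    have e2 := (((hB (1 ^ 2 * t)).comp 1 (hsq 1)).mul
      (((hasDerivAt_id (1 : ℝ)).mul_const t).div_const 2)).const_mul Γ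
    rw [e1.unique e2]
    simp
    ring
  have hApos : 0 < A t := besselEntire_pos h0 (sq_nonneg _)
  have hrec := besselEntire_recurrence h0 t
  rw [sub_add_cancel, show (N : ℝ) / 2 - 1 + 2 = N / 2 + 1 by ring] at hrec
  constructor
  · have := h1 1
    simp only [one_mul, one_pow] at this
    rw [this, hMθ, besselSlope]
    change _ = t * (B t / (2 * A t)) * _
    field_simp
  · simp only [one_mul] at h2
    rw [h2, hMθ, tiltedSecondMoment, besselSlope]
    change _ = t * (1 - (N - 1) * (B t / (2 * A t))) * _
    have : t * (1 - ((N : ℝ) - 1) * (B t / (2 * A t))) * (Γ * A t) =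
        Γ * t * (A t - (N - 1) * B t / 2) := by field_simp
    rw [this]
    linear_combination (-Γ * t) * hrec

/-! ### The Gibbs measure and single-spin resampling -/

/-- This lets coordinate i be integrated out separately without splitting the product space. -/
theorem measurePreserving_update {ι : Type*} [Fintype ι] [DecidableEq ι] {X : Type*}
    [MeasurableSpace X] (μ : Measure X) [IsProbabilityMeasure μ] (i : ι) :
    MeasurePreserving (fun z : (ι → X) × X => Function.update z.1 i z.2)
      ((Measure.pi fun _ => μ).prod μ) (Measure.pi fun _ => μ) := by
  have hm : Measurable (fun z : (ι → X) × X => Function.update z.1 i z.2) := by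
    rw [measurable_pi_iff]
    intro j
    by_cases h : j = i
    · subst h; simpa using measurable_snd
    · simp only [Function.update_of_ne h]
      exact (measurable_pi_apply j).comp measurable_fst
  refine ⟨hm, (Measure.pi_eq fun s hs => ?_).symm⟩
  rw [Measure.map_apply hm (.univ_pi hs)]
  have : (fun z : (ι → X) × X => Function.update z.1 i z.2) ⁻¹' (Set.univ.pi s) =
      (Set.univ.pi (Function.update s i Set.univ)) ×ˢ s i := by
    ext z
    simp only [Set.mem_preimage, Set.mem_pi, Set.mem_univ, true_implies, Set.mem_prod]
    constructor
    · intro h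
      refine ⟨fun j => ?_, by simpa using h i⟩
      by_cases hj : j = i
      · subst hj; simp
      · simpa [Function.update_of_ne hj] using h j
    · rintro ⟨h, hi⟩ j
      by_cases hj : j = i
      · subst hj; simpa using hi
      · simpa [Function.update_of_ne hj] using h j
  rw [this, Measure.prod_prod, Measure.pi_pi, ← Finset.mul_prod_erase _ _ (Finset.mem_univ i),
    ← Finset.mul_prod_erase Finset.univ (fun j => μ (s j)) (Finset.mem_univ i)]
  rw [Finset.prod_congr rfl (g := fun j => μ (s j)) fun j hj => by
    rw [Function.update_of_ne (Finset.ne_of_mem_erase hj)]]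
  simp [mul_comm]

section
variable {N n : ℕ}

/-- The total spin normalized to `(β / n) S`. -/
noncomputable def meanField (β : ℝ) (σ : SpinConfig N n) : EuclideanSpace ℝ (Fin N) :=
  (β / n) • totalSpin σ

/-- The field `(β / n) (S - σ_i)` felt by the spin at `i`. -/
noncomputable def localField (β : ℝ) (σ : SpinConfig N n) (i : Fin n) : EuclideanSpace ℝ (Fin N) :=
  (β / n) • (totalSpin σ - (σ i : EuclideanSpace ℝ (Fin N)))

@[simp] theorem norm_spin (s : Spin N) : ‖(s : EuclideanSpace ℝ (Fin N))‖ = 1 := by simp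

@[fun_prop] theorem continuous_totalSpin : Continuous (totalSpin : SpinConfig N n → _) := by
  unfold totalSpin; fun_prop

@[fun_prop] theorem continuous_meanField (β : ℝ) : Continuous (meanField β : SpinConfig N n → _) := by
  unfold meanField; fun_prop

@[fun_prop] theorem continuous_localField (β : ℝ) (i : Fin n) :
    Continuous fun σ : SpinConfig N n => localField β σ i := by
  unfold localField; fun_prop

theorem totalSpin_update (σ : SpinConfig N n) (i : Fin n) (s : Spin N) :
    totalSpin (Function.update σ i s) = totalSpin σ - (σ i : EuclideanSpace ℝ (Fin N)) + s := by
  unfold totalSpin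
  rw [← Finset.add_sum_erase _ _ (Finset.mem_univ i),
    ← Finset.add_sum_erase Finset.univ (fun j => (σ j : EuclideanSpace ℝ (Fin N))) (Finset.mem_univ i),
    Finset.sum_congr rfl (g := fun j => (σ j : EuclideanSpace ℝ (Fin N))) fun j hj => by
    rw [Function.update_of_ne (Finset.ne_of_mem_erase hj)]]
  simp [add_comm]

theorem localField_update (β : ℝ) (σ : SpinConfig N n) (i : Fin n) (s : Spin N) :
    localField β (Function.update σ i s) i = localField β σ i := by
  simp [localField, totalSpin_update]

theorem neg_mul_hamiltonian (β : ℝ) (σ : SpinConfig N n) :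
    -β * hamiltonian σ = β / (2 * n) * ‖totalSpin σ‖ ^ 2 := by
  rw [hamiltonian, ← real_inner_self_eq_norm_sq, totalSpin, sum_inner]
  simp_rw [inner_sum]
  ring

theorem neg_mul_hamiltonian_update (β : ℝ) (σ : SpinConfig N n) (i : Fin n) (s : Spin N) :
    -β * hamiltonian (Function.update σ i s) =
      β / (2 * n) * (‖totalSpin σ - (σ i : EuclideanSpace ℝ (Fin N))‖ ^ 2 + 1) +
        ⟪localField β σ i, (s : EuclideanSpace ℝ (Fin N))⟫ := by
  rw [neg_mul_hamiltonian, totalSpin_update, norm_add_sq_real, norm_spin, localField,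
    real_inner_smul_left]
  ring

theorem neg_mul_hamiltonian_eq_meanField {β : ℝ} (hβ : 0 < β) (hn : 1 ≤ n) (σ : SpinConfig N n) :
    -β * hamiltonian σ = n / (2 * β) * ‖meanField β σ‖ ^ 2 := by
  have hn0 : (0 : ℝ) < n := by exact_mod_cast hn
  rw [neg_mul_hamiltonian, meanField, norm_smul, mul_pow, Real.norm_eq_abs, sq_abs]
  field_simp

theorem continuous_hamiltonian : Continuous (hamiltonian : SpinConfig N n → ℝ) := by
  unfold hamiltonian; fun_prop

theorem _root_.Continuous.integrable_of_compactSpace {X : Type*} [TopologicalSpace X] [CompactSpace X]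
    [MeasurableSpace X] [OpensMeasurableSpace X] {μ : Measure X} [IsFiniteMeasure μ] {f : X → ℝ}
    (hf : Continuous f) : Integrable f μ :=
  hf.integrable_of_hasCompactSupport (HasCompactSupport.of_compactSpace _)

theorem continuous_sphereMGF (hN : 2 ≤ N) :
    Continuous (sphereMGF : EuclideanSpace ℝ (Fin N) → ℝ) := by
  have h : (sphereMGF : EuclideanSpace ℝ (Fin N) → ℝ) = fun θ => _ := funext (integral_exp_inner hN)
  rw [h]
  have := continuous_besselEntire (half_sub_one_nonneg hN)
  fun_prop

theorem sphereMGF_pos [NeZero N] (θ : EuclideanSpace ℝ (Fin N)) : 0 < sphereMGF θ :=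
  integral_exp_pos (continuous_inner_spin θ).rexp.integrable_of_compactSpace

/-- The joint law of `σ` and a spin resampled at `i` given the other spins. -/
noncomputable def resampleLaw (N n : ℕ) (β : ℝ) (i : Fin n) : Measure (SpinConfig N n × Spin N) :=
  ((gibbsMeasure N n β).prod (sphereUniform N)).withDensity fun z =>
    ENNReal.ofReal (Real.exp ⟪localField β z.1 i, (z.2 : EuclideanSpace ℝ (Fin N))⟫ /
      sphereMGF (localField β z.1 i))

variable [NeZero N]

instance isProbabilityMeasure_gibbsMeasure (β : ℝ) : IsProbabilityMeasure (gibbsMeasure N n β) := by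
  refine isProbabilityMeasure_tilted (Continuous.integrable_of_compactSpace ?_)
  exact ((continuous_const.mul continuous_hamiltonian)).rexp

theorem measurable_resample_density (hN : 2 ≤ N) (β : ℝ) (i : Fin n) :
    Measurable fun z : SpinConfig N n × Spin N =>
      ENNReal.ofReal (Real.exp ⟪localField β z.1 i, (z.2 : EuclideanSpace ℝ (Fin N))⟫ /
        sphereMGF (localField β z.1 i)) := by
  have h := continuous_sphereMGF hN
  refine (Continuous.measurable ?_).ennreal_ofReal
  refine Continuous.div (by fun_prop) (by fun_prop) fun z => (sphereMGF_pos _).ne'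

theorem lintegral_resampleLaw (hN : 2 ≤ N) (β : ℝ) (i : Fin n) {F : SpinConfig N n × Spin N → ℝ≥0∞}
    (hF : Measurable F) :
    ∫⁻ z, F z ∂(resampleLaw N n β i) = ∫⁻ σ, ∫⁻ s, ENNReal.ofReal (Real.exp
      ⟪localField β σ i, (s : EuclideanSpace ℝ (Fin N))⟫ / sphereMGF (localField β σ i)) * F (σ, s)
      ∂(sphereUniform N) ∂(gibbsMeasure N n β) := by
  have hm := measurable_resample_density hN β i
  rw [resampleLaw, lintegral_withDensity_eq_lintegral_mul _ hm hF,
    lintegral_prod _ (hm.mul hF).aemeasurable]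
  rfl

theorem lintegral_density_eq_one (θ : EuclideanSpace ℝ (Fin N)) :
    ∫⁻ s : Spin N, ENNReal.ofReal (Real.exp ⟪θ, (s : EuclideanSpace ℝ (Fin N))⟫ / sphereMGF θ)
      ∂(sphereUniform N) = 1 := by
  rw [← ofReal_integral_eq_lintegral_ofReal
    ((continuous_inner_spin θ).rexp.div_const _).integrable_of_compactSpace
    (.of_forall fun s => (div_pos (Real.exp_pos _) (sphereMGF_pos θ)).le), integral_div]
  change ENNReal.ofReal (sphereMGF θ / sphereMGF θ) = 1
  rw [div_self (sphereMGF_pos θ).ne', ENNReal.ofReal_one]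

theorem map_fst_resampleLaw (hN : 2 ≤ N) (β : ℝ) (i : Fin n) :
    (resampleLaw N n β i).map Prod.fst = gibbsMeasure N n β := by
  refine Measure.ext_of_lintegral _ fun F hF => ?_
  rw [lintegral_map hF measurable_fst,
    lintegral_resampleLaw hN β i (F := fun z => F z.1) (hF.comp measurable_fst)]
  refine lintegral_congr fun σ => ?_
  simp only
  rw [lintegral_mul_const _ ((continuous_inner_spin _).rexp.div_const _).measurable.ennreal_ofReal,
    lintegral_density_eq_one, one_mul]

theorem isProbabilityMeasure_resampleLaw (hN : 2 ≤ N) (β : ℝ) (i : Fin n) :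
    IsProbabilityMeasure (resampleLaw N n β i) := by
  have : IsProbabilityMeasure ((resampleLaw N n β i).map Prod.fst) := by
    rw [map_fst_resampleLaw hN]; infer_instance
  exact Measure.isProbabilityMeasure_of_map Prod.fst

theorem measurable_update_prod (i : Fin n) :
    Measurable fun z : SpinConfig N n × Spin N => Function.update z.1 i z.2 :=
  (measurePreserving_update (sphereUniform N) i).measurable

/-- Stationarity: the conditional density of σ_i given the other spins is exp⟨θ_i, s⟩/M(θ_i),
because θ_i and the rest of the Hamiltonian do not involve σ_i. No joint exchangeability is needed
later, only this equality of marginals. -/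
theorem map_update_resampleLaw (hN : 2 ≤ N) (β : ℝ) (i : Fin n) :
    (resampleLaw N n β i).map (fun z => Function.update z.1 i z.2) = gibbsMeasure N n β := by
  refine Measure.ext_of_lintegral _ fun F hF => ?_
  have hup := measurable_update_prod (N := N) i
  have hdens := measurable_resample_density hN β i
  have hpres := measurePreserving_update (sphereUniform N) i
  rw [lintegral_map hF hup,
    lintegral_resampleLaw hN β i (F := fun z => F (Function.update z.1 i z.2)) (hF.comp hup)]
  have hFu := hF.comp hup
  have hH : Measurable fun σ : SpinConfig N n => -β * hamiltonian σ :=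
    (continuous_const.mul continuous_hamiltonian).measurable
  set Z := ∫ σ : SpinConfig N n, Real.exp (-β * hamiltonian σ) ∂(Measure.pi fun _ => sphereUniform N)
  set D : SpinConfig N n → ℝ≥0∞ := fun σ => ENNReal.ofReal (Real.exp (-β * hamiltonian σ) / Z) with hD
  have hDm : Measurable D := (hH.exp.div_const _).ennreal_ofReal
  set Ψ : SpinConfig N n → ℝ≥0∞ := fun σ => ∫⁻ s, ENNReal.ofReal (Real.exp
      ⟪localField β σ i, (s : EuclideanSpace ℝ (Fin N))⟫ / sphereMGF (localField β σ i)) *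
      F (Function.update σ i s) ∂(sphereUniform N) with hΨ
  have hΨm : Measurable Ψ := (hdens.mul hFu).lintegral_prod_right'
  have hΨu : ∀ σ s, Ψ (Function.update σ i s) = Ψ σ := fun σ s => by
    simp only [hΨ, localField_update, Function.update_idem]
  -- Every Gibbs integral is written with spin i integrated first, so both sides can be compared for
  -- fixed other spins.
  have hgibbs : ∀ G : SpinConfig N n → ℝ≥0∞, Measurable G → ∫⁻ σ, G σ ∂(gibbsMeasure N n β) =
      ∫⁻ σ, ∫⁻ s, D (Function.update σ i s) * G (Function.update σ i s) ∂(sphereUniform N)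
        ∂(Measure.pi fun _ => sphereUniform N) := fun G hG => by
    rw [gibbsMeasure, lintegral_tilted]
    change ∫⁻ σ, (D * G) σ ∂(Measure.pi fun _ => sphereUniform N) = _
    rw [← hpres.lintegral_comp (hDm.mul hG)]
    exact lintegral_prod _ ((hDm.mul hG).comp hup).aemeasurable
  change ∫⁻ σ, Ψ σ ∂(gibbsMeasure N n β) = _
  rw [hgibbs Ψ hΨm, hgibbs F hF]
  refine lintegral_congr fun σ => ?_
  simp only [hΨu]
  rw [lintegral_mul_const (Ψ σ) (f := fun s => D (Function.update σ i s))
    (hDm.comp (measurable_update σ))]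
  set a := β / (2 * n) * (‖totalSpin σ - (σ i : EuclideanSpace ℝ (Fin N))‖ ^ 2 + 1)
  set θ := localField β σ i
  have hMpos := sphereMGF_pos θ
  have hZ : 0 ≤ Z := integral_nonneg fun _ => (Real.exp_pos _).le
  -- The Gibbs density in spin i is a constant times the normalised resampling density, which has
  -- total mass 1.
  have hDu : ∀ s, D (Function.update σ i s) = ENNReal.ofReal (Real.exp a * sphereMGF θ / Z) *
      ENNReal.ofReal (Real.exp ⟪θ, (s : EuclideanSpace ℝ (Fin N))⟫ / sphereMGF θ) := fun s => by
    rw [← ENNReal.ofReal_mul (by positivity)]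
    simp only [hD]
    rw [neg_mul_hamiltonian_update, Real.exp_add]
    change ENNReal.ofReal (Real.exp a * Real.exp ⟪θ, (s : EuclideanSpace ℝ (Fin N))⟫ / Z) = _
    congr 1
    generalize Real.exp a = x
    field_simp
  have hθm : Measurable fun s : Spin N =>
      ENNReal.ofReal (Real.exp ⟪θ, (s : EuclideanSpace ℝ (Fin N))⟫ / sphereMGF θ) :=
    ((continuous_inner_spin _).rexp.div_const _).measurable.ennreal_ofReal
  simp only [hDu, mul_assoc]
  rw [lintegral_const_mul _ hθm, lintegral_density_eq_one, mul_one,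
    lintegral_const_mul _ (f := fun s : Spin N => ENNReal.ofReal (Real.exp
      ⟪θ, (s : EuclideanSpace ℝ (Fin N))⟫ / sphereMGF θ) * F (Function.update σ i s))
      (hθm.mul (hF.comp (measurable_update σ)))]

/-! ### A small mean field is exponentially unlikely -/

/-- Linearise the quadratic exponent: (β/2n)|S|² ≥ ⟨θ, S⟩ - n|θ|²/(2β) for any fixed θ, and the
right side factors over the spins. It remains to choose θ with M(θ) > exp(|θ|²/(2β)); since M(θ) ≥ 1
+ |θ|²/(2N), a short θ works exactly because β > N. -/
theorem exists_partition_lower {β : ℝ} (hN : 2 ≤ N) (hβ : (N : ℝ) < β) :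
    ∃ c : ℝ, 0 < c ∧ ∀ n : ℕ, 1 ≤ n → Real.exp (c * n) ≤
      ∫ σ : SpinConfig N n, Real.exp (-β * hamiltonian σ) ∂(Measure.pi fun _ => sphereUniform N) := by
  have hN0 : (0 : ℝ) < N := by exact_mod_cast (by omega : 0 < N)
  have hβ0 : 0 < β := hN0.trans hβ
  -- With |θ|² = 2Nx one has M(θ) ≥ 1 + x and |θ|²/(2β) = xN/β. This x gives β/N = 1 + 2x, so log(1
  -- + x) ≥ x/(1 + x) > x/(1 + 2x) = xN/β.
  set x := (β - N) / (2 * N) with hx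
  have hx0 : 0 < x := div_pos (by linarith) (by positivity)
  refine ⟨x / (1 + x) - x * N / β, ?_, fun n hn => ?_⟩
  · have hb : β = N + 2 * N * x := by rw [hx]; field_simp; ring
    have : x / (1 + x) - x * N / β = x * (N * x) / ((1 + x) * β) := by
      field_simp
      linear_combination hb
    rw [this]
    positivity
  have hn0 : (0 : ℝ) < n := by exact_mod_cast hn
  set θ : EuclideanSpace ℝ (Fin N) := √(2 * N * x) • EuclideanSpace.single 0 1 with hθ
  have hθn : ‖θ‖ ^ 2 = 2 * N * x := by
    rw [hθ, norm_smul, PiLp.norm_single, norm_one, mul_one, Real.norm_eq_abs, sq_abs,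
      Real.sq_sqrt (by positivity)]
  have hM : 1 + x ≤ sphereMGF θ := by
    have h0 := half_sub_one_nonneg hN
    have h1 := besselEntire_ge h0 (show 0 ≤ 2 * N * x by positivity)
    rw [sub_add_cancel] at h1
    have h2 : 0 < Real.Gamma ((N : ℝ) / 2) := Real.Gamma_pos_of_pos (by positivity)
    rw [sphereMGF, integral_exp_inner hN, hθn]
    rw [div_le_iff₀ h2] at h1
    refine le_trans (le_of_eq ?_) (h1.trans (le_of_eq (mul_comm _ _)))
    field_simp
    ring
  have hexp : Real.exp (x / (1 + x) - x * N / β) ≤ sphereMGF θ * Real.exp (-(x * N / β)) := by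
    rw [sub_eq_add_neg, Real.exp_add]
    refine mul_le_mul_of_nonneg_right (le_trans ?_ hM) (Real.exp_pos _).le
    have h := Real.one_sub_inv_le_log_of_pos (show 0 < 1 + x by positivity)
    have h2 : x / (1 + x) = 1 - (1 + x)⁻¹ := by field_simp; ring
    rw [h2, ← Real.le_log_iff_exp_le (by positivity)]
    exact h
  calc Real.exp ((x / (1 + x) - x * N / β) * n)
      = Real.exp (x / (1 + x) - x * N / β) ^ n := by rw [mul_comm, Real.exp_nat_mul]
    _ ≤ (sphereMGF θ * Real.exp (-(x * N / β))) ^ n := by gcongr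
    _ = ∫ σ : SpinConfig N n, (∏ i, Real.exp ⟪θ, (σ i : EuclideanSpace ℝ (Fin N))⟫) *
          Real.exp (-(x * N / β)) ^ n ∂(Measure.pi fun _ => sphereUniform N) := by
        rw [integral_mul_const, integral_fintype_prod_eq_pow
          (fun s : Spin N => Real.exp ⟪θ, (s : EuclideanSpace ℝ (Fin N))⟫), mul_pow, Fintype.card_fin]
        rfl
    _ ≤ _ := by
        refine integral_mono (Continuous.integrable_of_compactSpace (by fun_prop))
          (Continuous.integrable_of_compactSpace
            (continuous_const.mul continuous_hamiltonian).rexp) fun σ => ?_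
        simp only
        rw [← Real.exp_sum, ← Real.exp_nat_mul, ← Real.exp_add, Real.exp_le_exp, neg_mul_hamiltonian,
          ← inner_sum]
        change ⟪θ, totalSpin σ⟫ + _ ≤ _
        -- Completing the square: expanding |(β/n)S - θ|² ≥ 0 gives the linear lower bound for the
        -- exponent.
        have h := sq_nonneg ‖(β / n) • totalSpin σ - θ‖
        rw [norm_sub_sq_real, hθn, real_inner_smul_left, norm_smul, mul_pow, Real.norm_eq_abs, sq_abs,
          real_inner_comm] at h
        have h3 := mul_nonneg (show 0 ≤ n / (2 * β) by positivity) h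
        have : (n : ℝ) / (2 * β) * ((β / n) ^ 2 * ‖totalSpin σ‖ ^ 2 -
            2 * (β / n * ⟪θ, totalSpin σ⟫) + 2 * N * x) =
            β / (2 * n) * ‖totalSpin σ‖ ^ 2 - ⟪θ, totalSpin σ⟫ + n * (x * N / β) := by
          field_simp
        rw [this] at h3
        linarith

/-- On τ < ε = βc the exponent is at most cn/2, against a partition function of at least exp(cn).
The exponential smallness is weakened to 1/n, which is all that is needed. -/
theorem exists_gibbs_small_meanField {β : ℝ} (hN : 2 ≤ N) (hβ : (N : ℝ) < β) :
    ∃ ε : ℝ, 0 < ε ∧ ∃ K : ℝ, 0 ≤ K ∧ ∀ n : ℕ, 1 ≤ n →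
      (gibbsMeasure N n β).real {σ | ‖meanField β σ‖ ^ 2 < ε} ≤ K / n := by
  have hN0 : (0 : ℝ) < N := by exact_mod_cast (by omega : 0 < N)
  have hβ0 : 0 < β := hN0.trans hβ
  obtain ⟨c, hc, hZ⟩ := exists_partition_lower hN hβ
  refine ⟨β * c, by positivity, 2 / c, by positivity, fun n hn => ?_⟩
  have hn0 : (0 : ℝ) < n := by exact_mod_cast hn
  set A : Set (SpinConfig N n) := {σ | ‖meanField β σ‖ ^ 2 < β * c}
  have hA : MeasurableSet A :=
    (isOpen_lt (by fun_prop) continuous_const).measurableSet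
  have hbound : gibbsMeasure N n β A ≤ ENNReal.ofReal (Real.exp (-(c * n / 2))) := by
    rw [gibbsMeasure, tilted_apply' _ _ hA]
    calc _ ≤ ∫⁻ σ in A, ENNReal.ofReal (Real.exp (-(c * n / 2)))
          ∂(Measure.pi fun _ => sphereUniform N) := by
          refine setLIntegral_mono measurable_const fun σ hσ => ENNReal.ofReal_le_ofReal ?_
          rw [div_le_iff₀ ((Real.exp_pos _).trans_le (hZ n hn))]
          refine le_trans ?_ (mul_le_mul_of_nonneg_left (hZ n hn) (Real.exp_pos _).le)
          rw [← Real.exp_add, Real.exp_le_exp, neg_mul_hamiltonian_eq_meanField hβ0 hn]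
          have h1 : (n : ℝ) / (2 * β) * ‖meanField β σ‖ ^ 2 ≤ n / (2 * β) * (β * c) :=
            mul_le_mul_of_nonneg_left (le_of_lt hσ) (by positivity)
          have h2 : (n : ℝ) / (2 * β) * (β * c) = c * n / 2 := by field_simp
          linarith
      _ ≤ _ := by
          rw [setLIntegral_const]
          exact mul_le_of_le_one_right' prob_le_one
  refine (ENNReal.toReal_le_of_le_ofReal (Real.exp_pos _).le hbound).trans ?_
  rw [Real.exp_neg, div_div, ← one_div, div_le_div_iff₀ (Real.exp_pos _) (by positivity)]
  have := Real.add_one_le_exp (c * n / 2)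
  linarith

end

/-! ### Deterministic estimates for the mean and local fields -/

section
variable {N n : ℕ}

theorem norm_totalSpin_le (σ : SpinConfig N n) : ‖totalSpin σ‖ ≤ n :=
  (norm_sum_le _ _).trans (by simp)

theorem norm_totalSpin_sub_le (σ : SpinConfig N n) (i : Fin n) :
    ‖totalSpin σ - (σ i : EuclideanSpace ℝ (Fin N))‖ ≤ n := by
  rw [totalSpin, ← Finset.sum_erase_eq_sub (Finset.mem_univ i)]
  refine (norm_sum_le _ _).trans ?_
  simp only [norm_spin, Finset.sum_const, nsmul_eq_mul, mul_one]
  exact_mod_cast (Finset.card_le_univ _).trans (by simp)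

theorem norm_div_smul_le {β : ℝ} (hβ : 0 ≤ β) {x : EuclideanSpace ℝ (Fin N)} (hx : ‖x‖ ≤ n) :
    ‖(β / n) • x‖ ≤ β := by
  rw [norm_smul, Real.norm_of_nonneg (by positivity)]
  rcases Nat.eq_zero_or_pos n with h | h
  · subst h; simpa using hβ
  · have : (0 : ℝ) < n := by exact_mod_cast h
    rw [div_mul_eq_mul_div, div_le_iff₀ this]
    gcongr

theorem norm_meanField_le {β : ℝ} (hβ : 0 ≤ β) (σ : SpinConfig N n) : ‖meanField β σ‖ ≤ β :=
  norm_div_smul_le hβ (norm_totalSpin_le σ)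

theorem norm_localField_le {β : ℝ} (hβ : 0 ≤ β) (σ : SpinConfig N n) (i : Fin n) :
    ‖localField β σ i‖ ≤ β :=
  norm_div_smul_le hβ (norm_totalSpin_sub_le σ i)

theorem localField_eq (β : ℝ) (σ : SpinConfig N n) (i : Fin n) :
    localField β σ i = meanField β σ - (β / n) • (σ i : EuclideanSpace ℝ (Fin N)) := by
  rw [localField, meanField, smul_sub]

theorem abs_sq_norm_sub_le {x y : EuclideanSpace ℝ (Fin N)} {K δ : ℝ} (hx : ‖x‖ ≤ K) (hy : ‖y‖ ≤ K)
    (hδ : ‖x - y‖ ≤ δ) : |‖x‖ ^ 2 - ‖y‖ ^ 2| ≤ 2 * K * δ := by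
  have h1 : ‖x‖ ^ 2 - ‖y‖ ^ 2 = (‖x‖ + ‖y‖) * (‖x‖ - ‖y‖) := by ring
  have hK : 0 ≤ K := (norm_nonneg x).trans hx
  rw [h1, abs_mul, abs_of_nonneg (by positivity)]
  exact mul_le_mul (by linarith) ((abs_norm_sub_norm_le x y).trans hδ) (abs_nonneg _) (by positivity)

theorem norm_meanField_sub_localField {β : ℝ} (hβ : 0 ≤ β) (σ : SpinConfig N n) (i : Fin n) :
    ‖meanField β σ - localField β σ i‖ ≤ β / n := by
  rw [localField_eq, sub_sub_cancel, norm_smul, norm_spin, mul_one, Real.norm_of_nonneg (by positivity)]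

theorem abs_sq_localField_sub_le {β : ℝ} (hβ : 0 ≤ β) (σ : SpinConfig N n) (i : Fin n) :
    |‖localField β σ i‖ ^ 2 - ‖meanField β σ‖ ^ 2| ≤ 2 * β ^ 2 / n := by
  rw [abs_sub_comm]
  refine (abs_sq_norm_sub_le (norm_meanField_le hβ σ) (norm_localField_le hβ σ i)
    (norm_meanField_sub_localField hβ σ i)).trans (le_of_eq ?_)
  ring

theorem sq_norm_mem_Icc {β R : ℝ} (hR : 4 * β ^ 2 ≤ R) {x : EuclideanSpace ℝ (Fin N)}
    (hx : ‖x‖ ≤ 2 * β) : ‖x‖ ^ 2 ∈ Set.Icc 0 R := by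
  refine ⟨sq_nonneg _, le_trans ?_ hR⟩
  calc ‖x‖ ^ 2 ≤ (2 * β) ^ 2 := by gcongr
    _ = _ := by ring

theorem abs_inner_localField_le {β : ℝ} (hβ : 0 ≤ β) (σ : SpinConfig N n) (i : Fin n) (s : Spin N) :
    |⟪localField β σ i, (s : EuclideanSpace ℝ (Fin N))⟫| ≤ β :=
  (abs_inner_spin_le _ s).trans (norm_localField_le hβ σ i)

/-- Exact because S is a multiple of θ; the term β/n is the self-interaction removed from each local
field. -/
theorem sum_inner_localField {β : ℝ} (hβ : β ≠ 0) (hn : 1 ≤ n) (σ : SpinConfig N n) :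
    1 / (n : ℝ) * ∑ i, ⟪localField β σ i, (σ i : EuclideanSpace ℝ (Fin N))⟫ =
      ‖meanField β σ‖ ^ 2 / β - β / n := by
  have hn0 : (n : ℝ) ≠ 0 := by positivity
  simp_rw [localField_eq, inner_sub_left, real_inner_smul_left, real_inner_self_eq_norm_sq, norm_spin]
  rw [Finset.sum_sub_distrib, ← inner_sum]
  change 1 / (n : ℝ) * (⟪meanField β σ, totalSpin σ⟫ - _) = _
  have h : totalSpin σ = (n / β : ℝ) • meanField β σ := by
    rw [meanField, smul_smul, div_mul_div_cancel₀ hβ, div_self hn0, one_smul]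
  rw [h, real_inner_smul_right, real_inner_self_eq_norm_sq]
  simp
  field_simp

/-- Since spins have unit length, the new value depends on s only through its inner product with S -
σ_i. -/
theorem sq_meanField_sub_update (β : ℝ) (σ : SpinConfig N n) (i : Fin n) (s : Spin N) :
    ‖meanField β σ‖ ^ 2 - ‖meanField β (Function.update σ i s)‖ ^ 2 =
      2 * (β / n) * (⟪localField β σ i, (σ i : EuclideanSpace ℝ (Fin N))⟫ -
        ⟪localField β σ i, (s : EuclideanSpace ℝ (Fin N))⟫) := by
  have h : ∀ r : Spin N, ‖meanField β (Function.update σ i r)‖ ^ 2 =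
      (β / n) ^ 2 * (‖totalSpin σ - (σ i : EuclideanSpace ℝ (Fin N))‖ ^ 2 + 1) +
        2 * (β / n) * ⟪localField β σ i, (r : EuclideanSpace ℝ (Fin N))⟫ := fun r => by
    rw [meanField, totalSpin_update, norm_smul, mul_pow, Real.norm_eq_abs, sq_abs, norm_add_sq_real,
      norm_spin, localField, real_inner_smul_left]
    ring
  have h0 := h (σ i)
  rw [Function.update_eq_self] at h0
  rw [h0, h s]
  ring

theorem abs_sq_meanField_sub_update_le {β : ℝ} (hβ : 0 ≤ β) (σ : SpinConfig N n) (i : Fin n) (s : Spin N) :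
    |‖meanField β σ‖ ^ 2 - ‖meanField β (Function.update σ i s)‖ ^ 2| ≤ 4 * β ^ 2 / n := by
  rw [sq_meanField_sub_update, abs_mul, abs_of_nonneg (by positivity)]
  have h := abs_sub (⟪localField β σ i, (σ i : EuclideanSpace ℝ (Fin N))⟫)
    ⟪localField β σ i, (s : EuclideanSpace ℝ (Fin N))⟫
  have h1 := abs_inner_localField_le hβ σ i (σ i)
  have h2 := abs_inner_localField_le hβ σ i s
  calc _ ≤ 2 * (β / n) * (2 * β) := by gcongr; linarith
    _ = _ := by ring

/-- `f(r) r` as a function of `t = r²`. -/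
noncomputable def slopeMul (N : ℕ) (t : ℝ) : ℝ := t * besselSlope N t

/-- The mean over `i` of `⟪θ_i, σ_i⟫ - E ⟪θ_i, σ_i'⟫`, where `θ_i` is the local field. -/
noncomputable def meanDrift (β : ℝ) (σ : SpinConfig N n) : ℝ :=
  1 / (n : ℝ) * ∑ i, (⟪localField β σ i, (σ i : EuclideanSpace ℝ (Fin N))⟫ -
    slopeMul N (‖localField β σ i‖ ^ 2))

/-- The mean over `i` of `E (⟪θ_i, σ_i⟫ - ⟪θ_i, σ_i'⟫)²`, where `θ_i` is the local field. -/
noncomputable def meanQuadratic (β : ℝ) (σ : SpinConfig N n) : ℝ :=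
  1 / (n : ℝ) * ∑ i, (⟪localField β σ i, (σ i : EuclideanSpace ℝ (Fin N))⟫ ^ 2 -
    2 * ⟪localField β σ i, (σ i : EuclideanSpace ℝ (Fin N))⟫ * slopeMul N (‖localField β σ i‖ ^ 2) +
      tiltedSecondMoment N (‖localField β σ i‖ ^ 2))

/-- `⟪θ_i, σ_i⟫²` minus its conditional mean given the other spins. -/
noncomputable def squareDefect (β : ℝ) (σ : SpinConfig N n) (i : Fin n) : ℝ :=
  ⟪localField β σ i, (σ i : EuclideanSpace ℝ (Fin N))⟫ ^ 2 - tiltedSecondMoment N (‖localField β σ i‖ ^ 2)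

theorem exists_lipschitz_slopeMul (hN : 2 ≤ N) (R : ℝ) :
    ∃ L : ℝ, 0 ≤ L ∧ ∀ s ∈ Set.Icc 0 R, ∀ t ∈ Set.Icc 0 R,
      |slopeMul N s - slopeMul N t| ≤ L * |s - t| := by
  have c1 := continuousOn_besselSlope hN
  have c2 := continuousOn_besselSlopeDeriv hN
  refine exists_lipschitz_bound (f' := fun t => 1 * besselSlope N t + t * besselSlopeDeriv N t)
    (fun t ht => (hasDerivAt_id t).mul (hasDerivAt_besselSlope hN ht)) (by fun_prop)

/-- Reduces continuity and Lipschitz bounds for the second moment to those for `slopeMul`. -/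
theorem tiltedSecondMoment_eq (t : ℝ) : tiltedSecondMoment N t = t - (N - 1) * slopeMul N t := by
  rw [tiltedSecondMoment, slopeMul]; ring

theorem continuousOn_slopeMul (hN : 2 ≤ N) : ContinuousOn (slopeMul N) (Set.Ici 0) :=
  continuousOn_id.mul (continuousOn_besselSlope hN)

theorem continuous_slopeMul_sq (hN : 2 ≤ N) {X : Type*} [TopologicalSpace X]
    {f : X → EuclideanSpace ℝ (Fin N)} (hf : Continuous f) :
    Continuous fun x => slopeMul N (‖f x‖ ^ 2) :=
  (continuousOn_slopeMul hN).comp_continuous (by fun_prop) fun _ => Set.mem_Ici.2 (sq_nonneg _)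

theorem continuous_tiltedSecondMoment_sq (hN : 2 ≤ N) {X : Type*} [TopologicalSpace X]
    {f : X → EuclideanSpace ℝ (Fin N)} (hf : Continuous f) :
    Continuous fun x => tiltedSecondMoment N (‖f x‖ ^ 2) := by
  have := continuous_slopeMul_sq hN hf
  simp_rw [tiltedSecondMoment_eq]
  fun_prop

theorem continuous_meanDrift (hN : 2 ≤ N) (β : ℝ) :
    Continuous (meanDrift β : SpinConfig N n → ℝ) := by
  unfold meanDrift
  have := fun i => continuous_slopeMul_sq hN (continuous_localField (n := n) β i)
  fun_prop

end

theorem abs_average_le {n : ℕ} (hn : 1 ≤ n) {f : Fin n → ℝ} {K : ℝ} (hf : ∀ i, |f i| ≤ K) :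
    |1 / (n : ℝ) * ∑ i, f i| ≤ K := by
  have hn0 : (0 : ℝ) < n := by exact_mod_cast hn
  rw [abs_mul, abs_of_nonneg (by positivity), one_div, inv_mul_le_iff₀ hn0]
  exact (Finset.abs_sum_le_sum_abs _ _).trans ((Finset.sum_le_sum fun i _ => hf i).trans (by simp))

section
variable {N n : ℕ}

theorem abs_tiltedSecondMoment_sub_le {L s t : ℝ} (hN : 2 ≤ N)
    (h : |slopeMul N s - slopeMul N t| ≤ L * |s - t|) :
    |tiltedSecondMoment N s - tiltedSecondMoment N t| ≤ (1 + N * L) * |s - t| := by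
  have h1 : (1 : ℝ) ≤ N := by exact_mod_cast (by omega : 1 ≤ N)
  have : tiltedSecondMoment N s - tiltedSecondMoment N t =
      (s - t) - (N - 1) * (slopeMul N s - slopeMul N t) := by
    rw [tiltedSecondMoment_eq, tiltedSecondMoment_eq]; ring
  rw [this]
  refine (abs_sub _ _).trans ?_
  rw [abs_mul, abs_of_nonneg (by linarith : (0 : ℝ) ≤ N - 1)]
  have h2 : ((N : ℝ) - 1) * |slopeMul N s - slopeMul N t| ≤ N * (L * |s - t|) :=
    mul_le_mul (by linarith) h (abs_nonneg _) (by linarith)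
  linarith

/-- The average of ⟨θ_i, σ_i⟩ is known exactly, and each |θ_i|² is within 2β²/n of τ, so Lipschitz
continuity replaces every conditional mean by its value at τ. -/
theorem abs_meanDrift_sub_le {β R L : ℝ} (hβ : 0 < β) (hR : 4 * β ^ 2 ≤ R) (hn : 1 ≤ n)
    (hL0 : 0 ≤ L) (hL : ∀ s ∈ Set.Icc 0 R, ∀ t ∈ Set.Icc 0 R, |slopeMul N s - slopeMul N t| ≤ L * |s - t|)
    (σ : SpinConfig N n) :
    |β * meanDrift β σ - ‖meanField β σ‖ ^ 2 * (1 - β * besselSlope N (‖meanField β σ‖ ^ 2))| ≤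
      (β ^ 2 + β * (L * (2 * β ^ 2))) / n := by
  have hn0 : (0 : ℝ) < n := by exact_mod_cast hn
  set τ := ‖meanField β σ‖ ^ 2
  have hτ : τ ∈ Set.Icc 0 R := sq_norm_mem_Icc hR ((norm_meanField_le hβ.le σ).trans (by linarith))
  have hi : ∀ i, |slopeMul N (‖localField β σ i‖ ^ 2) - slopeMul N τ| ≤ L * (2 * β ^ 2) / n := fun i => by
    refine (hL _ (sq_norm_mem_Icc hR ((norm_localField_le hβ.le σ i).trans (by linarith))) _ hτ).trans ?_
    rw [mul_div_assoc]
    exact mul_le_mul_of_nonneg_left (abs_sq_localField_sub_le hβ.le σ i) hL0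
  have hav := abs_average_le hn hi
  rw [Finset.sum_sub_distrib, Finset.sum_const, Finset.card_univ, Fintype.card_fin, nsmul_eq_mul,
    mul_sub, ← mul_assoc, one_div_mul_cancel hn0.ne', one_mul] at hav
  have hsum := sum_inner_localField hβ.ne' hn σ
  have hD : β * meanDrift β σ - τ * (1 - β * besselSlope N τ) = -(β ^ 2 / n) -
      β * (1 / (n : ℝ) * ∑ i, slopeMul N (‖localField β σ i‖ ^ 2) - slopeMul N τ) := by
    rw [meanDrift, Finset.sum_sub_distrib, mul_sub, hsum, slopeMul]
    change β * (τ / β - β / n - _) - _ = _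
    field_simp
    ring
  rw [hD]
  refine (abs_sub _ _).trans ?_
  rw [abs_neg, abs_of_nonneg (by positivity), abs_mul, abs_of_pos hβ, add_div, mul_div_assoc]
  gcongr

/-- Separates three errors: the fluctuation of ⟨θ_i, σ_i⟩² around its conditional mean, the O(1/n)
cost of replacing |θ_i|² by τ, and the distance from τ to the target t, which will be b². -/
theorem abs_meanQuadratic_sub_le {β R L : ℝ} (hN : 2 ≤ N) (hβ : 0 < β) (hR : 4 * β ^ 2 ≤ R) (hn : 1 ≤ n)
    (hL0 : 0 ≤ L) (hL : ∀ s ∈ Set.Icc 0 R, ∀ t ∈ Set.Icc 0 R, |slopeMul N s - slopeMul N t| ≤ L * |s - t|)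
    (σ : SpinConfig N n) {t : ℝ} (ht : t ∈ Set.Icc 0 R) :
    |meanQuadratic β σ - (2 * tiltedSecondMoment N t - 2 / β * (t * slopeMul N t))| ≤
      |1 / (n : ℝ) * ∑ i, squareDefect β σ i| +
        (2 * ((1 + N * L) * (2 * β ^ 2)) + 2 * (β * (L * (2 * β ^ 2))) + 2 * (β * (L * R))) / n +
        (2 * (1 + N * L) + 4 / β * (L * R)) * |‖meanField β σ‖ ^ 2 - t| := by
  have hn0 : (0 : ℝ) < n := by exact_mod_cast hn
  have hR0 : 0 ≤ R := le_trans (by positivity) hR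
  set τ := ‖meanField β σ‖ ^ 2
  have hτ : τ ∈ Set.Icc 0 R := sq_norm_mem_Icc hR ((norm_meanField_le hβ.le σ).trans (by linarith))
  have hmem : ∀ i, ‖localField β σ i‖ ^ 2 ∈ Set.Icc 0 R := fun i =>
    sq_norm_mem_Icc hR ((norm_localField_le hβ.le σ i).trans (by linarith))
  have hi : ∀ i, |slopeMul N (‖localField β σ i‖ ^ 2) - slopeMul N τ| ≤ L * (2 * β ^ 2) / n := fun i => by
    refine (hL _ (hmem i) _ hτ).trans ?_
    rw [mul_div_assoc]
    exact mul_le_mul_of_nonneg_left (abs_sq_localField_sub_le hβ.le σ i) hL0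
  have hi2 : ∀ i, |tiltedSecondMoment N (‖localField β σ i‖ ^ 2) - tiltedSecondMoment N τ| ≤
      (1 + N * L) * (2 * β ^ 2) / n := fun i => by
    refine (abs_tiltedSecondMoment_sub_le hN (hL _ (hmem i) _ hτ)).trans ?_
    rw [mul_div_assoc]
    exact mul_le_mul_of_nonneg_left (abs_sq_localField_sub_le hβ.le σ i) (by positivity)
  have hi3 : ∀ i, |⟪localField β σ i, (σ i : EuclideanSpace ℝ (Fin N))⟫ *
      (slopeMul N (‖localField β σ i‖ ^ 2) - slopeMul N τ)| ≤ β * (L * (2 * β ^ 2)) / n := fun i => by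
    rw [abs_mul, mul_div_assoc]
    exact mul_le_mul (abs_inner_localField_le hβ.le σ i _) (hi i) (abs_nonneg _) hβ.le
  have b2 := abs_average_le hn hi2
  have b3 := abs_average_le hn hi3
  have hsum := sum_inner_localField hβ.ne' hn σ
  have hbound : ∀ s ∈ Set.Icc 0 R, |slopeMul N s| ≤ L * R := fun s hs => by
    have h := hL s hs 0 ⟨le_rfl, hR0⟩
    rw [show slopeMul N 0 = 0 by simp [slopeMul], sub_zero, sub_zero, abs_of_nonneg hs.1] at h
    exact h.trans (mul_le_mul_of_nonneg_left hs.2 hL0)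
  have bprod : |τ * slopeMul N τ - t * slopeMul N t| ≤ 2 * (L * R) * |τ - t| := by
    have : τ * slopeMul N τ - t * slopeMul N t =
        τ * (slopeMul N τ - slopeMul N t) + (τ - t) * slopeMul N t := by ring
    rw [this]
    refine (abs_add_le _ _).trans ?_
    rw [abs_mul, abs_mul, abs_of_nonneg hτ.1]
    have h1 : τ * |slopeMul N τ - slopeMul N t| ≤ R * (L * |τ - t|) :=
      mul_le_mul hτ.2 (hL _ hτ _ ht) (abs_nonneg _) hR0
    have h2 : |τ - t| * |slopeMul N t| ≤ |τ - t| * (L * R) :=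
      mul_le_mul_of_nonneg_left (hbound t ht) (abs_nonneg _)
    linarith
  have bw := abs_tiltedSecondMoment_sub_le hN (hL _ hτ _ ht)
  have bg := hbound τ hτ
  set X := 1 / (n : ℝ) * ∑ i, (tiltedSecondMoment N (‖localField β σ i‖ ^ 2) - tiltedSecondMoment N τ) with hX
  set Y := 1 / (n : ℝ) * ∑ i, (⟪localField β σ i, (σ i : EuclideanSpace ℝ (Fin N))⟫ *
      (slopeMul N (‖localField β σ i‖ ^ 2) - slopeMul N τ)) with hY
  -- The cross term needs no concentration estimate: once |θ_i|² is replaced by τ in `slopeMul`,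
  -- only the exactly known average of ⟨θ_i, σ_i⟩ remains.
  have key : meanQuadratic β σ - (2 * tiltedSecondMoment N t - 2 / β * (t * slopeMul N t)) =
      1 / (n : ℝ) * ∑ i, squareDefect β σ i + 2 * X - 2 * Y + 2 * (β / n * slopeMul N τ) +
        2 * (tiltedSecondMoment N τ - tiltedSecondMoment N t) -
        2 / β * (τ * slopeMul N τ - t * slopeMul N t) := by
    have hX' : X = 1 / (n : ℝ) * ∑ i, tiltedSecondMoment N (‖localField β σ i‖ ^ 2) -
        tiltedSecondMoment N τ := by
      rw [hX, Finset.sum_sub_distrib, Finset.sum_const, Finset.card_univ, Fintype.card_fin, nsmul_eq_mul,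
        mul_sub, ← mul_assoc _ (n : ℝ), one_div_mul_cancel hn0.ne', one_mul]
    have hY' : Y = 1 / (n : ℝ) * ∑ i, ⟪localField β σ i, (σ i : EuclideanSpace ℝ (Fin N))⟫ *
        slopeMul N (‖localField β σ i‖ ^ 2) - (τ / β - β / n) * slopeMul N τ := by
      rw [hY, ← hsum]
      simp_rw [mul_sub]
      rw [Finset.sum_sub_distrib, ← Finset.sum_mul]
      ring
    have hQ : meanQuadratic β σ = 1 / (n : ℝ) * ∑ i, squareDefect β σ i -
        2 * (1 / (n : ℝ) * ∑ i, ⟪localField β σ i, (σ i : EuclideanSpace ℝ (Fin N))⟫ *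
          slopeMul N (‖localField β σ i‖ ^ 2)) +
        2 * (1 / (n : ℝ) * ∑ i, tiltedSecondMoment N (‖localField β σ i‖ ^ 2)) := by
      rw [meanQuadratic]
      simp only [squareDefect, Finset.sum_add_distrib, Finset.sum_sub_distrib, mul_assoc,
        ← Finset.mul_sum]
      ring
    rw [hQ, hX', hY']
    ring
  have e1 : |2 * (β / n * slopeMul N τ)| ≤ 2 * (β * (L * R) / n) := by
    rw [abs_mul, abs_mul, abs_of_nonneg (by positivity : 0 ≤ β / n), abs_of_pos (two_pos : (0 : ℝ) < 2)]
    have := mul_le_mul_of_nonneg_left bg (by positivity : 0 ≤ β / n)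
    calc _ ≤ 2 * (β / n * (L * R)) := by linarith
      _ = _ := by ring
  have e2 : |2 / β * (τ * slopeMul N τ - t * slopeMul N t)| ≤ 4 / β * (L * R) * |τ - t| := by
    rw [abs_mul, abs_of_pos (by positivity : 0 < 2 / β)]
    have := mul_le_mul_of_nonneg_left bprod (by positivity : 0 ≤ 2 / β)
    calc _ ≤ 2 / β * (2 * (L * R) * |τ - t|) := this
      _ = _ := by ring
  rw [key]
  have tri : ∀ a x y c d e : ℝ, |a + 2 * x - 2 * y + c + 2 * d - e| ≤
      |a| + 2 * |x| + 2 * |y| + |c| + 2 * |d| + |e| := by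
    intro a x y c d e
    refine abs_le.2 ⟨?_, ?_⟩ <;>
    linarith [neg_abs_le a, neg_abs_le x, neg_abs_le y, neg_abs_le c, neg_abs_le d, neg_abs_le e,
      le_abs_self a, le_abs_self x, le_abs_self y, le_abs_self c, le_abs_self d, le_abs_self e]
  refine (tri _ _ _ _ _ _).trans ?_
  have split : (2 * ((1 + N * L) * (2 * β ^ 2)) + 2 * (β * (L * (2 * β ^ 2))) + 2 * (β * (L * R))) / n =
      2 * ((1 + N * L) * (2 * β ^ 2) / n) + 2 * (β * (L * (2 * β ^ 2)) / n) + 2 * (β * (L * R) / n) := by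
    ring
  rw [split]
  linarith

/-- The field at j without the contribution of spin i is unchanged by an update at i. This makes the
cavity defect an admissible test function in `integral_squareDefect_mul`. -/
theorem localField_update_of_ne (β : ℝ) (σ : SpinConfig N n) {i j : Fin n} (hij : j ≠ i) (s : Spin N) :
    localField β (Function.update σ i s) j - (β / n) • (s : EuclideanSpace ℝ (Fin N)) =
      localField β σ j - (β / n) • (σ i : EuclideanSpace ℝ (Fin N)) := by
  simp only [localField, totalSpin_update, Function.update_of_ne hij]
  module

theorem continuous_squareDefect (hN : 2 ≤ N) (β : ℝ) (i : Fin n) :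
    Continuous fun σ : SpinConfig N n => squareDefect β σ i := by
  unfold squareDefect
  have := continuous_tiltedSecondMoment_sq hN (continuous_localField (n := n) β i)
  fun_prop

theorem continuous_meanQuadratic (hN : 2 ≤ N) (β : ℝ) :
    Continuous (meanQuadratic β : SpinConfig N n → ℝ) := by
  unfold meanQuadratic
  have := fun i => continuous_slopeMul_sq hN (continuous_localField (N := N) (n := n) β i)
  have := fun i => continuous_tiltedSecondMoment_sq hN (continuous_localField (N := N) (n := n) β i)
  fun_prop

/-! ### Integration against the resampling law -/

variable [NeZero N]

theorem integral_resampleLaw (hN : 2 ≤ N) (β : ℝ) (i : Fin n) {G : SpinConfig N n × Spin N → ℝ}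
    (hG : Integrable G (resampleLaw N n β i)) :
    ∫ z, G z ∂(resampleLaw N n β i) = ∫ σ, ∫ s, Real.exp
      ⟪localField β σ i, (s : EuclideanSpace ℝ (Fin N))⟫ / sphereMGF (localField β σ i) * G (σ, s)
      ∂(sphereUniform N) ∂(gibbsMeasure N n β) := by
  have hm := measurable_resample_density (n := n) hN β i
  have htop : ∀ᵐ z ∂((gibbsMeasure N n β).prod (sphereUniform N)), ENNReal.ofReal (Real.exp
      ⟪localField β z.1 i, (z.2 : EuclideanSpace ℝ (Fin N))⟫ / sphereMGF (localField β z.1 i)) < ∞ :=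
    .of_forall fun z => ENNReal.ofReal_lt_top
  have h0 : ∀ z : SpinConfig N n × Spin N, 0 ≤ Real.exp
      ⟪localField β z.1 i, (z.2 : EuclideanSpace ℝ (Fin N))⟫ / sphereMGF (localField β z.1 i) :=
    fun z => (div_pos (Real.exp_pos _) (sphereMGF_pos _)).le
  rw [resampleLaw, integrable_withDensity_iff_integrable_smul' hm htop] at hG
  rw [resampleLaw, integral_withDensity_eq_integral_toReal_smul hm htop]
  simp only [ENNReal.toReal_ofReal (h0 _), smul_eq_mul] at hG ⊢
  exact integral_prod _ hG

theorem integrable_of_bounded {X : Type*} [MeasurableSpace X] {μ : Measure X} [IsFiniteMeasure μ]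
    {f : X → ℝ} (hf : Measurable f) {K : ℝ} (hK : ∀ x, |f x| ≤ K) : Integrable f μ :=
  .of_bound hf.aestronglyMeasurable K (.of_forall hK)

theorem integral_fst_resampleLaw (hN : 2 ≤ N) (β : ℝ) (i : Fin n) {Φ : SpinConfig N n → ℝ}
    (hΦ : Measurable Φ) :
    ∫ z, Φ z.1 ∂(resampleLaw N n β i) = ∫ σ, Φ σ ∂(gibbsMeasure N n β) := by
  rw [← map_fst_resampleLaw hN β i, integral_map measurable_fst.aemeasurable hΦ.aestronglyMeasurable]

theorem integral_update_resampleLaw (hN : 2 ≤ N) (β : ℝ) (i : Fin n) {Φ : SpinConfig N n → ℝ}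
    (hΦ : Measurable Φ) :
    ∫ z, Φ (Function.update z.1 i z.2) ∂(resampleLaw N n β i) = ∫ σ, Φ σ ∂(gibbsMeasure N n β) := by
  rw [← map_update_resampleLaw hN β i,
    integral_map (measurable_update_prod i).aemeasurable hΦ.aestronglyMeasurable]

/-- With σ fixed, the integral over the new spin is a moment from `sphere_moments` divided by
M(θ_i). -/
theorem integral_mul_inner_resampleLaw (hN : 2 ≤ N) {β : ℝ} (hβ : 0 ≤ β) (i : Fin n)
    {Φ : SpinConfig N n → ℝ} (hΦ : Measurable Φ) {K : ℝ} (hK : ∀ σ, |Φ σ| ≤ K) :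
    (∫ z, Φ z.1 * ⟪localField β z.1 i, (z.2 : EuclideanSpace ℝ (Fin N))⟫ ∂(resampleLaw N n β i) =
      ∫ σ, Φ σ * slopeMul N (‖localField β σ i‖ ^ 2) ∂(gibbsMeasure N n β)) ∧
    (∫ z, Φ z.1 * ⟪localField β z.1 i, (z.2 : EuclideanSpace ℝ (Fin N))⟫ ^ 2 ∂(resampleLaw N n β i) =
      ∫ σ, Φ σ * tiltedSecondMoment N (‖localField β σ i‖ ^ 2) ∂(gibbsMeasure N n β)) := by
  have := isProbabilityMeasure_resampleLaw (n := n) hN β i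
  have hin : Measurable fun z : SpinConfig N n × Spin N =>
      ⟪localField β z.1 i, (z.2 : EuclideanSpace ℝ (Fin N))⟫ := Continuous.measurable (by fun_prop)
  have hbd := fun z : SpinConfig N n × Spin N => abs_inner_localField_le hβ z.1 i z.2
  have hI : Integrable (fun z : SpinConfig N n × Spin N => Φ z.1) (resampleLaw N n β i) :=
    integrable_of_bounded (hΦ.comp measurable_fst) fun z => hK z.1
  have h1 : Integrable (fun z : SpinConfig N n × Spin N =>
      Φ z.1 * ⟪localField β z.1 i, (z.2 : EuclideanSpace ℝ (Fin N))⟫) (resampleLaw N n β i) :=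
    hI.mul_bdd (c := β) hin.aestronglyMeasurable (.of_forall hbd)
  have h2 : Integrable (fun z : SpinConfig N n × Spin N =>
      Φ z.1 * ⟪localField β z.1 i, (z.2 : EuclideanSpace ℝ (Fin N))⟫ ^ 2) (resampleLaw N n β i) :=
    hI.mul_bdd (c := β ^ 2) (hin.pow_const 2).aestronglyMeasurable (.of_forall fun z => by
      rw [Real.norm_eq_abs, abs_pow]
      exact pow_le_pow_left₀ (abs_nonneg _) (hbd z) 2)
  constructor
  · rw [integral_resampleLaw hN β i h1]
    refine integral_congr_ae (.of_forall fun σ => ?_)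
    simp only
    set θ := localField β σ i
    have hM := (sphereMGF_pos θ).ne'
    have := (sphere_moments hN θ).1
    rw [slopeMul, (eq_div_iff hM).2 this.symm, ← integral_div, ← integral_const_mul]
    refine integral_congr_ae (.of_forall fun s => ?_)
    simp only
    ring
  · rw [integral_resampleLaw hN β i h2]
    refine integral_congr_ae (.of_forall fun σ => ?_)
    simp only
    set θ := localField β σ i
    have hM := (sphereMGF_pos θ).ne'
    have := (sphere_moments hN θ).2
    rw [(eq_div_iff hM).2 this.symm, ← integral_div, ← integral_const_mul]
    refine integral_congr_ae (.of_forall fun s => ?_)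
    simp only
    ring

end

/-! ### L¹ bounds from L², and near-orthogonality of the square defects -/

/-- From |f| ≤ √n f² + 1/√n, a weighted form of the arithmetic-geometric inequality that avoids a
square root of K. -/
theorem integral_abs_le_of_integral_sq_le {X : Type*} [MeasurableSpace X] {μ : Measure X}
    [IsProbabilityMeasure μ] {f : X → ℝ} (hf : Integrable f μ) (hf2 : Integrable (fun x => f x ^ 2) μ)
    {K : ℝ} {n : ℕ} (hn : 1 ≤ n) (h : ∫ x, f x ^ 2 ∂μ ≤ K / n) :
    ∫ x, |f x| ∂μ ≤ (K + 1) / √(n : ℝ) := by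
  have hn0 : (0 : ℝ) < n := by exact_mod_cast hn
  have hs : 0 < √(n : ℝ) := Real.sqrt_pos.2 hn0
  have hss : √(n : ℝ) ^ 2 = n := Real.sq_sqrt hn0.le
  have h1 : ∫ x, |f x| ∂μ ≤ ∫ x, (√(n : ℝ) * f x ^ 2 + 1 / √(n : ℝ)) ∂μ := by
    refine integral_mono hf.abs ((hf2.const_mul _).add (integrable_const _)) fun x => ?_
    simp only
    rw [← mul_le_mul_iff_right₀ hs, mul_add, mul_one_div_cancel hs.ne', ← mul_assoc, ← sq, ← sq_abs (f x)]
    nlinarith [sq_nonneg (√(n : ℝ) * |f x| - 1), abs_nonneg (f x), mul_nonneg hs.le (abs_nonneg (f x))]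
  refine h1.trans ?_
  rw [integral_add (hf2.const_mul _) (integrable_const _), integral_const_mul, integral_const,
    probReal_univ, one_smul, add_div]
  gcongr
  calc √(n : ℝ) * ∫ x, f x ^ 2 ∂μ ≤ √(n : ℝ) * (K / n) := by gcongr
    _ = K / √(n : ℝ) := by
      rw [mul_div_assoc', div_eq_div_iff hn0.ne' hs.ne']
      linear_combination K * hss

section
variable {N n : ℕ} [NeZero N]

/-- The defect at i has conditional mean zero given the other spins, hence is orthogonal to every
bounded function of them. -/
theorem integral_squareDefect_mul {β : ℝ} (hN : 2 ≤ N) (hβ : 0 ≤ β) (i : Fin n) {Ψ : SpinConfig N n → ℝ}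
    (hΨ : Measurable Ψ) {K : ℝ} (hK : ∀ σ, |Ψ σ| ≤ K)
    (hinv : ∀ σ s, Ψ (Function.update σ i s) = Ψ σ) :
    ∫ σ, squareDefect β σ i * Ψ σ ∂(gibbsMeasure N n β) = 0 := by
  have := isProbabilityMeasure_resampleLaw (n := n) hN β i
  have hc := continuous_squareDefect (n := n) hN β i
  have hw : Continuous fun σ : SpinConfig N n => tiltedSecondMoment N (‖localField β σ i‖ ^ 2) :=
    continuous_tiltedSecondMoment_sq hN (continuous_localField β i)
  rw [← integral_update_resampleLaw (Φ := fun σ => squareDefect β σ i * Ψ σ) hN β i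
    (hc.measurable.mul hΨ)]
  have h : ∀ z : SpinConfig N n × Spin N, squareDefect β (Function.update z.1 i z.2) i *
      Ψ (Function.update z.1 i z.2) =
      Ψ z.1 * ⟪localField β z.1 i, (z.2 : EuclideanSpace ℝ (Fin N))⟫ ^ 2 -
        Ψ z.1 * tiltedSecondMoment N (‖localField β z.1 i‖ ^ 2) := fun z => by
    rw [squareDefect, localField_update, hinv, Function.update_self]
    ring
  simp only [h]
  have hI : Integrable (fun z : SpinConfig N n × Spin N => Ψ z.1) (resampleLaw N n β i) :=
    integrable_of_bounded (hΨ.comp measurable_fst) fun z => hK z.1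
  have hin : Continuous fun z : SpinConfig N n × Spin N =>
      ⟪localField β z.1 i, (z.2 : EuclideanSpace ℝ (Fin N))⟫ ^ 2 := by fun_prop
  obtain ⟨C, hC⟩ := (isCompact_univ (X := SpinConfig N n)).exists_bound_of_continuousOn hw.continuousOn
  rw [integral_sub, (integral_mul_inner_resampleLaw hN hβ i hΨ hK).2,
    integral_fst_resampleLaw
      (Φ := fun σ => Ψ σ * tiltedSecondMoment N (‖localField β σ i‖ ^ 2)) hN β i (hΨ.mul hw.measurable)]
  · simp
  · refine hI.mul_bdd (c := β ^ 2) hin.aestronglyMeasurable (.of_forall fun z => ?_)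
    rw [Real.norm_eq_abs, abs_pow]
    exact pow_le_pow_left₀ (abs_nonneg _) (abs_inner_localField_le hβ z.1 i z.2) 2
  · exact hI.mul_bdd (c := C) (hw.comp continuous_fst).aestronglyMeasurable
      (.of_forall fun z => hC z.1 (Set.mem_univ _))

/-- `squareDefect β σ j` with the contribution of `σ_i` to the field at `j` left out. -/
noncomputable def cavitySquareDefect (β : ℝ) (σ : SpinConfig N n) (i j : Fin n) : ℝ :=
  ⟪localField β σ j - (β / n) • (σ i : EuclideanSpace ℝ (Fin N)), (σ j : EuclideanSpace ℝ (Fin N))⟫ ^ 2 -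
    tiltedSecondMoment N (‖localField β σ j - (β / n) • (σ i : EuclideanSpace ℝ (Fin N))‖ ^ 2)

omit [NeZero N] in
-- The crude triangle bound, with j = i allowed, is why Lipschitz constants are taken on [0, R] with
-- R ≥ 4β².
theorem norm_cavityField_le {β : ℝ} (hβ : 0 ≤ β) (hn : 1 ≤ n) (σ : SpinConfig N n) (i j : Fin n) :
    ‖localField β σ j - (β / n) • (σ i : EuclideanSpace ℝ (Fin N))‖ ≤ 2 * β := by
  have hn1 : (1 : ℝ) ≤ n := by exact_mod_cast hn
  refine (norm_sub_le _ _).trans ?_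
  have h1 := norm_localField_le hβ σ j
  have h2 : ‖(β / n) • (σ i : EuclideanSpace ℝ (Fin N))‖ ≤ β :=
    norm_div_smul_le hβ (by simpa using hn1)
  linarith

omit [NeZero N] in
theorem abs_squareDefect_sub_cavity_le {β R L : ℝ} (hN : 2 ≤ N) (hβ : 0 ≤ β) (hR : 4 * β ^ 2 ≤ R)
    (hn : 1 ≤ n) (hL0 : 0 ≤ L)
    (hL : ∀ s ∈ Set.Icc 0 R, ∀ t ∈ Set.Icc 0 R, |slopeMul N s - slopeMul N t| ≤ L * |s - t|)
    (σ : SpinConfig N n) (i j : Fin n) :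
    |squareDefect β σ j - cavitySquareDefect β σ i j| ≤ (1 + (1 + N * L)) * (4 * β ^ 2) / n := by
  set θ := localField β σ j with hθ
  set θ' := localField β σ j - (β / n) • (σ i : EuclideanSpace ℝ (Fin N)) with hθ'
  have hθ2 : ‖θ‖ ≤ 2 * β := (norm_localField_le hβ σ j).trans (by linarith)
  have hθ'2 : ‖θ'‖ ≤ 2 * β := norm_cavityField_le hβ hn σ i j
  have hd : θ - θ' = (β / n) • (σ i : EuclideanSpace ℝ (Fin N)) := by simp [hθ', θ]
  have hdist : ‖θ - θ'‖ ≤ β / n := by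
    rw [hd, norm_smul, norm_spin, mul_one, Real.norm_of_nonneg (by positivity)]
  have h1 : |‖θ‖ ^ 2 - ‖θ'‖ ^ 2| ≤ 4 * β ^ 2 / n :=
    (abs_sq_norm_sub_le hθ2 hθ'2 hdist).trans (le_of_eq (by ring))
  have h2 := (abs_tiltedSecondMoment_sub_le hN (hL _ (sq_norm_mem_Icc hR hθ2) _
    (sq_norm_mem_Icc hR hθ'2))).trans (mul_le_mul_of_nonneg_left h1 (by positivity))
  have h3 : |⟪θ, (σ j : EuclideanSpace ℝ (Fin N))⟫ ^ 2 - ⟪θ', (σ j : EuclideanSpace ℝ (Fin N))⟫ ^ 2| ≤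
      4 * β ^ 2 / n := by
    have : ⟪θ, (σ j : EuclideanSpace ℝ (Fin N))⟫ ^ 2 - ⟪θ', (σ j : EuclideanSpace ℝ (Fin N))⟫ ^ 2 =
        ⟪θ + θ', (σ j : EuclideanSpace ℝ (Fin N))⟫ * ⟪θ - θ', (σ j : EuclideanSpace ℝ (Fin N))⟫ := by
      rw [inner_add_left θ θ', inner_sub_left θ θ']; ring
    rw [this, abs_mul]
    calc _ ≤ (4 * β) * (β / n) := mul_le_mul ((abs_inner_spin_le _ _).trans
            ((norm_add_le _ _).trans (by linarith))) ((abs_inner_spin_le _ _).trans hdist)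
            (abs_nonneg _) (by positivity)
      _ = _ := by ring
  have e : squareDefect β σ j - cavitySquareDefect β σ i j =
      (⟪θ, (σ j : EuclideanSpace ℝ (Fin N))⟫ ^ 2 - ⟪θ', (σ j : EuclideanSpace ℝ (Fin N))⟫ ^ 2) -
      (tiltedSecondMoment N (‖θ‖ ^ 2) - tiltedSecondMoment N (‖θ'‖ ^ 2)) := by
    rw [squareDefect, cavitySquareDefect]; ring
  rw [e]
  refine (abs_sub _ _).trans ((add_le_add h3 h2).trans (le_of_eq ?_))
  ring

omit [NeZero N] in
theorem abs_squareDefect_le {β R L : ℝ} (hN : 2 ≤ N) (hβ : 0 ≤ β) (hR : 4 * β ^ 2 ≤ R) (hL0 : 0 ≤ L)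
    (hL : ∀ s ∈ Set.Icc 0 R, ∀ t ∈ Set.Icc 0 R, |slopeMul N s - slopeMul N t| ≤ L * |s - t|)
    (σ : SpinConfig N n) (i : Fin n) :
    |squareDefect β σ i| ≤ β ^ 2 + (1 + N * L) * R := by
  have hR0 : 0 ≤ R := le_trans (by positivity) hR
  have hmem := sq_norm_mem_Icc hR ((norm_localField_le hβ σ i).trans (by linarith))
  have h := abs_tiltedSecondMoment_sub_le hN (hL _ hmem 0 ⟨le_rfl, hR0⟩)
  rw [show tiltedSecondMoment N 0 = 0 by simp [tiltedSecondMoment], sub_zero, sub_zero,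
    abs_of_nonneg hmem.1] at h
  refine (abs_sub _ _).trans (add_le_add ?_ (h.trans (mul_le_mul_of_nonneg_left hmem.2 (by positivity))))
  rw [abs_pow]
  exact pow_le_pow_left₀ (abs_nonneg _) (abs_inner_localField_le hβ σ i _) 2

omit [NeZero N] in
theorem continuous_cavitySquareDefect (hN : 2 ≤ N) (β : ℝ) (i j : Fin n) :
    Continuous fun σ : SpinConfig N n => cavitySquareDefect β σ i j := by
  unfold cavitySquareDefect
  have := continuous_tiltedSecondMoment_sq hN (f := fun σ : SpinConfig N n =>
    localField β σ j - (β / n) • (σ i : EuclideanSpace ℝ (Fin N))) (by fun_prop)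
  fun_prop

/-- Replace the defect at j by its cavity version, which is orthogonal to the defect at i. Only the
O(1/n) replacement error survives. -/
theorem integral_squareDefect_mul_squareDefect_le {β R L : ℝ} (hN : 2 ≤ N) (hβ : 0 ≤ β)
    (hR : 4 * β ^ 2 ≤ R) (hn : 1 ≤ n) (hL0 : 0 ≤ L)
    (hL : ∀ s ∈ Set.Icc 0 R, ∀ t ∈ Set.Icc 0 R, |slopeMul N s - slopeMul N t| ≤ L * |s - t|)
    {i j : Fin n} (hij : j ≠ i) :
    ∫ σ, squareDefect β σ i * squareDefect β σ j ∂(gibbsMeasure N n β) ≤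
      (β ^ 2 + (1 + N * L) * R) * ((1 + (1 + N * L)) * (4 * β ^ 2) / n) := by
  set Ψ : SpinConfig N n → ℝ := fun σ => cavitySquareDefect β σ i j
  have hΨc : Continuous Ψ := continuous_cavitySquareDefect hN β i j
  have hci := continuous_squareDefect (n := n) hN β i
  have hcj := continuous_squareDefect (n := n) hN β j
  obtain ⟨K, hK⟩ := (isCompact_univ (X := SpinConfig N n)).exists_bound_of_continuousOn hΨc.continuousOn
  have h0 := integral_squareDefect_mul hN hβ i hΨc.measurable (fun σ => hK σ (Set.mem_univ _))
    fun σ s => by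
      simp only [Ψ, cavitySquareDefect, Function.update_self, localField_update_of_ne β σ hij,
        Function.update_of_ne hij]
  have hR0 : 0 ≤ R := le_trans (by positivity) hR
  have hint : Integrable (fun σ => squareDefect β σ i * squareDefect β σ j - squareDefect β σ i * Ψ σ)
    (gibbsMeasure N n β) := Continuous.integrable_of_compactSpace (by fun_prop)
  have hsub : ∫ σ, squareDefect β σ i * squareDefect β σ j ∂(gibbsMeasure N n β) =
      ∫ σ, (squareDefect β σ i * squareDefect β σ j - squareDefect β σ i * Ψ σ) ∂(gibbsMeasure N n β) := by
    rw [integral_sub (f := fun σ => squareDefect β σ i * squareDefect β σ j)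
      (g := fun σ => squareDefect β σ i * Ψ σ) (hci.mul hcj).integrable_of_compactSpace
      (hci.mul hΨc).integrable_of_compactSpace, h0, sub_zero]
  rw [hsub]
  refine (integral_mono hint (integrable_const _) fun σ => ?_).trans (by
    rw [integral_const, probReal_univ, one_smul])
  simp only
  rw [← mul_sub]
  refine (le_abs_self _).trans ?_
  rw [abs_mul]
  exact mul_le_mul (abs_squareDefect_le hN hβ hR hL0 hL σ i)
    (abs_squareDefect_sub_cavity_le hN hβ hR hn hL0 hL σ i j) (abs_nonneg _) (by positivity)

/-- In the expanded square, n diagonal terms are bounded and n² cross terms are O(1/n); dividing by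
n² leaves O(1/n). -/
theorem integral_average_squareDefect_sq_le {β R L : ℝ} (hN : 2 ≤ N) (hβ : 0 ≤ β)
    (hR : 4 * β ^ 2 ≤ R) (hn : 1 ≤ n) (hL0 : 0 ≤ L)
    (hL : ∀ s ∈ Set.Icc 0 R, ∀ t ∈ Set.Icc 0 R, |slopeMul N s - slopeMul N t| ≤ L * |s - t|) :
    ∫ σ, (1 / (n : ℝ) * ∑ i, squareDefect β σ i) ^ 2 ∂(gibbsMeasure N n β) ≤
      ((β ^ 2 + (1 + N * L) * R) ^ 2 + (β ^ 2 + (1 + N * L) * R) * ((1 + (1 + N * L)) * (4 * β ^ 2))) / n := by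
  have hn0 : (0 : ℝ) < n := by exact_mod_cast hn
  have hR0 : 0 ≤ R := le_trans (by positivity) hR
  set K := β ^ 2 + (1 + N * L) * R
  set K' := (1 + (1 + N * L)) * (4 * β ^ 2)
  have hK : 0 ≤ K := by positivity
  have hK' : 0 ≤ K' := by positivity
  have hc := fun i => continuous_squareDefect (N := N) (n := n) hN β i
  have hint : ∀ i j, Integrable (fun σ => squareDefect β σ i * squareDefect β σ j) (gibbsMeasure N n β) :=
    fun i j => ((hc i).mul (hc j)).integrable_of_compactSpace
  have hexp : ∀ σ : SpinConfig N n, (1 / (n : ℝ) * ∑ i, squareDefect β σ i) ^ 2 =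
      1 / (n : ℝ) ^ 2 * ∑ i, ∑ j, squareDefect β σ i * squareDefect β σ j := fun σ => by
    rw [mul_pow, sq (∑ i, _), Finset.sum_mul_sum]
    ring
  simp_rw [hexp]
  rw [integral_const_mul, integral_finsetSum _ fun i _ => integrable_finsetSum _ fun j _ => hint i j]
  have hterm : ∀ i j, ∫ σ, squareDefect β σ i * squareDefect β σ j ∂(gibbsMeasure N n β) ≤
      (if j = i then K ^ 2 else 0) + K * (K' / n) := by
    intro i j
    have hpos : 0 ≤ K * (K' / n) := by positivity
    by_cases hij : j = i
    · subst hij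
      rw [if_pos rfl]
      have : ∫ σ, squareDefect β σ j * squareDefect β σ j ∂(gibbsMeasure N n β) ≤ K ^ 2 := by
        refine (integral_mono (hint j j) (integrable_const (K ^ 2)) fun σ => ?_).trans (by
          rw [integral_const, probReal_univ, one_smul])
        simp only
        rw [← sq, ← sq_abs]
        exact pow_le_pow_left₀ (abs_nonneg _) (abs_squareDefect_le hN hβ hR hL0 hL σ j) 2
      linarith
    · rw [if_neg hij, zero_add]
      exact integral_squareDefect_mul_squareDefect_le hN hβ hR hn hL0 hL hij
  have hsum : ∑ i, ∫ σ, ∑ j, squareDefect β σ i * squareDefect β σ j ∂(gibbsMeasure N n β) ≤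
      ∑ i : Fin n, ∑ j : Fin n, ((if j = i then K ^ 2 else 0) + K * (K' / n)) := by
    refine Finset.sum_le_sum fun i _ => ?_
    rw [integral_finsetSum _ fun j _ => hint i j]
    exact Finset.sum_le_sum fun j _ => hterm i j
  refine (mul_le_mul_of_nonneg_left hsum (by positivity)).trans (le_of_eq ?_)
  simp [Finset.sum_add_distrib]
  field_simp

/-! ### Conditional moments of one resampling step -/

/-- The antisymmetry of the resampling step, in the form `E (W - W') (W - c) = ½ E (W - W')²`. -/
theorem integral_resample_antisymm {β : ℝ} (hN : 2 ≤ N) (i : Fin n) {φ : SpinConfig N n → ℝ}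
    (hφ : Continuous φ) :
    ∫ z, (φ z.1 - φ (Function.update z.1 i z.2)) * φ z.1 ∂(resampleLaw N n β i) =
      1 / 2 * ∫ z, (φ z.1 - φ (Function.update z.1 i z.2)) ^ 2 ∂(resampleLaw N n β i) := by
  have := isProbabilityMeasure_resampleLaw (n := n) hN β i
  have hup : Continuous fun z : SpinConfig N n × Spin N => Function.update z.1 i z.2 := by fun_prop
  have hφu := hφ.comp hup
  have hφ1 : Continuous fun z : SpinConfig N n × Spin N => φ z.1 := by fun_prop
  -- The difference of squares integrates to zero by stationarity alone.
  have e : ∀ z : SpinConfig N n × Spin N, (φ z.1 - φ (Function.update z.1 i z.2)) * φ z.1 =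
      1 / 2 * (φ z.1 - φ (Function.update z.1 i z.2)) ^ 2 +
      1 / 2 * (φ z.1 ^ 2 - φ (Function.update z.1 i z.2) ^ 2) := fun z => by ring
  simp_rw [e]
  have i1 : Integrable (fun z : SpinConfig N n × Spin N => (φ z.1 - φ (Function.update z.1 i z.2)) ^ 2)
    (resampleLaw N n β i) := ((hφ1.sub hφu).pow 2).integrable_of_compactSpace
  have i2 : Integrable (fun z : SpinConfig N n × Spin N => φ z.1 ^ 2)
    (resampleLaw N n β i) := (hφ1.pow 2).integrable_of_compactSpace
  have i3 : Integrable (fun z : SpinConfig N n × Spin N => φ (Function.update z.1 i z.2) ^ 2)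
    (resampleLaw N n β i) := (hφu.pow 2).integrable_of_compactSpace
  have i4 : Integrable (fun z : SpinConfig N n × Spin N => 1 / 2 *
    (φ z.1 ^ 2 - φ (Function.update z.1 i z.2) ^ 2)) (resampleLaw N n β i) := (i2.sub i3).const_mul _
  rw [integral_add (i1.const_mul _) i4, integral_const_mul, integral_const_mul,
    integral_sub i2 i3,
    integral_fst_resampleLaw (Φ := fun σ => φ σ ^ 2) hN β i (hφ.pow 2).measurable,
    integral_update_resampleLaw (Φ := fun σ => φ σ ^ 2) hN β i (hφ.pow 2).measurable]
  ring

/-- Identifies `meanDrift` as the conditional mean given σ in weak form, against bounded test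
functions; averaging over i stands for the uniform index. -/
theorem integral_mul_meanDrift {β : ℝ} (hN : 2 ≤ N) (hβ : 0 ≤ β) {Φ : SpinConfig N n → ℝ}
    (hΦ : Measurable Φ) {K : ℝ} (hK : ∀ σ, |Φ σ| ≤ K) :
    1 / (n : ℝ) * ∑ i, ∫ z, Φ z.1 * (⟪localField β z.1 i, (z.1 i : EuclideanSpace ℝ (Fin N))⟫ -
      ⟪localField β z.1 i, (z.2 : EuclideanSpace ℝ (Fin N))⟫) ∂(resampleLaw N n β i) =
    ∫ σ, Φ σ * meanDrift β σ ∂(gibbsMeasure N n β) := by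
  have hint : ∀ f : SpinConfig N n → ℝ, Continuous f →
      Integrable (fun σ => Φ σ * f σ) (gibbsMeasure N n β) := fun f hf => by
    obtain ⟨C, hC⟩ := (isCompact_univ (X := SpinConfig N n)).exists_bound_of_continuousOn hf.continuousOn
    exact (integrable_of_bounded hΦ hK).mul_bdd (c := C) hf.aestronglyMeasurable
      (.of_forall fun z => hC z (Set.mem_univ _))
  have hs := fun i => continuous_slopeMul_sq hN (continuous_localField (N := N) (n := n) β i)
  have hterm : ∀ i : Fin n, ∫ z, Φ z.1 * (⟪localField β z.1 i, (z.1 i : EuclideanSpace ℝ (Fin N))⟫ -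
      ⟪localField β z.1 i, (z.2 : EuclideanSpace ℝ (Fin N))⟫) ∂(resampleLaw N n β i) =
      ∫ σ, Φ σ * (⟪localField β σ i, (σ i : EuclideanSpace ℝ (Fin N))⟫ -
        slopeMul N (‖localField β σ i‖ ^ 2)) ∂(gibbsMeasure N n β) := fun i => by
    have := isProbabilityMeasure_resampleLaw (n := n) hN β i
    have hI : Integrable (fun z : SpinConfig N n × Spin N => Φ z.1) (resampleLaw N n β i) :=
      integrable_of_bounded (hΦ.comp measurable_fst) fun z => hK z.1
    have c1 : Continuous fun z : SpinConfig N n × Spin N =>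
      ⟪localField β z.1 i, (z.1 i : EuclideanSpace ℝ (Fin N))⟫ := by fun_prop
    have c1' : Continuous fun σ : SpinConfig N n =>
      ⟪localField β σ i, (σ i : EuclideanSpace ℝ (Fin N))⟫ := by fun_prop
    have c2 : Continuous fun z : SpinConfig N n × Spin N =>
      ⟪localField β z.1 i, (z.2 : EuclideanSpace ℝ (Fin N))⟫ := by fun_prop
    simp_rw [mul_sub]
    rw [integral_sub, integral_sub (hint _ c1') (hint _ (hs i)),
      (integral_mul_inner_resampleLaw hN hβ i hΦ hK).1,
      integral_fst_resampleLaw (Φ := fun σ => Φ σ * ⟪localField β σ i, (σ i : EuclideanSpace ℝ (Fin N))⟫)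
        hN β i (hΦ.mul c1'.measurable)]
    · exact hI.mul_bdd (c := β) c1.aestronglyMeasurable
        (.of_forall fun z => abs_inner_localField_le hβ z.1 i _)
    · exact hI.mul_bdd (c := β) c2.aestronglyMeasurable
        (.of_forall fun z => abs_inner_localField_le hβ z.1 i _)
  simp_rw [hterm]
  rw [← integral_finsetSum _ fun i _ => hint _ (by
      have := hs i
      fun_prop), ← integral_const_mul]
  refine integral_congr_ae (.of_forall fun σ => ?_)
  simp only [meanDrift, ← Finset.mul_sum]
  ring

theorem integral_mul_meanQuadratic {β : ℝ} (hN : 2 ≤ N) (hβ : 0 ≤ β) {Φ : SpinConfig N n → ℝ}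
    (hΦ : Measurable Φ) {K : ℝ} (hK : ∀ σ, |Φ σ| ≤ K) :
    1 / (n : ℝ) * ∑ i, ∫ z, Φ z.1 * (⟪localField β z.1 i, (z.1 i : EuclideanSpace ℝ (Fin N))⟫ -
      ⟪localField β z.1 i, (z.2 : EuclideanSpace ℝ (Fin N))⟫) ^ 2 ∂(resampleLaw N n β i) =
    ∫ σ, Φ σ * meanQuadratic β σ ∂(gibbsMeasure N n β) := by
  have hbound : ∀ f : SpinConfig N n → ℝ, Continuous f → ∃ C, ∀ σ, |f σ| ≤ C := fun f hf => by
    obtain ⟨C, hC⟩ := (isCompact_univ (X := SpinConfig N n)).exists_bound_of_continuousOn hf.continuousOn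
    exact ⟨C, fun σ => hC σ (Set.mem_univ _)⟩
  have hint : ∀ f : SpinConfig N n → ℝ, Continuous f →
      Integrable (fun σ => Φ σ * f σ) (gibbsMeasure N n β) := fun f hf => by
    obtain ⟨C, hC⟩ := hbound f hf
    exact (integrable_of_bounded hΦ hK).mul_bdd (c := C) hf.aestronglyMeasurable (.of_forall hC)
  have hs := fun i => continuous_slopeMul_sq hN (continuous_localField (N := N) (n := n) β i)
  have hw := fun i => continuous_tiltedSecondMoment_sq hN (continuous_localField (N := N) (n := n) β i)
  have hterm : ∀ i : Fin n, ∫ z, Φ z.1 * (⟪localField β z.1 i, (z.1 i : EuclideanSpace ℝ (Fin N))⟫ -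
      ⟪localField β z.1 i, (z.2 : EuclideanSpace ℝ (Fin N))⟫) ^ 2 ∂(resampleLaw N n β i) =
      ∫ σ, Φ σ * (⟪localField β σ i, (σ i : EuclideanSpace ℝ (Fin N))⟫ ^ 2 -
        2 * ⟪localField β σ i, (σ i : EuclideanSpace ℝ (Fin N))⟫ * slopeMul N (‖localField β σ i‖ ^ 2) +
        tiltedSecondMoment N (‖localField β σ i‖ ^ 2)) ∂(gibbsMeasure N n β) := fun i => by
    have := isProbabilityMeasure_resampleLaw (n := n) hN β i
    set a : SpinConfig N n → ℝ := fun σ => ⟪localField β σ i, (σ i : EuclideanSpace ℝ (Fin N))⟫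
    set c : SpinConfig N n × Spin N → ℝ := fun z => ⟪localField β z.1 i, (z.2 : EuclideanSpace ℝ (Fin N))⟫
    have ha : Continuous a := by fun_prop
    have hc : Continuous c := by fun_prop
    have hcb : ∀ z, |c z| ≤ β := fun z => abs_inner_localField_le hβ z.1 i z.2
    obtain ⟨Ca, hCa⟩ := hbound a ha
    -- The cross term of the square is a first moment of the new spin with test function Φ · 2a, so
    -- the earlier lemma applies to it unchanged.
    have hΦ2 : Measurable fun σ => Φ σ * (2 * a σ) := hΦ.mul (ha.measurable.const_mul 2)
    have hΦ2b : ∀ σ, |Φ σ * (2 * a σ)| ≤ K * (2 * Ca) := fun σ => by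
      rw [abs_mul, abs_mul, abs_two]
      have := (abs_nonneg _).trans (hK σ)
      gcongr
      · exact hK σ
      · exact hCa σ
    have hΦ3 : Measurable fun σ => Φ σ * a σ ^ 2 := hΦ.mul (ha.measurable.pow_const 2)
    have hΦ3b : ∀ σ, |Φ σ * a σ ^ 2| ≤ K * Ca ^ 2 := fun σ => by
      rw [abs_mul, abs_pow]
      have := (abs_nonneg _).trans (hK σ)
      gcongr
      · exact hK σ
      · exact hCa σ
    have hI : Integrable (fun z : SpinConfig N n × Spin N => Φ z.1) (resampleLaw N n β i) :=
      integrable_of_bounded (hΦ.comp measurable_fst) fun z => hK z.1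
    have hI2 : Integrable (fun z : SpinConfig N n × Spin N => Φ z.1 * (2 * a z.1)) (resampleLaw N n β i) :=
      integrable_of_bounded (hΦ2.comp measurable_fst) fun z => hΦ2b z.1
    have i1 : Integrable (fun z : SpinConfig N n × Spin N => Φ z.1 * a z.1 ^ 2) (resampleLaw N n β i) :=
      integrable_of_bounded (hΦ3.comp measurable_fst) fun z => hΦ3b z.1
    have i2 : Integrable (fun z : SpinConfig N n × Spin N => Φ z.1 * (2 * a z.1) * c z) (resampleLaw N n β i) :=
      hI2.mul_bdd (c := β) hc.aestronglyMeasurable (.of_forall hcb)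
    have i3 : Integrable (fun z : SpinConfig N n × Spin N => Φ z.1 * c z ^ 2) (resampleLaw N n β i) :=
      hI.mul_bdd (c := β ^ 2) (hc.pow 2).aestronglyMeasurable (.of_forall fun z => by
        rw [Real.norm_eq_abs, abs_pow]
        exact pow_le_pow_left₀ (abs_nonneg _) (hcb z) 2)
    have e1 : ∀ z : SpinConfig N n × Spin N, Φ z.1 * (a z.1 - c z) ^ 2 =
        Φ z.1 * a z.1 ^ 2 - Φ z.1 * (2 * a z.1) * c z + Φ z.1 * c z ^ 2 := fun z => by ring
    have e2 : ∀ σ, Φ σ * (a σ ^ 2 - 2 * a σ * slopeMul N (‖localField β σ i‖ ^ 2) +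
        tiltedSecondMoment N (‖localField β σ i‖ ^ 2)) =
        Φ σ * a σ ^ 2 - Φ σ * (2 * a σ) * slopeMul N (‖localField β σ i‖ ^ 2) +
          Φ σ * tiltedSecondMoment N (‖localField β σ i‖ ^ 2) := fun σ => by ring
    have j1 : Integrable (fun σ => Φ σ * a σ ^ 2) (gibbsMeasure N n β) := hint _ (ha.pow 2)
    have j2 : Integrable (fun σ => Φ σ * (2 * a σ) * slopeMul N (‖localField β σ i‖ ^ 2))
        (gibbsMeasure N n β) := by
      simp_rw [mul_assoc (Φ _)]
      exact hint _ ((continuous_const.mul ha).mul (hs i))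
    have i12 : Integrable (fun z : SpinConfig N n × Spin N =>
      Φ z.1 * a z.1 ^ 2 - Φ z.1 * (2 * a z.1) * c z) (resampleLaw N n β i) := i1.sub i2
    have j12 : Integrable (fun σ => Φ σ * a σ ^ 2 - Φ σ * (2 * a σ) * slopeMul N (‖localField β σ i‖ ^ 2))
        (gibbsMeasure N n β) := j1.sub j2
    change ∫ z, Φ z.1 * (a z.1 - c z) ^ 2 ∂(resampleLaw N n β i) = ∫ σ, Φ σ * (a σ ^ 2 - 2 * a σ *
      slopeMul N (‖localField β σ i‖ ^ 2) + tiltedSecondMoment N (‖localField β σ i‖ ^ 2)) ∂_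
    simp_rw [e1, e2]
    rw [integral_add i12 i3, integral_sub i1 i2, integral_add j12 (hint _ (hw i)),
      integral_sub j1 j2, (integral_mul_inner_resampleLaw hN hβ i hΦ hK).2,
      (integral_mul_inner_resampleLaw hN hβ i hΦ2 hΦ2b).1, integral_fst_resampleLaw hN β i hΦ3]
  simp_rw [hterm]
  rw [← integral_finsetSum _ fun i _ => hint _ (by
      have := hs i
      have := hw i
      fun_prop), ← integral_const_mul]
  refine integral_congr_ae (.of_forall fun σ => ?_)
  simp only [meanQuadratic, ← Finset.mul_sum]
  ring

end

/-! ### Concentration of the squared mean field -/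

section
variable {N : ℕ} [NeZero N]

/-- By antisymmetry the contribution of each site is (n/4β)E(φ - φ')², and |φ - φ'| ≤ 4β²/n. The
centring constant drops out of the difference. -/
theorem integral_centered_mul_meanDrift_le {n : ℕ} {β c : ℝ} (hN : 2 ≤ N) (hβ : 0 < β) (hn : 1 ≤ n) :
    ∫ σ : SpinConfig N n, (‖meanField β σ‖ ^ 2 - c) * meanDrift β σ ∂(gibbsMeasure N n β) ≤
      4 * β ^ 3 / n := by
  have hn0 : (0 : ℝ) < n := by exact_mod_cast hn
  set φ : SpinConfig N n → ℝ := fun σ => ‖meanField β σ‖ ^ 2 - c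
  have hφ : Continuous φ := by fun_prop
  obtain ⟨K, hK⟩ := (isCompact_univ (X := SpinConfig N n)).exists_bound_of_continuousOn hφ.continuousOn
  rw [← integral_mul_meanDrift hN hβ.le hφ.measurable (fun σ => hK σ (Set.mem_univ _))]
  refine (le_abs_self _).trans (abs_average_le hn fun i => ?_)
  have := isProbabilityMeasure_resampleLaw (n := n) hN β i
  have hsq : ∫ z, (φ z.1 - φ (Function.update z.1 i z.2)) ^ 2 ∂(resampleLaw N n β i) ≤ (4 * β ^ 2 / n) ^ 2 := by
    have hup : Continuous fun z : SpinConfig N n × Spin N => Function.update z.1 i z.2 := by fun_prop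
    have hφu := hφ.comp hup
    have hφ1 : Continuous fun z : SpinConfig N n × Spin N => φ z.1 := by fun_prop
    refine (integral_mono ((hφ1.sub hφu).pow 2).integrable_of_compactSpace
      (integrable_const ((4 * β ^ 2 / n) ^ 2)) fun z => ?_).trans (by
        rw [integral_const, probReal_univ, one_smul])
    change (φ z.1 - φ (Function.update z.1 i z.2)) ^ 2 ≤ _
    rw [← sq_abs]
    refine pow_le_pow_left₀ (abs_nonneg _) ?_ 2
    simp only [φ, sub_sub_sub_cancel_right]
    exact abs_sq_meanField_sub_update_le hβ.le z.1 i z.2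
  have hanti := integral_resample_antisymm (β := β) hN i hφ
  have e : ∀ z : SpinConfig N n × Spin N, (φ z.1 - φ (Function.update z.1 i z.2)) * φ z.1 =
      2 * (β / n) * (φ z.1 * (⟪localField β z.1 i, (z.1 i : EuclideanSpace ℝ (Fin N))⟫ -
      ⟪localField β z.1 i, (z.2 : EuclideanSpace ℝ (Fin N))⟫)) := fun z => by
    simp only [φ, sub_sub_sub_cancel_right]
    rw [sq_meanField_sub_update]
    ring
  have hnn : 0 ≤ ∫ z, (φ z.1 - φ (Function.update z.1 i z.2)) ^ 2 ∂(resampleLaw N n β i) :=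
    integral_nonneg fun z => sq_nonneg _
  simp_rw [e] at hanti
  rw [integral_const_mul] at hanti
  set Y := ∫ z : SpinConfig N n × Spin N, φ z.1 * (⟪localField β z.1 i, (z.1 i : EuclideanSpace ℝ (Fin N))⟫ -
      ⟪localField β z.1 i, (z.2 : EuclideanSpace ℝ (Fin N))⟫) ∂(resampleLaw N n β i)
  have hY : Y = n / (4 * β) * ∫ z, (φ z.1 - φ (Function.update z.1 i z.2)) ^ 2 ∂(resampleLaw N n β i) := by
    field_simp
    field_simp at hanti
    linarith
  rw [hY, abs_of_nonneg (by positivity)]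
  refine (mul_le_mul_of_nonneg_left hsq (by positivity)).trans (le_of_eq ?_)
  field_simp

/-- The drift pushes τ towards b² at a linear rate away from 0, while its correlation with τ - b² is
only O(1/n). Comparing the two bounds the variance, the neighbourhood of 0 being paid for by its
small probability. -/
theorem exists_second_moment_bound {β b : ℝ} (hN : 2 ≤ N) (hβ : (N : ℝ) < β) (hb : 0 < b)
    (hroot : β * besselSlope N (b ^ 2) = 1) :
    ∃ C : ℝ, 0 ≤ C ∧ ∀ n : ℕ, 1 ≤ n →
      ∫ σ : SpinConfig N n, (‖meanField β σ‖ ^ 2 - b ^ 2) ^ 2 ∂(gibbsMeasure N n β) ≤ C / n := by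
  have hβ0 : 0 < β := lt_of_le_of_lt (Nat.cast_nonneg N) hβ
  set R := 4 * β ^ 2 + b ^ 2
  have hRβ : 4 * β ^ 2 ≤ R := le_add_of_nonneg_right (sq_nonneg b)
  have hRb : b ^ 2 ≤ R := le_add_of_nonneg_left (by positivity)
  have hR0 : 0 ≤ R := (sq_nonneg b).trans hRb
  obtain ⟨ε, hε, K, hK0, hK⟩ := exists_gibbs_small_meanField hN hβ
  obtain ⟨L, hL0, hL⟩ := exists_lipschitz_slopeMul hN R
  obtain ⟨c, hc, hlow⟩ := exists_drift_lower hN hβ0 hb hroot hε hRb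
  set C1 := β ^ 2 + β * (L * (2 * β ^ 2)) with hC1
  have hC10 : 0 ≤ C1 := by positivity
  refine ⟨(4 * β ^ 4 + R * C1 + c * R ^ 2 * K) / c, by positivity, fun n hn => ?_⟩
  have hn0 : (0 : ℝ) < n := by exact_mod_cast hn
  set τ : SpinConfig N n → ℝ := fun σ => ‖meanField β σ‖ ^ 2
  have hτc : Continuous τ := by fun_prop
  have hdc := continuous_meanDrift (N := N) (n := n) hN β
  set S : Set (SpinConfig N n) := {σ | τ σ < ε}
  have hS : MeasurableSet S := (isOpen_lt hτc continuous_const).measurableSet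
  -- For τ < ε the drift term is merely nonnegative, so the indicator term supplies the missing cφ²
  -- ≤ cR².
  have hpt : ∀ σ, c * (τ σ - b ^ 2) ^ 2 ≤
      β * ((τ σ - b ^ 2) * meanDrift β σ) + R * (C1 / n) + S.indicator (fun _ => c * R ^ 2) σ := by
    intro σ
    have hτ : τ σ ∈ Set.Icc 0 R := sq_norm_mem_Icc hRβ ((norm_meanField_le hβ0.le σ).trans (by linarith))
    have hφ : |τ σ - b ^ 2| ≤ R := by
      rw [abs_le]
      constructor <;> linarith [hτ.1, hτ.2, sq_nonneg b]
    have h1 := abs_meanDrift_sub_le hβ0 hRβ hn hL0 hL σ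
    have h2 : (τ σ - b ^ 2) * (τ σ * (1 - β * besselSlope N (τ σ))) ≤
        β * ((τ σ - b ^ 2) * meanDrift β σ) + R * (C1 / n) := by
      have h3 : |(τ σ - b ^ 2) * (β * meanDrift β σ - τ σ * (1 - β * besselSlope N (τ σ)))| ≤
          R * (C1 / n) := by
        rw [abs_mul]
        exact mul_le_mul hφ h1 (abs_nonneg _) hR0
      have := (abs_le.1 h3).1
      linarith
    by_cases hσ : σ ∈ S
    · rw [Set.indicator_of_mem hσ]
      have h3 := drift_nonneg hN hβ0 hroot hτ.1
      have h4 : c * (τ σ - b ^ 2) ^ 2 ≤ c * R ^ 2 := by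
        rw [← sq_abs]
        gcongr
      linarith
    · rw [Set.indicator_of_notMem hσ, add_zero]
      exact (hlow _ ⟨not_lt.1 hσ, hτ.2⟩).trans h2
  have i0 : Integrable (fun σ => c * (τ σ - b ^ 2) ^ 2) (gibbsMeasure N n β) :=
    Continuous.integrable_of_compactSpace (by fun_prop)
  have i1 : Integrable (fun σ => β * ((τ σ - b ^ 2) * meanDrift β σ)) (gibbsMeasure N n β) :=
    Continuous.integrable_of_compactSpace (by fun_prop)
  have i2 : Integrable (fun σ => β * ((τ σ - b ^ 2) * meanDrift β σ) + R * (C1 / n)) (gibbsMeasure N n β) :=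
    i1.add (integrable_const _)
  have i3 : Integrable (S.indicator fun _ => c * R ^ 2) (gibbsMeasure N n β) :=
    (integrable_const _).indicator hS
  have hint := integral_mono i0 (i2.add i3) hpt
  have hadd : ∫ σ, (β * ((τ σ - b ^ 2) * meanDrift β σ) + R * (C1 / n) + S.indicator (fun _ => c * R ^ 2) σ)
      ∂(gibbsMeasure N n β) = β * ∫ σ, (τ σ - b ^ 2) * meanDrift β σ ∂(gibbsMeasure N n β) + R * (C1 / n) +
        (gibbsMeasure N n β).real S * (c * R ^ 2) := by
    rw [integral_add i2 i3, integral_add i1 (integrable_const _), integral_const_mul, integral_const,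
      probReal_univ, one_smul, integral_indicator_const _ hS, smul_eq_mul]
  rw [integral_const_mul] at hint
  have hint2 := hint.trans (le_of_eq hadd)
  have h5 := integral_centered_mul_meanDrift_le (c := b ^ 2) hN hβ0 hn
  have h6 := hK n hn
  have h7 : (gibbsMeasure N n β).real S * (c * R ^ 2) ≤ K / n * (c * R ^ 2) := by gcongr
  have h8 : β * ∫ σ, (τ σ - b ^ 2) * meanDrift β σ ∂(gibbsMeasure N n β) ≤ β * (4 * β ^ 3 / n) := by
    gcongr
  rw [div_div, le_div_iff₀ (by positivity)]
  have h9 : c * ∫ σ, (τ σ - b ^ 2) ^ 2 ∂(gibbsMeasure N n β) ≤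
      (4 * β ^ 4 + R * C1 + c * R ^ 2 * K) / n := by
    have : (4 * β ^ 4 + R * C1 + c * R ^ 2 * K) / n =
      β * (4 * β ^ 3 / n) + R * (C1 / n) + K / n * (c * R ^ 2) := by ring
    linarith
  rw [le_div_iff₀ hn0] at h9
  calc _ = (c * ∫ σ, (τ σ - b ^ 2) ^ 2 ∂(gibbsMeasure N n β)) * n := by ring
    _ ≤ _ := h9

/-- The quantitative estimates on the Gibbs measure behind the exchangeable pair. -/
theorem exists_gibbs_estimates {β b : ℝ} (hN : 2 ≤ N) (hβ : (N : ℝ) < β) (hb : 0 < b)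
    (hroot : β * besselSlope N (b ^ 2) = 1) :
    ∃ C : ℝ, 0 ≤ C ∧ ∀ n : ℕ, 1 ≤ n →
      ∫ σ : SpinConfig N n, (‖meanField β σ‖ ^ 2 - b ^ 2) ^ 2 ∂(gibbsMeasure N n β) ≤ C / n ∧
      ∫ σ : SpinConfig N n, |β * meanDrift β σ +
        β * b ^ 2 * besselSlopeDeriv N (b ^ 2) * (‖meanField β σ‖ ^ 2 - b ^ 2)| ∂(gibbsMeasure N n β) ≤ C / n ∧
      ∫ σ : SpinConfig N n, |meanQuadratic β σ - (2 * tiltedSecondMoment N (b ^ 2) -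
        2 / β * (b ^ 2 * slopeMul N (b ^ 2)))| ∂(gibbsMeasure N n β) ≤ C / √(n : ℝ) := by
  have hβ0 : 0 < β := lt_of_le_of_lt (Nat.cast_nonneg N) hβ
  set R := 4 * β ^ 2 + b ^ 2
  have hRβ : 4 * β ^ 2 ≤ R := le_add_of_nonneg_right (sq_nonneg b)
  have hRb : b ^ 2 ≤ R := le_add_of_nonneg_left (by positivity)
  have hR0 : 0 ≤ R := (sq_nonneg b).trans hRb
  obtain ⟨C0, hC00, hC0⟩ := exists_second_moment_bound hN hβ hb hroot
  obtain ⟨L, hL0, hL⟩ := exists_lipschitz_slopeMul hN R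
  obtain ⟨T, hT0, hT⟩ := exists_drift_taylor hN hroot hRb
  set C1 := β ^ 2 + β * (L * (2 * β ^ 2))
  have hC10 : 0 ≤ C1 := by positivity
  set C2 := (β ^ 2 + (1 + N * L) * R) ^ 2 +
    (β ^ 2 + (1 + N * L) * R) * ((1 + (1 + N * L)) * (4 * β ^ 2))
  have hC20 : 0 ≤ C2 := by positivity
  set C3 := 2 * ((1 + N * L) * (2 * β ^ 2)) + 2 * (β * (L * (2 * β ^ 2))) + 2 * (β * (L * R))
  have hC30 : 0 ≤ C3 := by positivity
  set C4 := 2 * (1 + N * L) + 4 / β * (L * R)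
  have hC40 : 0 ≤ C4 := by positivity
  set Ca := C1 + T * C0
  set Cb := (C2 + 1) + C3 + C4 * (C0 + 1)
  have hCa : 0 ≤ Ca := by positivity
  have hCb : 0 ≤ Cb := by positivity
  refine ⟨C0 + Ca + Cb, by positivity, fun n hn => ?_⟩
  have hn0 : (0 : ℝ) < n := by exact_mod_cast hn
  have hs1 : 1 ≤ √(n : ℝ) := Real.one_le_sqrt.2 (by exact_mod_cast hn)
  have hss : √(n : ℝ) ^ 2 = n := Real.sq_sqrt hn0.le
  set τ : SpinConfig N n → ℝ := fun σ => ‖meanField β σ‖ ^ 2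
  have hτc : Continuous τ := by fun_prop
  have hτ : ∀ σ, τ σ ∈ Set.Icc 0 R := fun σ =>
    sq_norm_mem_Icc hRβ ((norm_meanField_le hβ0.le σ).trans (by linarith))
  have hdc := continuous_meanDrift (N := N) (n := n) hN β
  have hqc := continuous_meanQuadratic (N := N) (n := n) hN β
  have hdef := fun i => continuous_squareDefect (N := N) (n := n) hN β i
  have j1 : Integrable (fun σ => τ σ - b ^ 2) (gibbsMeasure N n β) :=
    Continuous.integrable_of_compactSpace (by fun_prop)
  have j2 : Integrable (fun σ => (τ σ - b ^ 2) ^ 2) (gibbsMeasure N n β) :=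
    Continuous.integrable_of_compactSpace (by fun_prop)
  have k1 : Integrable (fun σ : SpinConfig N n => 1 / (n : ℝ) * ∑ i, squareDefect β σ i) (gibbsMeasure N n β) :=
    Continuous.integrable_of_compactSpace (by fun_prop)
  have k2 : Integrable (fun σ : SpinConfig N n => (1 / (n : ℝ) * ∑ i, squareDefect β σ i) ^ 2)
    (gibbsMeasure N n β) := Continuous.integrable_of_compactSpace (by fun_prop)
  refine ⟨(hC0 n hn).trans ?_, ?_, ?_⟩
  · gcongr
    linarith
  · have hpt : ∀ σ, |β * meanDrift β σ + β * b ^ 2 * besselSlopeDeriv N (b ^ 2) * (τ σ - b ^ 2)| ≤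
        C1 / n + T * (τ σ - b ^ 2) ^ 2 := fun σ => by
      have h1 := abs_meanDrift_sub_le hβ0 hRβ hn hL0 hL σ
      have h2 := hT (τ σ) (hτ σ)
      have := (abs_add_le _ _).trans (add_le_add h1 h2)
      refine le_trans (le_of_eq ?_) this
      congr 1
      simp only [τ]
      ring
    have hi : Integrable (fun σ => C1 / n + T * (τ σ - b ^ 2) ^ 2) (gibbsMeasure N n β) :=
      (integrable_const _).add (j2.const_mul T)
    have := integral_mono (Continuous.integrable_of_compactSpace (by fun_prop)) hi hpt
    rw [integral_add (integrable_const _) (j2.const_mul T), integral_const, probReal_univ, one_smul,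
      integral_const_mul] at this
    have h3 := mul_le_mul_of_nonneg_left (hC0 n hn) hT0
    calc _ ≤ _ := this
      _ ≤ C1 / n + T * (C0 / n) := by gcongr
      _ = Ca / n := by ring
      _ ≤ _ := by gcongr; linarith
  · have hpt := fun σ : SpinConfig N n =>
      abs_meanQuadratic_sub_le hN hβ0 hRβ hn hL0 hL σ (t := b ^ 2) ⟨sq_nonneg b, hRb⟩
    have hi : Integrable (fun σ : SpinConfig N n => |1 / (n : ℝ) * ∑ i, squareDefect β σ i| + C3 / n)
      (gibbsMeasure N n β) := k1.abs.add (integrable_const _)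
    have hi2 : Integrable (fun σ : SpinConfig N n => C4 * |τ σ - b ^ 2|) (gibbsMeasure N n β) :=
      j1.abs.const_mul _
    have := integral_mono (Continuous.integrable_of_compactSpace (by fun_prop)) (hi.add hi2) hpt
    have e : ∫ σ : SpinConfig N n, (|1 / (n : ℝ) * ∑ i, squareDefect β σ i| + C3 / n + C4 * |τ σ - b ^ 2|)
        ∂(gibbsMeasure N n β) = ∫ σ : SpinConfig N n, |1 / (n : ℝ) * ∑ i, squareDefect β σ i|
        ∂(gibbsMeasure N n β) + C3 / n + C4 * ∫ σ, |τ σ - b ^ 2| ∂(gibbsMeasure N n β) := by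
      rw [integral_add hi hi2, integral_add k1.abs (integrable_const _), integral_const, probReal_univ,
        one_smul, integral_const_mul]
    have h1 := integral_abs_le_of_integral_sq_le k1 k2 hn
      (integral_average_squareDefect_sq_le hN hβ0.le hRβ hn hL0 hL)
    have h2 := integral_abs_le_of_integral_sq_le j1 j2 hn (hC0 n hn)
    have h3 : C3 / n ≤ C3 / √(n : ℝ) := by
      refine div_le_div_of_nonneg_left hC30 (by positivity) ?_
      calc √(n : ℝ) = √(n : ℝ) * 1 := (mul_one _).symm
        _ ≤ √(n : ℝ) * √(n : ℝ) := by gcongr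
        _ = n := by rw [← sq, hss]
    have h4 := mul_le_mul_of_nonneg_left h2 hC40
    calc _ ≤ _ := this
      _ = _ := e
      _ ≤ (C2 + 1) / √(n : ℝ) + C3 / √(n : ℝ) + C4 * ((C0 + 1) / √(n : ℝ)) :=
          add_le_add (add_le_add h1 h3) h4
      _ = Cb / √(n : ℝ) := by ring
      _ ≤ _ := by gcongr; linarith

end

/-! ### The joint law of the configuration and one conditional copy -/

section
variable {N n : ℕ} [NeZero N]

/-- The probability of `B` under the law on the sphere with density proportional to `exp ⟪θ, s⟫`. -/
noncomputable def fieldProb (B : Set (Spin N)) (θ : EuclideanSpace ℝ (Fin N)) : ℝ :=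
  ∫ s : Spin N, Real.exp ⟪θ, (s : EuclideanSpace ℝ (Fin N))⟫ / sphereMGF θ * B.indicator (fun _ => 1) s
    ∂(sphereUniform N)

theorem measurable_fieldProb (hN : 2 ≤ N) {B : Set (Spin N)} (hB : MeasurableSet B) :
    Measurable (fieldProb B) := by
  have h := continuous_sphereMGF hN
  have hd : Measurable fun z : EuclideanSpace ℝ (Fin N) × Spin N =>
      Real.exp ⟪z.1, (z.2 : EuclideanSpace ℝ (Fin N))⟫ / sphereMGF z.1 :=
    Continuous.measurable (Continuous.div (by fun_prop) (by fun_prop) fun z => (sphereMGF_pos _).ne')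
  have hm : Measurable fun z : EuclideanSpace ℝ (Fin N) × Spin N =>
      Real.exp ⟪z.1, (z.2 : EuclideanSpace ℝ (Fin N))⟫ / sphereMGF z.1 * B.indicator (fun _ => (1 : ℝ)) z.2 :=
    hd.mul ((measurable_const.indicator hB).comp measurable_snd)
  exact (hm.stronglyMeasurable.integral_prod_right').measurable

theorem abs_fieldProb_le_one (B : Set (Spin N)) (θ : EuclideanSpace ℝ (Fin N)) :
    |fieldProb B θ| ≤ 1 := by
  have hpos : ∀ s : Spin N, 0 < Real.exp ⟪θ, (s : EuclideanSpace ℝ (Fin N))⟫ / sphereMGF θ :=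
    fun s => div_pos (Real.exp_pos _) (sphereMGF_pos θ)
  have hi : Integrable (fun s : Spin N => Real.exp ⟪θ, (s : EuclideanSpace ℝ (Fin N))⟫ / sphereMGF θ)
    (sphereUniform N) := ((continuous_inner_spin θ).rexp.div_const _).integrable_of_compactSpace
  have hone : ∫ s : Spin N, Real.exp ⟪θ, (s : EuclideanSpace ℝ (Fin N))⟫ / sphereMGF θ ∂(sphereUniform N) = 1 := by
    rw [integral_div]
    exact div_self (sphereMGF_pos θ).ne'
  refine (abs_integral_le_integral_abs).trans (le_trans (integral_mono_of_nonneg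
    (.of_forall fun s => abs_nonneg _) hi (.of_forall fun s => ?_)) hone.le)
  simp only [abs_mul, abs_of_pos (hpos s)]
  refine mul_le_of_le_one_right (hpos s).le ?_
  by_cases hs : s ∈ B <;> simp [hs]

theorem integral_mul_indicator_resampleLaw (hN : 2 ≤ N) (β : ℝ) (i : Fin n) {Φ : SpinConfig N n → ℝ}
    (hΦ : Measurable Φ) {K : ℝ} (hK : ∀ σ, |Φ σ| ≤ K) {B : Set (Spin N)} (hB : MeasurableSet B) :
    ∫ z, Φ z.1 * B.indicator (fun _ => 1) z.2 ∂(resampleLaw N n β i) =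
      ∫ σ, Φ σ * fieldProb B (localField β σ i) ∂(gibbsMeasure N n β) := by
  have := isProbabilityMeasure_resampleLaw (n := n) hN β i
  have hI : Integrable (fun z : SpinConfig N n × Spin N => Φ z.1) (resampleLaw N n β i) :=
    integrable_of_bounded (hΦ.comp measurable_fst) fun z => hK z.1
  have hind : Measurable fun z : SpinConfig N n × Spin N => B.indicator (fun _ => (1 : ℝ)) z.2 :=
    (measurable_const.indicator hB).comp measurable_snd
  rw [integral_resampleLaw hN β i (hI.mul_bdd (c := 1) hind.aestronglyMeasurable
    (.of_forall fun z => by by_cases hz : z.2 ∈ B <;> simp [hz]))]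
  refine integral_congr_ae (.of_forall fun σ => ?_)
  simp only [fieldProb]
  rw [← integral_const_mul]
  refine integral_congr_ae (.of_forall fun s => ?_)
  simp only
  ring

/-- Stationarity, applied to functions of the other spins, gives the conditional law of spin i in
weak form. -/
theorem integral_mul_indicator_gibbs (hN : 2 ≤ N) (β : ℝ) (i : Fin n) {Φ : SpinConfig N n → ℝ}
    (hΦ : Measurable Φ) {K : ℝ} (hK : ∀ σ, |Φ σ| ≤ K) (hinv : ∀ σ s, Φ (Function.update σ i s) = Φ σ)
    {B : Set (Spin N)} (hB : MeasurableSet B) :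
    ∫ σ, Φ σ * B.indicator (fun _ => 1) (σ i) ∂(gibbsMeasure N n β) =
      ∫ σ, Φ σ * fieldProb B (localField β σ i) ∂(gibbsMeasure N n β) := by
  rw [← integral_mul_indicator_resampleLaw hN β i hΦ hK hB,
    ← integral_update_resampleLaw (Φ := fun σ => Φ σ * B.indicator (fun _ => 1) (σ i)) hN β i
      (hΦ.mul ((measurable_const.indicator hB).comp (measurable_pi_apply i)))]
  simp only [hinv, Function.update_self]

/-- The spins other than the one at `i`. -/
def restSpins (i : Fin n) (σ : SpinConfig N n) : {j : Fin n // j ≠ i} → Spin N := fun j => σ j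

omit [NeZero N] in
theorem measurable_restSpins (i : Fin n) :
    Measurable (restSpins i : SpinConfig N n → _) := by
  unfold restSpins; fun_prop

omit [NeZero N] in
theorem restSpins_update (i : Fin n) (σ : SpinConfig N n) (s : Spin N) :
    restSpins i (Function.update σ i s) = restSpins i σ := by
  ext1 j
  simp [restSpins, Function.update_of_ne j.2]

omit [NeZero N] in
-- Shows that the local field is measurable for the σ-algebra of the other spins.
theorem localField_eq_restSpins (β : ℝ) (σ : SpinConfig N n) (i : Fin n) :
    localField β σ i = (β / n) • ∑ j, (restSpins i σ j : EuclideanSpace ℝ (Fin N)) := by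
  rw [localField, totalSpin, ← Finset.sum_erase_eq_sub (Finset.mem_univ i)]
  congr 1
  exact (Finset.sum_subtype (Finset.univ.erase i) (fun j => by simp)
    (fun j => (σ j : EuclideanSpace ℝ (Fin N))))

variable {Ω : Type*} [MeasurableSpace Ω] {P : Measure Ω} [IsProbabilityMeasure P] {β : ℝ}
  {σ σ' : Ω → SpinConfig N n} {I : Ω → Fin n}

omit [IsProbabilityMeasure P] [NeZero N] in
theorem IsResampling.integral_comp (h : IsResampling P β σ σ' I) {Φ : SpinConfig N n → ℝ}
    (hΦ : Measurable Φ) : ∫ ω, Φ (σ ω) ∂P = ∫ τ, Φ τ ∂(gibbsMeasure N n β) := by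
  rw [← h.law_spin, integral_map h.measurable_spin.aemeasurable hΦ.aestronglyMeasurable]

theorem condProb_spin (hN : 2 ≤ N) (h : IsResampling P β σ σ' I) (i : Fin n) {B : Set (Spin N)}
    (hB : MeasurableSet B) :
    P⟦(fun ω => σ ω i) ⁻¹' B|otherSpins σ i⟧ =ᵐ[P] fun ω => fieldProb B (localField β (σ ω) i) := by
  have hσ := h.measurable_spin
  have hg : Measurable fun ω => restSpins i (σ ω) := (measurable_restSpins i).comp hσ
  have hm : otherSpins σ i ≤ ‹MeasurableSpace Ω› := hg.comap_le
  have hσi : Measurable fun ω => σ ω i := (measurable_pi_apply i).comp hσ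
  have hfm := measurable_fieldProb hN hB
  have hlf : Measurable fun τ : SpinConfig N n => fieldProb B (localField β τ i) :=
    hfm.comp (continuous_localField β i).measurable
  have hint : Integrable (fun ω => fieldProb B (localField β (σ ω) i)) P :=
    integrable_of_bounded (hlf.comp hσ) fun ω => abs_fieldProb_le_one B _
  refine (ae_eq_condExp_of_forall_setIntegral_eq hm
    ((integrable_const _).indicator (hσi hB)) (fun s _ _ => hint.integrableOn) ?_ ?_).symm
  · rintro _ ⟨A, hA, rfl⟩ -
    have hA' : MeasurableSet ((fun ω => restSpins i (σ ω)) ⁻¹' A) := hg hA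
    change ∫ ω in (fun ω => restSpins i (σ ω)) ⁻¹' A, _ ∂P =
      ∫ ω in (fun ω => restSpins i (σ ω)) ⁻¹' A, _ ∂P
    rw [← integral_indicator hA', ← integral_indicator hA']
    set Φ : SpinConfig N n → ℝ := fun τ => A.indicator (fun _ => 1) (restSpins i τ)
    have hΦ : Measurable Φ := (measurable_const.indicator hA).comp (measurable_restSpins i)
    have key := integral_mul_indicator_gibbs hN β i hΦ (K := 1)
      (fun τ => by by_cases hz : restSpins i τ ∈ A <;> simp [Φ, hz])
      (fun τ s => by simp only [Φ, restSpins_update]) hB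
    have hind : Measurable fun τ : SpinConfig N n => B.indicator (fun _ => (1 : ℝ)) (τ i) :=
      (measurable_const.indicator hB).comp (measurable_pi_apply i)
    rw [← h.integral_comp (Φ := fun τ => Φ τ * B.indicator (fun _ => (1 : ℝ)) (τ i)) (hΦ.mul hind),
      ← h.integral_comp (Φ := fun τ => Φ τ * fieldProb B (localField β τ i)) (hΦ.mul hlf)] at key
    refine Eq.trans ?_ (key.symm.trans ?_) <;>
    · refine integral_congr_ae (.of_forall fun ω => ?_)
      by_cases hz : restSpins i (σ ω) ∈ A <;> by_cases hz' : σ ω i ∈ B <;>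
        simp [Φ, hz, hz', Set.indicator]
  · have h1 : Measurable fun r : {j : Fin n // j ≠ i} → Spin N =>
        fieldProb B ((β / n) • ∑ j, (r j : EuclideanSpace ℝ (Fin N))) :=
      hfm.comp (Continuous.measurable (by fun_prop))
    have h2 : Measurable[otherSpins σ i] fun ω => fieldProb B (localField β (σ ω) i) := by
      simp_rw [localField_eq_restSpins]
      exact h1.comp (comap_measurable _)
    exact h2.stronglyMeasurable.aestronglyMeasurable

/-- The configuration with spins `r` away from `i` and spin `x` at `i`. -/
def glueSpins (i : Fin n) (r : {j : Fin n // j ≠ i} → Spin N) (x : Spin N) : SpinConfig N n :=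
  fun j => if h : j = i then x else r ⟨j, h⟩

omit [NeZero N] in
theorem measurable_glueSpins (i : Fin n) :
    Measurable fun z : ({j : Fin n // j ≠ i} → Spin N) × Spin N => glueSpins i z.1 z.2 := by
  rw [measurable_pi_iff]
  intro j
  by_cases hj : j = i
  · simpa [glueSpins, hj] using measurable_snd
  · simp only [glueSpins, hj, dif_neg, not_false_eq_true]
    fun_prop

omit [NeZero N] in
theorem glueSpins_restSpins (i : Fin n) (τ : SpinConfig N n) : glueSpins i (restSpins i τ) (τ i) = τ := by
  funext j
  by_cases hj : j = i
  · subst hj; simp [glueSpins]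
  · simp [glueSpins, restSpins, hj]

/-- Conditional independence and equality of conditional laws determine the joint law. It suffices
to test events of the form: rest in A, spin in B, copy in B'. -/
theorem map_pair_eq_resampleLaw (hN : 2 ≤ N) (h : IsResampling P β σ σ' I) (i : Fin n) :
    P.map (fun ω => (σ ω, σ' ω i)) = resampleLaw N n β i := by
  have := isProbabilityMeasure_resampleLaw (n := n) hN β i
  have hσ := h.measurable_spin
  have hσ'i : Measurable fun ω => σ' ω i := (measurable_pi_apply i).comp h.measurable_copy
  have hσi : Measurable fun ω => σ ω i := (measurable_pi_apply i).comp hσ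
  have hg : Measurable fun ω => restSpins i (σ ω) := (measurable_restSpins i).comp hσ
  have hm : otherSpins σ i ≤ ‹MeasurableSpace Ω› := hg.comap_le
  have hpair : Measurable fun ω => (σ ω, σ' ω i) := hσ.prodMk hσ'i
  have : IsProbabilityMeasure (P.map fun ω => (σ ω, σ' ω i)) :=
    Measure.isProbabilityMeasure_map hpair.aemeasurable
  -- Splitting σ into its rest and its i-th spin makes the test events product sets; `T'` is a left
  -- inverse, so nothing is lost.
  set T : SpinConfig N n × Spin N → (({j : Fin n // j ≠ i} → Spin N) × Spin N) × Spin N :=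
    fun z => ((restSpins i z.1, z.1 i), z.2) with hT
  have hTm : Measurable T := (((measurable_restSpins i).comp measurable_fst).prodMk
    ((measurable_pi_apply i).comp measurable_fst)).prodMk measurable_snd
  set T' : (({j : Fin n // j ≠ i} → Spin N) × Spin N) × Spin N → SpinConfig N n × Spin N :=
    fun z => (glueSpins i z.1.1 z.1.2, z.2) with hT'
  have hT'm : Measurable T' := ((measurable_glueSpins i).comp measurable_fst).prodMk measurable_snd
  have hTT' : T' ∘ T = id := by
    funext z
    simp [hT, hT', glueSpins_restSpins]
  suffices hmap : (P.map fun ω => (σ ω, σ' ω i)).map T = (resampleLaw N n β i).map T by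
    have := congrArg (Measure.map T') hmap
    rwa [Measure.map_map hT'm hTm, Measure.map_map hT'm hTm, hTT', Measure.map_id, Measure.map_id] at this
  have := Measure.isProbabilityMeasure_map (μ := P.map fun ω => (σ ω, σ' ω i)) hTm.aemeasurable
  have := Measure.isProbabilityMeasure_map (μ := resampleLaw N n β i) hTm.aemeasurable
  refine Measure.ext_prod₃_iff'.2 fun {A B B'} hA hB hB' => ?_
  have hset : MeasurableSet ((A ×ˢ B) ×ˢ B') := (hA.prod hB).prod hB'
  rw [← measureReal_eq_measureReal_iff, measureReal_def, measureReal_def, Measure.map_apply hTm hset,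
    Measure.map_apply hTm hset, Measure.map_apply hpair (hTm hset), ← measureReal_def, ← measureReal_def]
  set Φ : SpinConfig N n → ℝ := fun τ => A.indicator (fun _ => 1) (restSpins i τ)
  have hΦ : Measurable Φ := (measurable_const.indicator hA).comp (measurable_restSpins i)
  have hΦ1 : ∀ τ, |Φ τ| ≤ 1 := fun τ => by by_cases hz : restSpins i τ ∈ A <;> simp [Φ, hz]
  have hΦu : ∀ τ s, Φ (Function.update τ i s) = Φ τ := fun τ s => by simp only [Φ, restSpins_update]
  set Φ' : SpinConfig N n → ℝ := fun τ => Φ τ * fieldProb B' (localField β τ i)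
  have hlf : ∀ D : Set (Spin N), MeasurableSet D →
      Measurable fun τ : SpinConfig N n => fieldProb D (localField β τ i) := fun D hD =>
    (measurable_fieldProb hN hD).comp (continuous_localField β i).measurable
  have hind : Measurable fun τ : SpinConfig N n => B.indicator (fun _ => (1 : ℝ)) (τ i) :=
    (measurable_const.indicator hB).comp (measurable_pi_apply i)
  have hΦ' : Measurable Φ' := hΦ.mul (hlf B' hB')
  have hΦ'1 : ∀ τ, |Φ' τ| ≤ 1 := fun τ => by
    rw [abs_mul]
    exact mul_le_one₀ (hΦ1 τ) (abs_nonneg _) (abs_fieldProb_le_one B' _)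
  have hΦ'u : ∀ τ s, Φ' (Function.update τ i s) = Φ' τ := fun τ s => by
    simp only [Φ', hΦu, localField_update]
  -- Given the other spins, the probability of the two events is the product of the field
  -- probabilities of B and B'. On the resampling side only B' is integrated out;
  -- `integral_mul_indicator_gibbs` then does the same for B.
  have hleft : P.real ((fun ω => (σ ω, σ' ω i)) ⁻¹' (T ⁻¹' ((A ×ˢ B) ×ˢ B'))) =
      ∫ τ, Φ' τ * fieldProb B (localField β τ i) ∂(gibbsMeasure N n β) := by
    have hA' : MeasurableSet[otherSpins σ i] ((fun ω => restSpins i (σ ω)) ⁻¹' A) := ⟨A, hA, rfl⟩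
    have hBB : MeasurableSet ((fun ω => σ ω i) ⁻¹' B ∩ (fun ω => σ' ω i) ⁻¹' B') :=
      (hσi hB).inter (hσ'i hB')
    have e : (fun ω => (σ ω, σ' ω i)) ⁻¹' (T ⁻¹' ((A ×ˢ B) ×ˢ B')) =
        ((fun ω => σ ω i) ⁻¹' B ∩ (fun ω => σ' ω i) ⁻¹' B') ∩ (fun ω => restSpins i (σ ω)) ⁻¹' A := by
      ext ω
      simp only [hT, Set.mem_preimage, Set.mem_prod, Set.mem_inter_iff]
      tauto
    have hae : P⟦(fun ω => σ ω i) ⁻¹' B ∩ (fun ω => σ' ω i) ⁻¹' B'|otherSpins σ i⟧ =ᵐ[P]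
        fun ω => fieldProb B (localField β (σ ω) i) * fieldProb B' (localField β (σ ω) i) := by
      filter_upwards [(h.copy i).cond_indep B B' hB hB', condProb_spin hN h i hB,
        (h.copy i).same_law B' hB', condProb_spin hN h i hB'] with ω h1 h2 h3 h4
      rw [h1, Pi.mul_apply, h2, h3, h4]
    have hset := setIntegral_condExp hm
      ((integrable_const (1 : ℝ)).indicator (μ := P) hBB) hA'
    rw [integral_indicator hBB, setIntegral_const, smul_eq_mul, mul_one, measureReal_restrict_apply hBB] at hset
    rw [e, ← hset, ← integral_indicator (hm _ hA'),
      ← h.integral_comp (Φ := fun τ => Φ' τ * fieldProb B (localField β τ i)) (hΦ'.mul (hlf B hB))]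
    refine integral_congr_ae ?_
    filter_upwards [hae] with ω hω
    by_cases hz : restSpins i (σ ω) ∈ A
    · rw [Set.indicator_of_mem (show ω ∈ (fun ω => restSpins i (σ ω)) ⁻¹' A from hz), hω]
      simp [Φ', Φ, hz, mul_comm]
    · rw [Set.indicator_of_notMem (show ω ∉ (fun ω => restSpins i (σ ω)) ⁻¹' A from hz)]
      simp [Φ', Φ, hz]
  have hright : (resampleLaw N n β i).real (T ⁻¹' ((A ×ˢ B) ×ˢ B')) =
      ∫ τ, (Φ τ * B.indicator (fun _ => 1) (τ i)) * fieldProb B' (localField β τ i) ∂(gibbsMeasure N n β) := by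
    rw [← integral_mul_indicator_resampleLaw (K := 1)
      (Φ := fun τ => Φ τ * B.indicator (fun _ => 1) (τ i)) hN β i (hΦ.mul hind) (fun τ => by
      rw [abs_mul]
      refine mul_le_one₀ (hΦ1 τ) (abs_nonneg _) ?_
      by_cases hz : τ i ∈ B <;> simp [hz]) hB', ← integral_indicator_one (hTm hset)]
    refine integral_congr_ae (.of_forall fun z => ?_)
    by_cases h1 : restSpins i z.1 ∈ A <;> by_cases h2 : z.1 i ∈ B <;> by_cases h3 : z.2 ∈ B' <;>
      simp [Set.indicator, Φ, hT, h1, h2, h3]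
  rw [hleft, hright, ← integral_mul_indicator_gibbs hN β i hΦ' hΦ'1 hΦ'u hB]
  refine integral_congr_ae (.of_forall fun τ => ?_)
  simp only [Φ']
  ring

end

/-! ### Conditional expectations given W -/

theorem condExp_comap_congr {Ω : Type*} [mΩ : MeasurableSpace Ω] {P : Measure Ω} [IsProbabilityMeasure P]
    {W f g : Ω → ℝ} (hW : Measurable W) (hf : Integrable f P) (hg : Integrable g P)
    (h : ∀ A : Set ℝ, MeasurableSet A → ∫ ω in W ⁻¹' A, f ω ∂P = ∫ ω in W ⁻¹' A, g ω ∂P) :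
    P[f|MeasurableSpace.comap W inferInstance] =ᵐ[P] P[g|MeasurableSpace.comap W inferInstance] := by
  have hm : MeasurableSpace.comap W inferInstance ≤ mΩ := hW.comap_le
  refine (ae_eq_condExp_of_forall_setIntegral_eq hm hg
    (fun s _ _ => integrable_condExp.integrableOn) ?_
    stronglyMeasurable_condExp.aestronglyMeasurable)
  rintro _ ⟨A, hA, rfl⟩ -
  rw [setIntegral_condExp hm hf ⟨A, hA, rfl⟩]
  exact h A hA

/-- L¹ contraction of conditional expectation, after moving the m-measurable U inside. Conditioning
on W thus costs nothing beyond the estimates in terms of σ. -/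
theorem integral_abs_mul_condExp_sub_le {Ω : Type*} {m mΩ : MeasurableSpace Ω} {P : Measure Ω}
    [IsProbabilityMeasure P] (hm : m ≤ mΩ) {Y U : Ω → ℝ} (c : ℝ) (hY : Integrable Y P)
    (hUm : StronglyMeasurable[m] U) (hU : Integrable U P) :
    ∫ ω, |c * (P[Y|m]) ω - U ω| ∂P ≤ ∫ ω, |c * Y ω - U ω| ∂P := by
  refine le_trans (le_of_eq (integral_congr_ae ?_)) (integral_abs_condExp_le (m := m) (c • Y - U))
  filter_upwards [condExp_sub (hY.smul c) hU m, condExp_smul c Y m] with ω h1 h2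
  rw [h1, Pi.sub_apply, h2, condExp_of_stronglyMeasurable hm hUm hU]
  simp

section
variable {N n : ℕ} [NeZero N]
variable {Ω : Type*} [MeasurableSpace Ω] {P : Measure Ω} [IsProbabilityMeasure P] {β : ℝ}
  {σ σ' : Ω → SpinConfig N n} {I : Ω → Fin n}

/-- Split according to the value of I; independence gives each value weight 1/n. Only the law of the
pair (σ, σ'_i) for each separate i enters, never the joint law of σ'. -/
theorem IsResampling.integral_index (hN : 2 ≤ N) (h : IsResampling P β σ σ' I)
    {G : Fin n → SpinConfig N n × Spin N → ℝ} (hG : ∀ i, Measurable (G i)) {K : ℝ} (hK : ∀ i z, |G i z| ≤ K) :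
    ∫ ω, G (I ω) (σ ω, σ' ω (I ω)) ∂P = 1 / (n : ℝ) * ∑ i, ∫ z, G i z ∂(resampleLaw N n β i) := by
  have hpair : Measurable fun ω => (σ ω, σ' ω) := h.measurable_spin.prodMk h.measurable_copy
  have hproj : ∀ i : Fin n, Measurable fun q : SpinConfig N n × SpinConfig N n => (q.1, q.2 i) := fun i =>
    measurable_fst.prodMk ((measurable_pi_apply i).comp measurable_snd)
  have hone : ∀ i : Fin n, Measurable fun k : Fin n => if k = i then (1 : ℝ) else 0 := fun i =>
    measurable_of_finite _
  have hsplit : ∀ ω, G (I ω) (σ ω, σ' ω (I ω)) =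
      ∑ i, (if I ω = i then (1 : ℝ) else 0) * G i (σ ω, σ' ω i) := fun ω => by
    simp
  simp_rw [hsplit]
  rw [integral_finsetSum, Finset.mul_sum]
  · refine Finset.sum_congr rfl fun i _ => ?_
    have hGi : Measurable fun q : SpinConfig N n × SpinConfig N n => G i (q.1, q.2 i) :=
      (hG i).comp (hproj i)
    rw [h.indep_index.integral_fun_comp_mul_comp (f := fun k => if k = i then (1 : ℝ) else 0)
      (g := fun q => G i (q.1, q.2 i)) h.measurable_index.aemeasurable hpair.aemeasurable
      (hone i).aestronglyMeasurable hGi.aestronglyMeasurable]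
    congr 1
    · have : (fun ω => if I ω = i then (1 : ℝ) else 0) = (I ⁻¹' {i}).indicator 1 := by
        ext ω
        simp [Set.indicator]
      rw [this, integral_indicator_one (h.measurable_index (measurableSet_singleton i)), measureReal_def,
        h.uniform_index]
      simp
    · have hpi : Measurable fun ω => (σ ω, σ' ω i) := (hproj i).comp hpair
      rw [← map_pair_eq_resampleLaw hN h i,
        integral_map hpi.aemeasurable (hG i).aestronglyMeasurable]
  · intro i _
    refine integrable_of_bounded (K := K) (((hone i).comp h.measurable_index).mul
      ((hG i).comp ((hproj i).comp hpair))) fun ω => ?_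
    have h0 := (abs_nonneg _).trans (hK i (σ ω, σ' ω i))
    by_cases hI : I ω = i
    · simpa [hI] using hK i _
    · simpa [hI] using h0

omit [NeZero N] in
theorem fluctuation_totalSpin (b : ℝ) (τ : SpinConfig N n) (hb : b ≠ 0) :
    fluctuation n β b (totalSpin τ) = √(n : ℝ) / b ^ 2 * (‖meanField β τ‖ ^ 2 - b ^ 2) := by
  rw [fluctuation, meanField, norm_smul, mul_pow, Real.norm_eq_abs, sq_abs]
  field_simp

omit [NeZero N] in
theorem totalSpin'_eq (τ τ' : SpinConfig N n) (i : Fin n) :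
    totalSpin' τ τ' i = totalSpin (Function.update τ i (τ' i)) := by
  rw [totalSpin', totalSpin_update]

omit [NeZero N] in
theorem fluctuation_sub (b : ℝ) (hb : b ≠ 0) (τ τ' : SpinConfig N n) (i : Fin n) :
    fluctuation n β b (totalSpin τ) - fluctuation n β b (totalSpin' τ τ' i) =
      √(n : ℝ) / b ^ 2 * (2 * (β / n)) * (⟪localField β τ i, (τ i : EuclideanSpace ℝ (Fin N))⟫ -
        ⟪localField β τ i, (τ' i : EuclideanSpace ℝ (Fin N))⟫) := by
  rw [totalSpin'_eq, fluctuation_totalSpin b _ hb, fluctuation_totalSpin b _ hb, ← mul_sub,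
    sub_sub_sub_cancel_right, sq_meanField_sub_update]
  ring

omit [NeZero N] in
theorem abs_inner_sub_inner_le (hβ : 0 ≤ β) (τ : SpinConfig N n) (i : Fin n) (s : Spin N) :
    |⟪localField β τ i, (τ i : EuclideanSpace ℝ (Fin N))⟫ -
      ⟪localField β τ i, (s : EuclideanSpace ℝ (Fin N))⟫| ≤ 2 * β := by
  refine (abs_sub _ _).trans ?_
  linarith [abs_inner_localField_le hβ τ i (τ i), abs_inner_localField_le hβ τ i s]

theorem IsResampling.integral_mul_sub (hN : 2 ≤ N) (hβ : 0 ≤ β) (h : IsResampling P β σ σ' I)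
    {Φ : SpinConfig N n → ℝ} (hΦ : Measurable Φ) {K : ℝ} (hK : ∀ τ, |Φ τ| ≤ K) :
    (∫ ω, Φ (σ ω) * (⟪localField β (σ ω) (I ω), (σ ω (I ω) : EuclideanSpace ℝ (Fin N))⟫ -
        ⟪localField β (σ ω) (I ω), (σ' ω (I ω) : EuclideanSpace ℝ (Fin N))⟫) ∂P =
      ∫ ω, Φ (σ ω) * meanDrift β (σ ω) ∂P) ∧
    (∫ ω, Φ (σ ω) * (⟪localField β (σ ω) (I ω), (σ ω (I ω) : EuclideanSpace ℝ (Fin N))⟫ -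
        ⟪localField β (σ ω) (I ω), (σ' ω (I ω) : EuclideanSpace ℝ (Fin N))⟫) ^ 2 ∂P =
      ∫ ω, Φ (σ ω) * meanQuadratic β (σ ω) ∂P) := by
  set d : Fin n → SpinConfig N n × Spin N → ℝ := fun i z =>
    ⟪localField β z.1 i, (z.1 i : EuclideanSpace ℝ (Fin N))⟫ -
      ⟪localField β z.1 i, (z.2 : EuclideanSpace ℝ (Fin N))⟫
  have hdm : ∀ i, Measurable (d i) := fun i => Continuous.measurable (by fun_prop)
  have hdb : ∀ i z, |d i z| ≤ 2 * β := fun i z => abs_inner_sub_inner_le hβ z.1 i z.2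
  have hΦm : Measurable fun z : SpinConfig N n × Spin N => Φ z.1 := hΦ.comp measurable_fst
  constructor
  · rw [h.integral_comp (Φ := fun τ => Φ τ * meanDrift β τ) (hΦ.mul (continuous_meanDrift hN β).measurable),
      ← integral_mul_meanDrift hN hβ hΦ hK]
    refine h.integral_index hN (G := fun i z => Φ z.1 * d i z) (K := K * (2 * β))
      (fun i => hΦm.mul (hdm i)) fun i z => ?_
    rw [abs_mul]
    exact mul_le_mul (hK _) (hdb i z) (abs_nonneg _) ((abs_nonneg _).trans (hK z.1))
  · rw [h.integral_comp (Φ := fun τ => Φ τ * meanQuadratic β τ)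
      (hΦ.mul (continuous_meanQuadratic hN β).measurable), ← integral_mul_meanQuadratic hN hβ hΦ hK]
    refine h.integral_index hN (G := fun i z => Φ z.1 * d i z ^ 2) (K := K * (2 * β) ^ 2)
      (fun i => hΦm.mul ((hdm i).pow_const 2)) fun i z => ?_
    rw [abs_mul, abs_pow]
    exact mul_le_mul (hK _) (pow_le_pow_left₀ (abs_nonneg _) (hdb i z) 2) (by positivity)
      ((abs_nonneg _).trans (hK z.1))

omit [NeZero N] [IsProbabilityMeasure P] in
theorem IsResampling.measurable_inner_sub (h : IsResampling P β σ σ' I) :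
    Measurable fun ω => ⟪localField β (σ ω) (I ω), (σ ω (I ω) : EuclideanSpace ℝ (Fin N))⟫ -
      ⟪localField β (σ ω) (I ω), (σ' ω (I ω) : EuclideanSpace ℝ (Fin N))⟫ := by
  have hj : ∀ i, Measurable fun ω =>
      ⟪localField β (σ ω) i, (σ ω i : EuclideanSpace ℝ (Fin N))⟫ -
        ⟪localField β (σ ω) i, (σ' ω i : EuclideanSpace ℝ (Fin N))⟫ := fun i => by
    have hc : Continuous fun x : SpinConfig N n × SpinConfig N n =>
        ⟪localField β x.1 i, (x.1 i : EuclideanSpace ℝ (Fin N))⟫ -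
          ⟪localField β x.1 i, (x.2 i : EuclideanSpace ℝ (Fin N))⟫ := by fun_prop
    have hcomp : ∀ g : SpinConfig N n × SpinConfig N n → ℝ, Continuous g →
        Measurable fun ω => g (σ ω, σ' ω) := fun g hg =>
      hg.measurable.comp (h.measurable_spin.prodMk h.measurable_copy)
    have hm := hcomp _ hc
    dsimp only at hm
    exact hm
  have hsum : (fun ω => ⟪localField β (σ ω) (I ω), (σ ω (I ω) : EuclideanSpace ℝ (Fin N))⟫ -
      ⟪localField β (σ ω) (I ω), (σ' ω (I ω) : EuclideanSpace ℝ (Fin N))⟫) = fun ω =>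
      ∑ i, (if I ω = i then (1 : ℝ) else 0) *
        (⟪localField β (σ ω) i, (σ ω i : EuclideanSpace ℝ (Fin N))⟫ -
          ⟪localField β (σ ω) i, (σ' ω i : EuclideanSpace ℝ (Fin N))⟫) := by
    ext ω
    simp
  rw [hsum]
  refine Finset.measurable_sum _ fun i _ => Measurable.mul ?_ (hj i)
  exact (measurable_of_finite fun k : Fin n => if k = i then (1 : ℝ) else 0).comp h.measurable_index

omit [IsProbabilityMeasure P] in
theorem IsResampling.integrable_comp (h : IsResampling P β σ σ' I) {f : SpinConfig N n → ℝ}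
    (hf : Continuous f) : Integrable (fun ω => f (σ ω)) P := by
  have : Integrable f (P.map σ) := by
    rw [h.law_spin]
    exact hf.integrable_of_compactSpace
  exact this.comp_measurable h.measurable_spin

omit [IsProbabilityMeasure P] in
theorem setIntegral_preimage_eq {W : Ω → ℝ} (hW : Measurable W) {A : Set ℝ} (hA : MeasurableSet A)
    (f : Ω → ℝ) :
    ∫ ω in W ⁻¹' A, f ω ∂P = ∫ ω, A.indicator (fun _ => 1) (W ω) * f ω ∂P := by
  rw [← integral_indicator (hW hA)]
  refine integral_congr_ae (.of_forall fun ω => ?_)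
  by_cases hω : W ω ∈ A
  · simp [hω]
  · simp [hω]

/-- Conditional expectations given w(σ) are determined by integrals over the events w(σ) ∈ A, whose
indicators are bounded test functions of σ. -/
theorem IsResampling.condExp_inner_sub (hN : 2 ≤ N) (hβ : 0 ≤ β) (h : IsResampling P β σ σ' I)
    {w : SpinConfig N n → ℝ} (hw : Continuous w) (κ : ℝ) :
    (P[fun ω => κ * (⟪localField β (σ ω) (I ω), (σ ω (I ω) : EuclideanSpace ℝ (Fin N))⟫ -
        ⟪localField β (σ ω) (I ω), (σ' ω (I ω) : EuclideanSpace ℝ (Fin N))⟫) |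
        MeasurableSpace.comap (fun ω => w (σ ω)) inferInstance] =ᵐ[P]
      P[fun ω => κ * meanDrift β (σ ω) | MeasurableSpace.comap (fun ω => w (σ ω)) inferInstance]) ∧
    (P[fun ω => (κ * (⟪localField β (σ ω) (I ω), (σ ω (I ω) : EuclideanSpace ℝ (Fin N))⟫ -
        ⟪localField β (σ ω) (I ω), (σ' ω (I ω) : EuclideanSpace ℝ (Fin N))⟫)) ^ 2 |
        MeasurableSpace.comap (fun ω => w (σ ω)) inferInstance] =ᵐ[P]
      P[fun ω => κ ^ 2 * meanQuadratic β (σ ω) |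
        MeasurableSpace.comap (fun ω => w (σ ω)) inferInstance]) := by
  have hW : Measurable fun ω => w (σ ω) := hw.measurable.comp h.measurable_spin
  have hdm := h.measurable_inner_sub
  have hdb := fun ω => abs_inner_sub_inner_le hβ (σ ω) (I ω) (σ' ω (I ω))
  have hmom := fun (A : Set ℝ) (hA : MeasurableSet A) =>
    h.integral_mul_sub hN hβ (Φ := fun τ => A.indicator (fun _ => 1) (w τ)) (K := 1)
      ((measurable_const.indicator hA).comp hw.measurable)
      (fun τ => by by_cases hz : w τ ∈ A <;> simp [hz])
  constructor
  · refine condExp_comap_congr hW ((integrable_of_bounded hdm hdb).const_mul κ)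
      ((h.integrable_comp (continuous_meanDrift hN β)).const_mul κ) fun A hA => ?_
    rw [integral_const_mul, integral_const_mul, setIntegral_preimage_eq hW hA,
      setIntegral_preimage_eq hW hA, (hmom A hA).1]
  · simp_rw [mul_pow]
    refine condExp_comap_congr hW
      ((integrable_of_bounded (hdm.pow_const 2) (K := (2 * β) ^ 2) fun ω => ?_).const_mul (κ ^ 2))
      ((h.integrable_comp (continuous_meanQuadratic hN β)).const_mul (κ ^ 2)) fun A hA => ?_
    · rw [abs_pow]
      exact pow_le_pow_left₀ (abs_nonneg _) (hdb ω) 2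
    · rw [integral_const_mul, integral_const_mul, setIntegral_preimage_eq hW hA,
        setIntegral_preimage_eq hW hA, (hmom A hA).2]

end

/-! ### Assembling the bounds -/

/-- The approximate Stein pair bounds for `(W, W')` with rate `lam`, limiting variance `v`, constant
`C`, and size parameter `n`. -/
def SteinPairBounds {Ω : Type*} [MeasurableSpace Ω] (P : Measure Ω) (W W' : Ω → ℝ) (lam v δ C : ℝ)
    (n : ℕ) : Prop :=
  ((∀ ω, |W ω - W' ω| ≤ δ) ∧ Integrable (fun ω => W ω ^ 2) P ∧ ∫ ω, W ω ^ 2 ∂P ≤ C) ∧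
  (∃ R : Ω → ℝ, Measurable R ∧ Integrable R P ∧
    (P[fun ω => W ω - W' ω | MeasurableSpace.comap W inferInstance]
      =ᵐ[P] fun ω => lam * (W ω + R ω)) ∧ ∫ ω, |R ω| ∂P ≤ C / √(n : ℝ)) ∧
  (∫ ω, |(1 / (2 * lam)) *
    (P[fun ω => (W ω - W' ω) ^ 2 | MeasurableSpace.comap W inferInstance]) ω - v| ∂P ≤ C / √(n : ℝ))

theorem SteinPairBounds.mono {Ω : Type*} [MeasurableSpace Ω] {P : Measure Ω} {W W' : Ω → ℝ}
    {lam v δ C C' : ℝ} {n : ℕ} (h : SteinPairBounds P W W' lam v δ C n) (hC : C ≤ C') :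
    SteinPairBounds P W W' lam v δ C' n := by
  have hd : C / √(n : ℝ) ≤ C' / √(n : ℝ) := by gcongr
  obtain ⟨⟨h1, h2, h3⟩, ⟨R, h4, h5, h6, h7⟩, h8⟩ := h
  exact ⟨⟨h1, h2, h3.trans hC⟩, ⟨R, h4, h5, h6, h7.trans hd⟩, h8.trans hd⟩

set_option maxHeartbeats 1000000 in
theorem exists_steinPairBounds {N : ℕ} (hN : 2 ≤ N) {β b : ℝ} (hβ : (N : ℝ) < β) (hb : 0 < b)
    (hroot : b - β * besselRatio N b = 0) :
    ∃ C : ℝ, 0 < C ∧ ∀ (n : ℕ), 1 ≤ n →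
      ∀ (Ω : Type*) [MeasurableSpace Ω] (P : Measure Ω) [IsProbabilityMeasure P]
        (σ σ' : Ω → SpinConfig N n) (I : Ω → Fin n), IsResampling P β σ σ' I →
        SteinPairBounds P (fun ω => fluctuation n β b (totalSpin (σ ω)))
          (fun ω => fluctuation n β b (totalSpin' (σ ω) (σ' ω) (I ω)))
          ((1 - β * deriv (besselRatio N) b) / n) (limitVariance N β b)
          (4 * β ^ 2 / b ^ 2 / √(n : ℝ)) C n := by
  have : NeZero N := ⟨by omega⟩
  have hβ0 : 0 < β := lt_of_le_of_lt (Nat.cast_nonneg N) hβ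
  have hslope := besselSlope_eq_of_root hb hroot
  obtain ⟨C, hC0, hC⟩ := exists_gibbs_estimates hN hβ hb hslope
  set ℓ := 1 - β * deriv (besselRatio N) b with hℓdef
  have hℓ : ℓ = -(2 * β * b ^ 2 * besselSlopeDeriv N (b ^ 2)) := one_sub_deriv_besselRatio hN hb hroot
  have hℓ0 : 0 < ℓ := by
    have h1 := besselSlopeDeriv_neg hN (show 0 < b ^ 2 by positivity)
    have h2 : 0 < 2 * β * b ^ 2 := by positivity
    rw [hℓ]
    nlinarith
  set q₀ := 2 * tiltedSecondMoment N (b ^ 2) - 2 / β * (b ^ 2 * slopeMul N (b ^ 2)) with hq₀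
  -- At the root p(b²) = 1/β and f(b) = b/β, so the limiting variance is the rescaled value at b² of
  -- the conditional second moment.
  have hv : limitVariance N β b = 2 * β ^ 2 / (b ^ 4 * ℓ) * q₀ := by
    have hp : besselSlope N (b ^ 2) = 1 / β := by
      rw [eq_div_iff hβ0.ne', mul_comm, hslope]
    rw [limitVariance, ← hℓdef, hq₀, tiltedSecondMoment, slopeMul, besselRatio_eq hb, hp]
    field_simp
    ring
  -- The first three summands serve (i), (ii) and (iii) in turn; the 1 ensures positivity, as C may
  -- be 0.
  refine ⟨C / b ^ 4 + 2 * C / (b ^ 2 * ℓ) + 2 * β ^ 2 * C / (b ^ 4 * ℓ) + 1, by positivity, ?_⟩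
  intro n hn Ω _ P _ σ σ' I h
  have hn0 : (0 : ℝ) < n := by exact_mod_cast hn
  have hs0 : 0 < √(n : ℝ) := Real.sqrt_pos.2 hn0
  have hss : √(n : ℝ) ^ 2 = n := Real.sq_sqrt hn0.le
  obtain ⟨hC1, hC2, hC3⟩ := hC n hn
  set w : SpinConfig N n → ℝ := fun τ => fluctuation n β b (totalSpin τ)
  have hweq : ∀ τ, w τ = √(n : ℝ) / b ^ 2 * (‖meanField β τ‖ ^ 2 - b ^ 2) := fun τ =>
    fluctuation_totalSpin b τ hb.ne'
  have hwc : Continuous w := by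
    rw [show w = _ from funext hweq]
    fun_prop
  set W : Ω → ℝ := fun ω => w (σ ω) with hW
  set d : Ω → ℝ := fun ω => ⟪localField β (σ ω) (I ω), (σ ω (I ω) : EuclideanSpace ℝ (Fin N))⟫ -
    ⟪localField β (σ ω) (I ω), (σ' ω (I ω) : EuclideanSpace ℝ (Fin N))⟫
  set κ := √(n : ℝ) / b ^ 2 * (2 * (β / n)) with hκ
  have hκ0 : 0 ≤ κ := by positivity
  set W' : Ω → ℝ := fun ω => fluctuation n β b (totalSpin' (σ ω) (σ' ω) (I ω))
  have hdiff : ∀ ω, W ω - W' ω = κ * d ω := fun ω => fluctuation_sub b hb.ne' (σ ω) (σ' ω) (I ω)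
  have hdb : ∀ ω, |d ω| ≤ 2 * β := fun ω => abs_inner_sub_inner_le hβ0.le (σ ω) (I ω) _
  have hσ := h.measurable_spin
  have hWm : Measurable W := hwc.measurable.comp hσ
  have hm : MeasurableSpace.comap W inferInstance ≤ ‹MeasurableSpace Ω› := hWm.comap_le
  have hWm' : StronglyMeasurable[MeasurableSpace.comap W inferInstance] W :=
    (comap_measurable W).stronglyMeasurable
  have hdc := continuous_meanDrift (N := N) (n := n) hN β
  have hqc := continuous_meanQuadratic (N := N) (n := n) hN β
  have hWi : Integrable W P := h.integrable_comp hwc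
  set D : Ω → ℝ := fun ω => κ * meanDrift β (σ ω) with hD
  set V : Ω → ℝ := fun ω => κ ^ 2 * meanQuadratic β (σ ω) with hV
  have hDi : Integrable D P := (h.integrable_comp hdc).const_mul κ
  have hVi : Integrable V P := (h.integrable_comp hqc).const_mul (κ ^ 2)
  obtain ⟨hcond1, hcond2⟩ := h.condExp_inner_sub hN hβ0.le hwc κ
  replace hcond1 : P[fun ω => W ω - W' ω|MeasurableSpace.comap W inferInstance] =ᵐ[P]
      P[D|MeasurableSpace.comap W inferInstance] := by
    simp_rw [hdiff]
    exact hcond1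
  replace hcond2 : P[fun ω => (W ω - W' ω) ^ 2|MeasurableSpace.comap W inferInstance] =ᵐ[P]
      P[V|MeasurableSpace.comap W inferInstance] := by
    simp_rw [hdiff]
    exact hcond2
  have p1 : 0 ≤ C / b ^ 4 := by positivity
  have p2 : 0 ≤ 2 * C / (b ^ 2 * ℓ) := by positivity
  have p3 : 0 ≤ 2 * β ^ 2 * C / (b ^ 4 * ℓ) := by positivity
  -- The remainder is defined so that the identity in (ii) holds automatically; its content is the
  -- L¹ bound.
  refine ⟨⟨fun ω => ?_, h.integrable_comp (hwc.pow 2), ?_⟩,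
    ⟨fun ω => (ℓ / n)⁻¹ * (P[D|MeasurableSpace.comap W inferInstance]) ω - W ω, ?_, ?_, ?_, ?_⟩, ?_⟩
  · rw [hdiff, abs_mul, abs_of_nonneg hκ0]
    refine (mul_le_mul_of_nonneg_left (hdb ω) hκ0).trans (le_of_eq ?_)
    rw [hκ]
    field_simp
    rw [hss]
    ring
  · rw [h.integral_comp (Φ := fun τ => w τ ^ 2) (hwc.pow 2).measurable]
    simp_rw [hweq, mul_pow, div_pow, hss]
    rw [integral_const_mul]
    have e : (n : ℝ) / (b ^ 2) ^ 2 * (C / n) = C / b ^ 4 := by field_simp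
    have := mul_le_mul_of_nonneg_left hC1 (show 0 ≤ (n : ℝ) / (b ^ 2) ^ 2 by positivity)
    linarith
  · exact ((stronglyMeasurable_condExp.measurable.mono hm le_rfl).const_mul _).sub hWm
  · exact (integrable_condExp.const_mul _).sub hWi
  · filter_upwards [hcond1] with ω hω
    rw [hω, add_sub_cancel, mul_inv_cancel_left₀ (by positivity)]
  · refine (integral_abs_mul_condExp_sub_le hm _ hDi hWm' hWi).trans ?_
    -- Before conditioning, the remainder is exactly √n times a constant times the linearised drift
    -- error, since βb²p'(b²) = -ℓ/2.
    have e : ∀ ω, |(ℓ / n)⁻¹ * D ω - W ω| = 2 * √(n : ℝ) / (b ^ 2 * ℓ) *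
        |β * meanDrift β (σ ω) + β * b ^ 2 * besselSlopeDeriv N (b ^ 2) *
          (‖meanField β (σ ω)‖ ^ 2 - b ^ 2)| := fun ω => by
      rw [← abs_of_nonneg (show 0 ≤ 2 * √(n : ℝ) / (b ^ 2 * ℓ) by positivity), ← abs_mul]
      congr 1
      have : β * b ^ 2 * besselSlopeDeriv N (b ^ 2) = -ℓ / 2 := by rw [hℓ]; ring
      rw [this]
      simp only [hD, hW, hweq, hκ]
      field_simp
      ring
    simp_rw [e]
    rw [integral_const_mul, h.integral_comp (Φ := fun τ => |β * meanDrift β τ +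
      β * b ^ 2 * besselSlopeDeriv N (b ^ 2) * (‖meanField β τ‖ ^ 2 - b ^ 2)|)
      (Continuous.measurable (by fun_prop))]
    refine (mul_le_mul_of_nonneg_left hC2 (by positivity)).trans ?_
    have e2 : 2 * √(n : ℝ) / (b ^ 2 * ℓ) * (C / n) = 2 * C / (b ^ 2 * ℓ) / √(n : ℝ) := by
      rw [eq_div_iff hs0.ne']
      calc _ = 2 * C / (b ^ 2 * ℓ) * (√(n : ℝ) ^ 2 / n) := by ring
        _ = _ := by rw [hss, div_self hn0.ne', mul_one]
    rw [e2]
    gcongr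
    linarith
  · have hae : ∀ᵐ ω ∂P, |1 / (2 * (ℓ / n)) *
        (P[fun ω => (W ω - W' ω) ^ 2|MeasurableSpace.comap W inferInstance]) ω - limitVariance N β b| =
        |1 / (2 * (ℓ / n)) * (P[V|MeasurableSpace.comap W inferInstance]) ω - limitVariance N β b| := by
      filter_upwards [hcond2] with ω hω
      rw [hω]
    rw [integral_congr_ae hae]
    refine (integral_abs_mul_condExp_sub_le hm _ hVi stronglyMeasurable_const (integrable_const _)).trans ?_
    have e : ∀ ω, |1 / (2 * (ℓ / n)) * V ω - limitVariance N β b| = 2 * β ^ 2 / (b ^ 4 * ℓ) *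
        |meanQuadratic β (σ ω) - q₀| := fun ω => by
      rw [← abs_of_nonneg (show 0 ≤ 2 * β ^ 2 / (b ^ 4 * ℓ) by positivity), ← abs_mul, hv,
        mul_sub _ (meanQuadratic β (σ ω)) q₀]
      congr 2
      rw [hV, ← mul_assoc]
      congr 1
      rw [hκ, mul_pow, div_pow, hss]
      field_simp
    simp_rw [e]
    rw [integral_const_mul, h.integral_comp (Φ := fun τ => |meanQuadratic β τ - q₀|)
      (Continuous.measurable (by fun_prop))]
    refine (mul_le_mul_of_nonneg_left hC3 (by positivity)).trans ?_
    rw [← mul_div_assoc]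
    gcongr
    have : 2 * β ^ 2 / (b ^ 4 * ℓ) * C = 2 * β ^ 2 * C / (b ^ 4 * ℓ) := by ring
    linarith

theorem proposition2p1 (β : ℝ) :
    ∃ C : ℝ, 0 < C ∧
      ∀ (N : ℕ), 2 ≤ N → (N : ℝ) < β →
      ∀ (b : ℝ), 0 < b → b - β * besselRatio N b = 0 →
      ∀ (n : ℕ), 1 ≤ n →
      ∀ (Ω : Type*) [MeasurableSpace Ω] (P : Measure Ω) [IsProbabilityMeasure P]
        (σ σ' : Ω → SpinConfig N n) (I : Ω → Fin n), IsResampling P β σ σ' I →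
      ∀ (W W' : Ω → ℝ),
        (W = fun ω => fluctuation n β b (totalSpin (σ ω))) →
        (W' = fun ω => fluctuation n β b (totalSpin' (σ ω) (σ' ω) (I ω))) →
      ∀ (lam : ℝ), lam = (1 - β * deriv (besselRatio N) b) / (n : ℝ) →
        -- (i)
        ((∀ ω, |W ω - W' ω| ≤ 4 * β ^ 2 / b ^ 2 / √(n : ℝ)) ∧
          Integrable (fun ω => W ω ^ 2) P ∧ ∫ ω, W ω ^ 2 ∂P ≤ C) ∧
        -- (ii)
        (∃ R : Ω → ℝ, Measurable R ∧ Integrable R P ∧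
          (P[fun ω => W ω - W' ω | MeasurableSpace.comap W inferInstance]
            =ᵐ[P] fun ω => lam * (W ω + R ω)) ∧
          ∫ ω, |R ω| ∂P ≤ C / √(n : ℝ)) ∧
        -- (iii)
        (∫ ω, |(1 / (2 * lam)) *
              (P[fun ω => (W ω - W' ω) ^ 2 | MeasurableSpace.comap W inferInstance]) ω
              - limitVariance N β b| ∂P ≤ C / √(n : ℝ)) := by
  -- For each N the root is unique, so the constant can be chosen before b; if no admissible root
  -- exists, any positive constant will do.
  have hex : ∀ N : ℕ, ∃ C : ℝ, 0 < C ∧ (2 ≤ N → (N : ℝ) < β →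
      ∀ (b : ℝ), 0 < b → b - β * besselRatio N b = 0 → ∀ (n : ℕ), 1 ≤ n →
      ∀ (Ω : Type _) [MeasurableSpace Ω] (P : Measure Ω) [IsProbabilityMeasure P]
        (σ σ' : Ω → SpinConfig N n) (I : Ω → Fin n), IsResampling P β σ σ' I →
        SteinPairBounds P (fun ω => fluctuation n β b (totalSpin (σ ω)))
          (fun ω => fluctuation n β b (totalSpin' (σ ω) (σ' ω) (I ω)))
          ((1 - β * deriv (besselRatio N) b) / n) (limitVariance N β b)
          (4 * β ^ 2 / b ^ 2 / √(n : ℝ)) C n) := by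
    intro N
    by_cases hroot : 2 ≤ N ∧ (N : ℝ) < β ∧ ∃ b : ℝ, 0 < b ∧ b - β * besselRatio N b = 0
    · obtain ⟨hN, hβ, b₀, hb₀, hr₀⟩ := hroot
      obtain ⟨C, hC0, hC⟩ := exists_steinPairBounds hN hβ hb₀ hr₀
      refine ⟨C, hC0, fun _ _ b hb hr => ?_⟩
      obtain rfl := root_unique hN hb hb₀ hr hr₀
      exact hC
    · exact ⟨1, one_pos, fun hN hβ b hb hr => absurd ⟨hN, hβ, b, hb, hr⟩ hroot⟩
  choose C hC0 hC using hex
  -- Every N < β lies in this finite range, and the bounds are monotone in the constant, so the sum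
  -- serves all N at once.
  refine ⟨∑ N ∈ Finset.range (⌈β⌉₊ + 1), C N, Finset.sum_pos (fun N _ => hC0 N) ⟨0, by simp⟩, ?_⟩
  rintro N hN hβ b hb hr n hn Ω _ P _ σ σ' I h W W' rfl rfl lam rfl
  have hmem : N ∈ Finset.range (⌈β⌉₊ + 1) :=
    Finset.mem_range.2 (Nat.lt_succ_of_lt (Nat.lt_ceil.2 hβ))
  exact (hC N hN hβ b hb hr n hn Ω P σ σ' I h).mono
    (Finset.single_le_sum (fun N _ => (hC0 N).le) hmem)
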